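/- Let $G$ be a finite connected graph without loops or multiple edges, with $n>1$ vertices and vertex set $\mathcal V$, and let $w_{xy}=w_{yx}>0$ be edge weights. Set $w_{xy}=0$ if $x\not\sim y$, and $p_{xy}=w_{xy}/\sum_z w_{xz}$. An oriented cycle of $G$ is a cyclic word $(x_0\,x_1\cdots x_{m-1})$, $m\ge 2$, of distinct vertices in which cyclically consecutive ones are adjacent (backtracks, $m=2$, are included). Each oriented cycle $c$ has a weight $\alpha(c)\in[0,1]$, and $\alpha(c)>0$ for at least one oriented cycle. **Algorithm.** For each vertex $x$ let $(X^x_k)_{k\ge0}$ be a Markov chain started at $x$ with transition probabilities $p$, and for each vertex $x$, oriented cycle $c$ and $k\ge0$ let $B^x_{c,k}$ be a Bernoulli variable of parameter $\alpha(c)$, all chains and Bernoulli variables being mutually independent. Fix an ordering $\iota$ of the vertices. CyclePopping starts from the empty set $\mathcal V_0=\emptyset$ of visited vertices. While $\mathcal V_\ell\neq\mathcal V$, let $x$ be the first vertex, in the order $\iota$, not in $\mathcal V_\ell$; run $X^x$ and keep its chronological loop erasure, until the first time $\tau$ at which either $X^x_\tau\in\mathcal V_\ell$, or the walk closes a cycle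 $c$ with the current loop-erased path and $B^x_{c,\tau}=1$ ($c$ is accepted); a cycle $c$ closed at time $k$ with $B^x_{c,k}=0$ is popped, i.e. erased from the path. Then $\mathcal V_{\ell+1}$ is $\mathcal V_\ell$ together with the vertices of the branch or lasso obtained. Let $T\in\{0,1,\dots\}\cup\{\infty\}$ be the total number of Markov chain steps, i.e. the sum of the times $\tau$ over all iterations. **Loop measure.** A based loop $\gamma$ is a closed path $(x_0,\dots,x_k)$ of $G$, $x_k=x_0$ (trivial if $k=0$), of length $|\gamma|=k$; an unbased loop $[\gamma]$ is the class of $\gamma$ under cyclic shifts of the base point, and $\mathrm L$ is the set of unbased loops. Let $\mathrm{cycles}(\gamma)$ be the multiset of oriented cycles that are erased, chronologically, along $\gamma$, and put $$\mu_\alpha(\gamma)=\prod_{i=0}^{k-1}p_{x_ix_{i+1}}\prod_{c\in\mathrm{cycles}(\gamma)}(1-\alpha(c)),\qquad \mu_\alpha([\gamma])=\sum_{\gamma'\in[\gamma]}\mu_\alpha(\gamma'),\qquad m_\alpha([\gamma])=\frac{\mu_\alpha([\gamma])}{|\gamma|}\ \text{ if }|\gamma|\ge2,$$ and $m_\alpha([\gamma])=0$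 if $|\gamma|=0$; the sum defining $\mu_\alpha([\gamma])$ runs over the distinct based loops in the class $[\gamma]$. **Conclusion.** $T<\infty$ almost surely, and $$T\ \stackrel{\text{(law)}}{=}\ n+\sum_{[\gamma]\in\mathcal X}|\gamma|,$$ where $\mathcal X$ is a Poisson point process on $\mathrm L$ with intensity $m_\alpha$. Moreover $m_\alpha(\mathrm L)<\infty$, and for all $t\in(0,1]$ $$\mathbb E[t^T]=t^n\exp\Big(\sum_{[\gamma]\in\mathrm L}(t^{|\gamma|}-1)\,m_\alpha([\gamma])\Big).$$ -/

import Mathlib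

open MeasureTheory ProbabilityTheory
open scoped ENNReal

noncomputable section

namespace CyclePopping

/-! ### Oriented cycles, edge weights and the simple random walk -/

section Graph

variable {V : Type*}

/-- An oriented cycle of `G`, with its base point forgotten: the cyclic word `(x₀ x₁ … xₘ₋₁)` stands
for the closed path `(x₀, x₁, …, xₘ₋₁, x₀)`; the vertices are distinct and cyclically consecutive
ones are adjacent. The length `m = 2` gives the backtracks. -/
def IsOrientedCycle (G : SimpleGraph V) (c : Cycle V) : Prop :=
  2 ≤ c.length ∧ c.Nodup ∧ c.Chain G.Adj

/-- The type of oriented cycles of `G`, backtracks included. -/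
abbrev OrientedCycle (G : SimpleGraph V) : Type _ := {c : Cycle V // IsOrientedCycle G c}

/-- `W` is a symmetric system of edge weights for `G`: positive on edges, zero elsewhere. -/
structure IsEdgeWeight (G : SimpleGraph V) (W : Matrix V V ℝ) : Prop where
  symm : W.IsSymm
  pos : ∀ x y, G.Adj x y → 0 < W x y
  zero : ∀ x y, ¬ G.Adj x y → W x y = 0

/-- The transition probability `p_{xy} = w_{xy} / deg(x)` of the simple random walk. -/
def transition [Fintype V] (W : Matrix V V ℝ) (x y : V) : ℝ :=
  W x y / ∑ z, W x z

end Graph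

/-! ### Chronological loop erasure -/

section Erasure

variable {V : Type*} [DecidableEq V]

/-- One step of the chronological loop erasure. `p` is the current self-avoiding path and `v` the
next vertex of the walk: if `v` is not on `p`, it is appended; otherwise the cycle just closed at `v`
is erased, and the path ends at `v`. -/
def eraseStep (p : List V) (v : V) : List V :=
  if v ∈ p then p.takeWhile (fun u => decide (u ≠ v)) ++ [v] else p ++ [v]

/-- The cycle that is closed when the walk, whose current loop-erased path is `p`, moves to a vertex
`v` of `p`. -/
def closedCycle (p : List V) (v : V) : Cycle V :=
  (p.dropWhile (fun u => decide (u ≠ v)) : List V)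

/-- The cycles, with multiplicity, erased while the vertices of a list are visited in order, starting
with the current self-avoiding path `p`. -/
def erasedCycles (p : List V) : List V → Multiset (Cycle V)
  | [] => 0
  | v :: l =>
    if v ∈ p then closedCycle p v ::ₘ erasedCycles (eraseStep p v) l
    else erasedCycles (eraseStep p v) l

end Erasure

/-! ### Based loops, unbased loops, and the loop measures -/

section Loops

variable {V : Type*}

/-- A based loop: a closed path `(x₀, …, xₖ₋₁, x₀)` of `G`. The path of length zero at a vertex is a
(trivial) based loop; as `G` has no self-loop, the others have length at least two. -/
abbrev BasedLoop (G : SimpleGraph V) : Type _ := Σ x : V, G.Walk x x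

/-- Two based loops are shifts of one another if the first is `p` followed by `q` and the second is `q`
followed by `p`, for some path `p` from `x` to `y` and some path `q` from `y` to `x`. -/
def IsShift (G : SimpleGraph V) (γ γ' : BasedLoop G) : Prop :=
  ∃ (x y : V) (p : G.Walk x y) (q : G.Walk y x),
    γ = ⟨x, p.append q⟩ ∧ γ' = ⟨y, q.append p⟩

/-- Unbased loops: based loops up to shifts. -/
def UnbasedLoop (G : SimpleGraph V) : Type _ := Quot (IsShift G)

/-- The unbased loop `[γ]` of a based loop `γ`. -/
def UnbasedLoop.mk {G : SimpleGraph V} (γ : BasedLoop G) : UnbasedLoop G := Quot.mk _ γ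

/-- The number of edges `|γ|` of an unbased loop `[γ]`. -/
def UnbasedLoop.length {G : SimpleGraph V} : UnbasedLoop G → ℕ :=
  Quot.lift (fun γ => γ.2.length) (by
    rintro _ _ ⟨x, y, p, q, rfl, rfl⟩
    simp [SimpleGraph.Walk.length_append, add_comm])

/-- The set of unbased loops is discrete. -/
instance (G : SimpleGraph V) : MeasurableSpace (UnbasedLoop G) := ⊤

variable [Fintype V]

/-- `q(γ)`: the product of the transition probabilities along the based loop `γ`. -/
def stepWeight {G : SimpleGraph V} (W : Matrix V V ℝ) (γ : BasedLoop G) : ℝ :=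
  (γ.2.darts.map (fun d => transition W d.fst d.snd)).prod

variable [DecidableEq V]

/-- `cycles(γ)`: the multiset of oriented cycles chronologically erased along the based loop `γ`. -/
def cycles {G : SimpleGraph V} (γ : BasedLoop G) : Multiset (Cycle V) :=
  erasedCycles [] γ.2.support

/-- The measure `μ_α(γ) = q(γ) ∏_{c ∈ cycles(γ)} (1 - α(c))` of a based loop (which is `1` if `γ` is
trivial). -/
def basedMeasure {G : SimpleGraph V} (W : Matrix V V ℝ) (α : Cycle V → ℝ) (γ : BasedLoop G) : ℝ :=
  stepWeight W γ * ((cycles γ).map (fun c => 1 - α c)).prod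

/-- The measure `μ_α([γ])` of an unbased loop: the (finite) sum of `μ_α` over all its based
representatives. -/
def unbasedMeasure {G : SimpleGraph V} (W : Matrix V V ℝ) (α : Cycle V → ℝ) (ℓ : UnbasedLoop G) :
    ℝ :=
  ∑' γ : {γ : BasedLoop G // UnbasedLoop.mk γ = ℓ}, basedMeasure W α γ.1

/-- `m_α([γ]) = μ_α([γ]) / |γ|`, and `0` for trivial loops. -/
def loopMass {G : SimpleGraph V} (W : Matrix V V ℝ) (α : Cycle V → ℝ) (ℓ : UnbasedLoop G) : ℝ :=
  if ℓ.length = 0 then 0 else unbasedMeasure W α ℓ / ℓ.length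

/-- `m_α` as a measure on the set of unbased loops. -/
def loopIntensity (G : SimpleGraph V) (W : Matrix V V ℝ) (α : Cycle V → ℝ) :
    Measure (UnbasedLoop G) :=
  Measure.sum fun ℓ => ENNReal.ofReal (loopMass W α ℓ) • Measure.dirac ℓ

end Loops

/-! ### Poisson point processes -/

section Poisson

/-- The Poisson law of parameter `r ∈ [0, ∞]`, as a law on `[0, ∞]`; for `r = ∞` it is the point mass
at `∞`. -/
def poissonLaw (r : ℝ≥0∞) : Measure ℝ≥0∞ :=
  if r = ∞ then Measure.dirac ∞ else (poissonMeasure r.toNNReal).map (fun k : ℕ => (k : ℝ≥0∞))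

/-- `N` is a Poisson point process on `E` with intensity measure `Λ` on the probability space `(Ω, Q)`;
it is seen as a random counting measure, `N ω A` being the number of points in `A`, counted with
multiplicity. -/
structure IsPoissonProcess {Ω E : Type*} [MeasurableSpace Ω] [MeasurableSpace E]
    (Λ : Measure E) (N : Ω → Measure E) (Q : Measure Ω) : Prop where
  measurable : Measurable N
  integer_valued : ∀ᵐ ω ∂Q, ∀ A, MeasurableSet A → ∃ k : ℕ∞, N ω A = (k : ℝ≥0∞)
  law : ∀ A, MeasurableSet A → Q.map (fun ω => N ω A) = poissonLaw (Λ A)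
  indep : ∀ (m : ℕ) (A : Fin m → Set E), (∀ i, MeasurableSet (A i)) →
    Pairwise (fun i j => Disjoint (A i) (A j)) → iIndepFun (fun i ω => N ω (A i)) Q

end Poisson

/-! ### The algorithm -/

section Deterministic

variable {V : Type*} [DecidableEq V]

/-- The loop-erased path of the walk `X` at time `k`, when every cycle closed so far is erased. -/
def loopErased (X : ℕ → V) : ℕ → List V
  | 0 => [X 0]
  | k + 1 => eraseStep (loopErased X k) (X (k + 1))

/-- The cycle `c` is formed by the walk `X` at time `k`: the step to `X k` hits the current loop-erased
path and closes `c`. -/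
def FormedAt (X : ℕ → V) (k : ℕ) (c : Cycle V) : Prop :=
  ∃ j, k = j + 1 ∧ X k ∈ loopErased X j ∧ c = closedCycle (loopErased X j) (X k)

/-- The walk `X` with acceptance bits `b` meets the stopping criterion at time `k`: either it is in `A`,
or a cycle is formed at time `k` and accepted. -/
def StopsAt {G : SimpleGraph V} (X : ℕ → V) (b : OrientedCycle G → ℕ → Bool) (A : Finset V) (k : ℕ) :
    Prop :=
  X k ∈ A ∨ ∃ c : OrientedCycle G, FormedAt X k c.1 ∧ b c k = true

/-- The first time at which the stopping criterion is met, `∞` if there is none. -/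
def stopTime {G : SimpleGraph V} (X : ℕ → V) (b : OrientedCycle G → ℕ → Bool) (A : Finset V) : ℕ∞ :=
  sInf {k : ℕ∞ | ∃ j : ℕ, k = j ∧ StopsAt X b A j}

/-- The vertices of the branch or lasso obtained by loop erasure of `(X 0, …, X k)`, the last cycle
formed, if it is formed at time `k`, being kept: those of the loop-erased path just before time `k`,
and the last position `X k`. -/
def newVertices (X : ℕ → V) (k : ℕ) : Finset V :=
  insert (X k) (loopErased X (k - 1)).toFinset

variable [Fintype V]

/-- The starting vertex of the next walk: the first vertex, in the order `ι`, that is not in `S`, if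
there is one. -/
def nextStart (ι : Fin (Fintype.card V) ≃ V) (S : Finset V) : Option V :=
  ((List.finRange (Fintype.card V)).map ι).find? (fun v => decide (v ∉ S))

/-- The number of Markov chain steps made in one iteration from the visited set `S`. -/
def iterSteps {G : SimpleGraph V} (ι : Fin (Fintype.card V) ≃ V) (X : V → ℕ → V)
    (b : V → OrientedCycle G → ℕ → Bool) (S : Finset V) : ℕ∞ :=
  match nextStart ι S with
  | none => 0
  | some x => stopTime (X x) (b x) S

/-- The visited set after one iteration from the visited set `S` (an iteration that never stops leaves
it unchanged). -/
def iterVertices {G : SimpleGraph V} (ι : Fin (Fintype.card V) ≃ V) (X : V → ℕ → V)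
    (b : V → OrientedCycle G → ℕ → Bool) (S : Finset V) : Finset V :=
  match nextStart ι S with
  | none => S
  | some x =>
    if stopTime (X x) (b x) S = ⊤ then S
    else S ∪ newVertices (X x) (stopTime (X x) (b x) S).toNat

/-- The vertex set of the subgraph built by the first `l` iterations. The edges of the subgraph
influence neither the later iterations nor the number of steps. -/
def vertexSet {G : SimpleGraph V} (ι : Fin (Fintype.card V) ≃ V) (X : V → ℕ → V)
    (b : V → OrientedCycle G → ℕ → Bool) : ℕ → Finset V
  | 0 => ∅
  | l + 1 => iterVertices ι X b (vertexSet ι X b l)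

/-- The total number of Markov chain steps made by the algorithm, `∞` if it does not terminate. Each
iteration that stops adds its starting vertex to the visited set, so that there are at most as many
iterations as vertices; iterations after completion count for `0`. -/
def totalSteps {G : SimpleGraph V} (ι : Fin (Fintype.card V) ≃ V) (X : V → ℕ → V)
    (b : V → OrientedCycle G → ℕ → Bool) : ℕ∞ :=
  ∑ l ∈ Finset.range (Fintype.card V), iterSteps ι X b (vertexSet ι X b l)

end Deterministic

section Random

variable {V : Type*} [Fintype V] [DecidableEq V] [MeasurableSpace V]

/-- The random input of the algorithm on the probability space `(Ω, P)`: for each vertex `x`, a simple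
random walk `X x` started at `x`, and for each vertex `x` and oriented cycle `c`, a sequence `B x c` of
Bernoulli variables with success probability `α(c)`; the walks and all Bernoulli variables are mutually
independent. -/
structure IsRandomInput {Ω : Type*} [MeasurableSpace Ω] {G : SimpleGraph V} (W : Matrix V V ℝ)
    (α : Cycle V → ℝ) (P : Measure Ω) (X : V → ℕ → Ω → V)
    (B : V → OrientedCycle G → ℕ → Ω → Bool) : Prop where
  measurable_walk : ∀ x k, Measurable (X x k)
  measurable_bit : ∀ x c k, Measurable (B x c k)
  walk_law : ∀ (x : V) (k : ℕ) (y : ℕ → V),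
    P {ω | ∀ i ≤ k, X x i ω = y i} =
      ENNReal.ofReal ((if y 0 = x then 1 else 0) *
        ∏ i ∈ Finset.range k, transition W (y i) (y (i + 1)))
  bit_law : ∀ x c k, P {ω | B x c k ω = true} = ENNReal.ofReal (α c.1)
  walk_indep : iIndepFun (fun (x : V) (ω : Ω) (k : ℕ) => X x k ω) P
  bit_indep : iIndepFun
    (fun (s : V × OrientedCycle G × ℕ) (ω : Ω) => B s.1 s.2.1 s.2.2 ω) P
  indep : IndepFun (fun (ω : Ω) (s : V × ℕ) => X s.1 s.2 ω)
    (fun (ω : Ω) (s : V × OrientedCycle G × ℕ) => B s.1 s.2.1 s.2.2 ω) P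

/-- The random number `T` of Markov chain steps to complete the algorithm. -/
def runningTime {Ω : Type*} {G : SimpleGraph V} (ι : Fin (Fintype.card V) ≃ V)
    (X : V → ℕ → Ω → V) (B : V → OrientedCycle G → ℕ → Ω → Bool) (ω : Ω) : ℕ∞ :=
  totalSteps ι (fun x k => X x k ω) (fun x c k => B x c k ω)

end Random

end CyclePopping

end

/-!
The law of `T` is computed through its generating function, with the loop-erased path of the walk as a
Markov chain. From the unvisited set `U`, this chain moves by the kernel `pathKernel` until it is
killed, by leaving `U` or by accepting a cycle. Everything is expressed by the alternating sums

  `D_t(U) = ∑ (-1) ^ k ∏ t ^ |cᵢ| wt(cᵢ)` (`cycleSum`)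

over the families `{c₁, …, cₖ}` of disjoint cycles in `U`, where `wt(c)` is the product of the transition
probabilities along `c` and of the probability `1 - α(c)` that `c` is popped. This is the heap-of-pieces
inversion of the sum over popped cycles; for `α = 0` it is the determinant of `1 - t p` restricted to `U`,
which is no longer available for general `α`.

* Green function. Removing the cycle through a given vertex gives a recurrence for `D_t`
  (`cycleSum_recurrence`). It says that `h(q) = t ^ (|q| - 1) w(q) D_t(U \ q)` solves the Green equation
  of the kernel (`greenNumerator_eq`), so that `∑ₖ t ^ k Kᵏ([x], q) = h(q) / D_t(U)`
  (`hasSum_pathKernel`): directly for `t < 1`, and by Abel's theorem at `t = 1`. Summing the Green equation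
  over `q` (`sum_greenNumerator_mul`) gives `D_t(U) > 0` by induction on `U`; at `t = 1` this uses that `G`
  is connected and that some cycle can be accepted (`cycleSum_one_pos`).
* The algorithm. If `T_S` is the number of steps made from the visited set `S` and `U` is the complement
  of `S`, then `E[t ^ T_S] = t ^ |U| D_1(U) / D_t(U)` (`lintegral_stepGen`). Indeed the walk of the next
  iteration is independent of what follows, as its starting vertex has been visited from then on; and in
  the sum over the loop-erased path `q` at the end of the iteration, the factors `D_t(U \ q)` of the Green
  function and of the induction hypothesis cancel, which leaves the conservation of mass at `t = 1`. For
  `S = ∅` and `t = 1` this is the almost sure termination.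
* Loops. A closed walk from `x` is exactly one that ends with the loop-erased path `[x]`, so the loop
  measure is read off the diagonal entries of the powers of the kernel (`closedWeight`,
  `hasSum_loopMass`). By the Green function, the logarithmic derivative of `D_t` is minus their
  generating function, so `D_t(V) = exp (- ∑ t ^ |ℓ| m_α(ℓ))` (`cycleSum_eq_exp`). With the previous point
  this is the formula for `E[t ^ T]`.
* Poisson process. The same function is the generating function of `n + ∑ |ℓ|` over a Poisson process of
  loops (`IsPoissonProcess.lintegral_expNeg`), and a law on the nonnegative integers is determined by
  its generating function on `(0, 1)` (`identDistrib_of_lintegral_expNeg`).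
-/

noncomputable section

namespace CyclePopping

/-! ### The alternating sum over families of disjoint pieces -/

section Pieces

variable {V C : Type*} [DecidableEq V] [Fintype C] [DecidableEq C]

open Classical in
/-- The families of pieces with non-empty, pairwise disjoint supports contained in `U`. -/
def disjointFamilies (supp : C → Finset V) (U : Finset V) : Finset (Finset C) :=
  {S | (S : Set C).PairwiseDisjoint supp ∧ ∀ c ∈ S, (supp c).Nonempty ∧ supp c ⊆ U}

/-- The alternating sum `D_t(U) = ∑_S ∏_{c ∈ S} (- t ^ |c| wt(c))` over the families `S` of disjoint
pieces in `U`; its inverse is the generating function of the heaps of pieces in `U`. -/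
def alternatingSum (supp : C → Finset V) (wt : C → ℝ) (U : Finset V) (t : ℝ) : ℝ :=
  ∑ S ∈ disjointFamilies supp U, ∏ c ∈ S, -(t ^ (supp c).card * wt c)

variable {supp : C → Finset V} {wt : C → ℝ} {U : Finset V} {t : ℝ}

lemma mem_disjointFamilies {S : Finset C} : S ∈ disjointFamilies supp U ↔
    (S : Set C).PairwiseDisjoint supp ∧ ∀ c ∈ S, (supp c).Nonempty ∧ supp c ⊆ U := by
  simp [disjointFamilies]

lemma alternatingSum_empty : alternatingSum supp wt ∅ t = 1 := by
  have : disjointFamilies supp (∅ : Finset V) = {∅} := by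
    ext S
    rw [mem_disjointFamilies, Finset.mem_singleton]
    constructor
    · rintro ⟨-, h⟩
      refine Finset.eq_empty_of_forall_notMem fun c hc => ?_
      obtain ⟨⟨v, hv⟩, h2⟩ := h c hc
      exact absurd (h2 hv) (Finset.notMem_empty v)
    · rintro rfl
      simp
  simp [alternatingSum, this]

lemma alternatingSum_zero : alternatingSum supp wt U 0 = 1 := by
  rw [alternatingSum, Finset.sum_eq_single ∅]
  · simp
  · intro S hS hne
    obtain ⟨c, hc⟩ := Finset.nonempty_iff_ne_empty.2 hne
    refine Finset.prod_eq_zero hc ?_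
    have := ((mem_disjointFamilies.1 hS).2 c hc).1
    rw [zero_pow (Finset.card_pos.2 this).ne']
    simp
  · intro h
    exact absurd (mem_disjointFamilies.2 (by simp)) h

/-- A family either avoids the vertex `v`, or it consists of exactly one piece through `v` and of a
family that is disjoint from this piece. -/
lemma alternatingSum_recurrence (v : V) :
    alternatingSum supp wt (U.erase v) t = alternatingSum supp wt U t +
      ∑ c with v ∈ supp c ∧ supp c ⊆ U,
        t ^ (supp c).card * wt c * alternatingSum supp wt (U \ supp c) t := by
  classical
  have h1 : (disjointFamilies supp U).filter (fun S => ∀ c ∈ S, v ∉ supp c) =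
      disjointFamilies supp (U.erase v) := by
    ext S
    simp only [Finset.mem_filter, mem_disjointFamilies, Finset.subset_erase]
    constructor
    · rintro ⟨⟨h, h'⟩, h''⟩
      exact ⟨h, fun c hc => ⟨(h' c hc).1, (h' c hc).2, h'' c hc⟩⟩
    · rintro ⟨h, h'⟩
      exact ⟨⟨h, fun c hc => ⟨(h' c hc).1, (h' c hc).2.1⟩⟩, fun c hc => (h' c hc).2.2⟩
  have h2 : ∑ S ∈ (disjointFamilies supp U).filter (fun S => ¬ ∀ c ∈ S, v ∉ supp c),
        ∏ c ∈ S, -(t ^ (supp c).card * wt c) =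
      -∑ c with v ∈ supp c ∧ supp c ⊆ U,
        t ^ (supp c).card * wt c * alternatingSum supp wt (U \ supp c) t := by
    simp only [alternatingSum, Finset.mul_sum, ← Finset.sum_neg_distrib]
    rw [Finset.sum_sigma']
    symm
    refine Finset.sum_bij (fun x _ => insert x.1 x.2) ?_ ?_ ?_ ?_
    · rintro ⟨c, S⟩ h
      simp only [Finset.mem_sigma, Finset.mem_filter, Finset.mem_univ, true_and,
        mem_disjointFamilies, Finset.subset_sdiff] at h
      obtain ⟨⟨hvc, hcU⟩, hS, hS'⟩ := h
      simp only [Finset.mem_filter, mem_disjointFamilies]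
      refine ⟨⟨?_, ?_⟩, ?_⟩
      · rw [Finset.coe_insert]
        exact hS.insert fun d hd _ => (hS' d hd).2.2.symm
      · intro d hd
        rcases Finset.mem_insert.1 hd with rfl | hd
        · exact ⟨⟨v, hvc⟩, hcU⟩
        · exact ⟨(hS' d hd).1, (hS' d hd).2.1⟩
      · intro h
        exact h c (Finset.mem_insert_self _ _) hvc
    · rintro ⟨c, S⟩ h ⟨c', S'⟩ h' heq
      simp only [Finset.mem_sigma, Finset.mem_filter, Finset.mem_univ, true_and,
        mem_disjointFamilies, Finset.subset_sdiff] at h h'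
      obtain ⟨⟨hvc, hcU⟩, hS, hS'⟩ := h
      obtain ⟨⟨hvc', hcU'⟩, hS2, hS2'⟩ := h'
      simp only at heq
      have hc : c = c' := by
        by_contra hne
        have : c ∈ insert c' S' := heq ▸ Finset.mem_insert_self _ _
        rcases Finset.mem_insert.1 this with h | h
        · exact hne h
        · exact Finset.disjoint_left.1 (hS2' c h).2.2 hvc hvc'
      subst hc
      have n1 : c ∉ S := fun h => Finset.disjoint_left.1 (hS' c h).2.2 hvc hvc
      have n2 : c ∉ S' := fun h => Finset.disjoint_left.1 (hS2' c h).2.2 hvc hvc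
      have : S = S' := by
        rw [← Finset.erase_insert n1, heq, Finset.erase_insert n2]
      rw [this]
    · intro S hS
      simp only [Finset.mem_filter, mem_disjointFamilies, not_forall, not_not] at hS
      obtain ⟨⟨hd, hS⟩, c, hc, hvc⟩ := hS
      refine ⟨⟨c, S.erase c⟩, ?_, Finset.insert_erase hc⟩
      simp only [Finset.mem_sigma, Finset.mem_filter, Finset.mem_univ, true_and,
        mem_disjointFamilies, Finset.subset_sdiff]
      refine ⟨⟨hvc, (hS c hc).2⟩, hd.subset (by simp), fun d hdS => ?_⟩
      obtain ⟨hne, hdS⟩ := Finset.mem_erase.1 hdS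
      exact ⟨(hS d hdS).1, (hS d hdS).2, hd hdS hc hne⟩
    · rintro ⟨c, S⟩ h
      simp only [Finset.mem_sigma, Finset.mem_filter, Finset.mem_univ, true_and,
        mem_disjointFamilies, Finset.subset_sdiff] at h
      obtain ⟨⟨hvc, hcU⟩, hS, hS'⟩ := h
      have n1 : c ∉ S := fun h => Finset.disjoint_left.1 (hS' c h).2.2 hvc hvc
      rw [Finset.prod_insert n1]
      ring
  have h3 : alternatingSum supp wt U t = _ + _ :=
    (Finset.sum_filter_add_sum_filter_not (disjointFamilies supp U)
      (fun S => ∀ c ∈ S, v ∉ supp c) _).symm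
  rw [h1, h2] at h3
  rw [h3]
  simp [alternatingSum]

lemma continuous_alternatingSum : Continuous (alternatingSum supp wt U) := by
  unfold alternatingSum
  fun_prop

/-- The derivative of `D_t(U)` counts the covered vertices of a family; the vertices that a family
does not cover are counted by the sums `D_t(U \ {x})`. -/
lemma hasDerivAt_alternatingSum (ht : t ≠ 0) :
    HasDerivAt (alternatingSum supp wt U)
      (t⁻¹ * ∑ x ∈ U, (alternatingSum supp wt U t - alternatingSum supp wt (U.erase x) t)) t := by
  classical
  have key : ∀ s, ∀ S ∈ disjointFamilies supp U, ∏ c ∈ S, -(s ^ (supp c).card * wt c) =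
      s ^ (∑ c ∈ S, (supp c).card) * ∏ c ∈ S, -wt c := by
    intro s S _
    rw [← Finset.prod_pow_eq_pow_sum, ← Finset.prod_mul_distrib]
    exact Finset.prod_congr rfl fun c _ => by ring
  have hfun : alternatingSum supp wt U = fun s => ∑ S ∈ disjointFamilies supp U,
      s ^ (∑ c ∈ S, (supp c).card) * ∏ c ∈ S, -wt c := by
    funext s
    exact Finset.sum_congr rfl (key s)
  have hder : HasDerivAt (fun s => ∑ S ∈ disjointFamilies supp U,
      s ^ (∑ c ∈ S, (supp c).card) * ∏ c ∈ S, -wt c)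
      (∑ S ∈ disjointFamilies supp U, ((∑ c ∈ S, (supp c).card : ℕ) *
        t ^ (∑ c ∈ S, (supp c).card - 1)) * ∏ c ∈ S, -wt c) t :=
    HasDerivAt.fun_sum fun S _ => (hasDerivAt_pow _ t).mul_const _
  rw [hfun]
  convert hder using 1
  rw [← hfun]
  have hx : ∀ x ∈ U, alternatingSum supp wt U t - alternatingSum supp wt (U.erase x) t =
      ∑ S ∈ disjointFamilies supp U, if ∃ c ∈ S, x ∈ supp c then
        ∏ c ∈ S, -(t ^ (supp c).card * wt c) else 0 := by
    intro x hx
    have h1 : (disjointFamilies supp U).filter (fun S => ¬ ∃ c ∈ S, x ∈ supp c) =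
        disjointFamilies supp (U.erase x) := by
      ext S
      simp only [Finset.mem_filter, mem_disjointFamilies, Finset.subset_erase]
      constructor
      · rintro ⟨⟨h, h'⟩, h''⟩
        exact ⟨h, fun c hc => ⟨(h' c hc).1, (h' c hc).2, fun hh => h'' ⟨c, hc, hh⟩⟩⟩
      · rintro ⟨h, h'⟩
        exact ⟨⟨h, fun c hc => ⟨(h' c hc).1, (h' c hc).2.1⟩⟩,
          fun ⟨c, hc, hh⟩ => (h' c hc).2.2 hh⟩
    rw [alternatingSum, alternatingSum, ← h1, ← Finset.sum_filter, sub_eq_iff_eq_add,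
      Finset.sum_filter_add_sum_filter_not]
  rw [Finset.sum_congr rfl hx, Finset.sum_comm, Finset.mul_sum]
  refine Finset.sum_congr rfl fun S hS => ?_
  obtain ⟨hd, hS'⟩ := mem_disjointFamilies.1 hS
  have hcard : (U.filter fun x => ∃ c ∈ S, x ∈ supp c).card = ∑ c ∈ S, (supp c).card := by
    rw [← Finset.card_biUnion fun c hc d hd' hne => hd hc hd' hne]
    congr 1
    ext x
    simp only [Finset.mem_filter, Finset.mem_biUnion]
    exact ⟨fun h => h.2, fun ⟨c, hc, hx⟩ => ⟨(hS' c hc).2 hx, c, hc, hx⟩⟩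
  rw [← Finset.sum_filter, Finset.sum_const, hcard, nsmul_eq_mul, key t S hS]
  rcases Nat.eq_zero_or_pos (∑ c ∈ S, (supp c).card) with h0 | h0
  · simp [h0]
  · obtain ⟨m, hm⟩ := Nat.exists_eq_succ_of_ne_zero h0.ne'
    rw [hm, Nat.succ_sub_one, pow_succ]
    field_simp

end Pieces

/-! ### Weights of paths and cycles -/

section Weights

variable {V : Type*}

/-- The product of the weights `p` of the steps of a path. -/
def pathWeight (p : V → V → ℝ) : List V → ℝ
  | [] => 1
  | [_] => 1
  | x :: y :: l => p x y * pathWeight p (y :: l)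

/-- The product of the weights of the steps of the closed path that visits a list and returns to its
first vertex. -/
def closedPathWeight (p : V → V → ℝ) : List V → ℝ
  | [] => 1
  | x :: l => pathWeight p (x :: l ++ [x])

lemma pathWeight_append (p : V → V → ℝ) (a b : List V) (y : V) :
    pathWeight p (a ++ y :: b) = pathWeight p (a ++ [y]) * pathWeight p (y :: b) := by
  induction a with
  | nil => simp [pathWeight]
  | cons x a ih =>
    cases a with
    | nil => simp [pathWeight]
    | cons z a =>
      simp only [List.cons_append, pathWeight] at ih ⊢
      rw [ih, mul_assoc]

lemma pathWeight_concat (p : V → V → ℝ) (a : List V) (v y : V) :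
    pathWeight p (a ++ [v] ++ [y]) = pathWeight p (a ++ [v]) * p v y := by
  have := pathWeight_append p a [y] v
  simpa [pathWeight] using this

lemma pathWeight_nonneg {p : V → V → ℝ} (hp : ∀ x y, 0 ≤ p x y) (l : List V) :
    0 ≤ pathWeight p l := by
  induction l with
  | nil => simp [pathWeight]
  | cons x a ih =>
    cases a with
    | nil => simp [pathWeight]
    | cons z a => exact mul_nonneg (hp _ _) ih

lemma closedPathWeight_concat (p : V → V → ℝ) (x : V) (l : List V) :
    closedPathWeight p (l ++ [x]) = closedPathWeight p (x :: l) := by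
  cases l with
  | nil => rfl
  | cons y l =>
    have : closedPathWeight p (y :: l ++ [x]) = pathWeight p ((y :: l) ++ x :: [y]) := by
      simp [closedPathWeight]
    rw [this, pathWeight_append]
    simp [closedPathWeight, pathWeight, mul_comm]

lemma closedPathWeight_isRotated (p : V → V → ℝ) {l l' : List V} (h : l ~r l') :
    closedPathWeight p l = closedPathWeight p l' := by
  obtain ⟨n, rfl⟩ := h
  induction n with
  | zero => simp
  | succ n ih =>
    rw [ih, ← List.rotate_rotate]
    cases l.rotate n with
    | nil => simp
    | cons x m => simp [closedPathWeight_concat]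

/-- The product of the weights of the steps of a cycle. -/
def cycleWeight (p : V → V → ℝ) (c : Cycle V) : ℝ :=
  Quotient.lift (s := List.IsRotated.setoid V) (closedPathWeight p)
    (fun _ _ h => closedPathWeight_isRotated p h) c

lemma cycleWeight_coe (p : V → V → ℝ) (l : List V) :
    cycleWeight p (l : Cycle V) = closedPathWeight p l := rfl

end Weights

/-! ### Loop-erased paths and the kernel of the loop-erased walk -/

section Kernel

variable {V : Type*} [DecidableEq V]

/-- The self-avoiding vertex sequences, i.e. the states of the loop-erased walk. -/
abbrev SAPath (V : Type*) : Type _ := {l : List V // l.Nodup}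

lemma takeWhile_append_cons {y : V} {a : List V} (ha : y ∉ a) (l : List V) :
    (a ++ y :: l).takeWhile (fun u => decide (u ≠ y)) = a := by
  induction a with
  | nil => simp
  | cons z a ih =>
    simp only [List.mem_cons, not_or] at ha
    rw [List.cons_append, List.takeWhile_cons_of_pos (by simpa using Ne.symm ha.1), ih ha.2]

lemma dropWhile_append_cons {y : V} {a : List V} (ha : y ∉ a) (l : List V) :
    (a ++ y :: l).dropWhile (fun u => decide (u ≠ y)) = y :: l := by
  induction a with
  | nil => simp
  | cons z a ih =>
    simp only [List.mem_cons, not_or] at ha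
    rw [List.cons_append, List.dropWhile_cons_of_pos (by simpa using Ne.symm ha.1), ih ha.2]

lemma eraseStep_of_notMem {q : List V} {y : V} (h : y ∉ q) : eraseStep q y = q ++ [y] := by
  simp [eraseStep, h]

lemma eraseStep_append_cons {y : V} {a : List V} (ha : y ∉ a) (l : List V) :
    eraseStep (a ++ y :: l) y = a ++ [y] := by
  rw [eraseStep, if_pos (by simp), takeWhile_append_cons ha]

lemma closedCycle_append_cons {y : V} {a : List V} (ha : y ∉ a) (l : List V) :
    closedCycle (a ++ y :: l) y = ((y :: l : List V) : Cycle V) := by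
  rw [closedCycle, dropWhile_append_cons ha]

lemma eraseStep_eq_concat (q : List V) (y : V) : ∃ a, eraseStep q y = a ++ [y] := by
  unfold eraseStep
  split_ifs <;> exact ⟨_, rfl⟩

lemma eraseStep_nodup {q : List V} (hq : q.Nodup) (y : V) : (eraseStep q y).Nodup := by
  by_cases h : y ∈ q
  · obtain ⟨a, l, rfl, ha⟩ := List.eq_append_cons_of_mem h
    rw [eraseStep_append_cons ha]
    exact hq.sublist (by simp)
  · rw [eraseStep_of_notMem h]
    exact List.nodup_append.2 ⟨hq, by simp, by simpa using fun a ha (e : a = y) => h (e ▸ ha)⟩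

lemma eraseStep_head? {q : List V} (hq : q ≠ []) (y : V) : (eraseStep q y).head? = q.head? := by
  by_cases h : y ∈ q
  · obtain ⟨a, l, rfl, ha⟩ := List.eq_append_cons_of_mem h
    rw [eraseStep_append_cons ha]
    cases a <;> simp
  · rw [eraseStep_of_notMem h]
    cases q <;> simp at hq ⊢

lemma eraseStep_toFinset_subset (q : List V) (y : V) :
    (eraseStep q y).toFinset ⊆ insert y q.toFinset := by
  by_cases h : y ∈ q
  · obtain ⟨a, l, rfl, ha⟩ := List.eq_append_cons_of_mem h
    rw [eraseStep_append_cons ha]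
    intro v
    simp
    tauto
  · rw [eraseStep_of_notMem h]
    intro v
    simp

/-- The state of the loop-erased walk after a step from the state `q` to the vertex `y`. -/
def nextPath (q : SAPath V) (y : V) : SAPath V := ⟨eraseStep q.1 y, eraseStep_nodup q.2 y⟩

/-- The weight of a step of the walk to `y` from the state `q`: the weight of the step from the last
vertex of `q` to `y`, times the weight `r` of the cycle that is closed, if there is one. -/
def moveWeight (p : V → V → ℝ) (r : Cycle V → ℝ) (q : List V) (y : V) : ℝ :=
  (match q.getLast? with
    | some v => p v y
    | none => 0) * if y ∈ q then r (closedCycle q y) else 1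

lemma moveWeight_concat {p : V → V → ℝ} {r : Cycle V → ℝ} (a : List V) (v y : V) (hy : y ∉ a ++ [v]) :
    moveWeight p r (a ++ [v]) y = p v y := by
  simp [moveWeight, hy]

lemma pathWeight_mul_moveWeight {p : V → V → ℝ} {r : Cycle V → ℝ} (a l : List V) (y : V) (hy : y ∉ a) :
    pathWeight p (a ++ y :: l) * moveWeight p r (a ++ y :: l) y =
      pathWeight p (a ++ [y]) * (pathWeight p (y :: l ++ [y]) * r (y :: l : List V)) := by
  rw [moveWeight, closedCycle_append_cons hy, if_pos (by simp)]
  obtain ⟨b, v, hb⟩ : ∃ b v, y :: l = b ++ [v] :=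
    ⟨_, _, (List.dropLast_append_getLast (List.cons_ne_nil y l)).symm⟩
  have h1 : pathWeight p (a ++ y :: l ++ [y]) = pathWeight p (a ++ y :: l) * p v y := by
    rw [hb, ← List.append_assoc, pathWeight_concat]
  have h2 : (a ++ y :: l).getLast? = some v := by
    rw [hb, ← List.append_assoc]; simp
  rw [h2, ← mul_assoc, ← h1, List.append_assoc, List.cons_append, pathWeight_append, mul_assoc]

/-- The kernel, on self-avoiding paths, of the loop-erased walk restricted to `U`. -/
def pathKernel [Fintype V] (p : V → V → ℝ) (r : Cycle V → ℝ) (U : Finset V) :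
    Matrix (SAPath V) (SAPath V) ℝ :=
  fun q q' => ∑ y ∈ U, if nextPath q y = q' then moveWeight p r q.1 y else 0

end Kernel

/-! ### The Green function of the loop-erased walk -/

section Green

variable {V : Type*} [DecidableEq V] [Fintype V] (p : V → V → ℝ) (r : Cycle V → ℝ)

/-- The alternating sum over the families of vertex-disjoint cycles in `U`, the weight of a cycle `c`
being `t ^ |c|` times the weights of its steps times `r c`. -/
def cycleSum (U : Finset V) (t : ℝ) : ℝ :=
  alternatingSum (fun c : {c : Cycle V // c.Nodup} => c.1.toFinset)
    (fun c => cycleWeight p c.1 * r c.1) U t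

lemma cycleSum_recurrence {U : Finset V} (v : V) (t : ℝ) :
    cycleSum p r (U.erase v) t = cycleSum p r U t +
      ∑ s : SAPath V with s.1.head? = some v ∧ s.1.toFinset ⊆ U,
        t ^ s.1.length * (pathWeight p (s.1 ++ [v]) * r s.1) *
          cycleSum p r (U \ s.1.toFinset) t := by
  rw [cycleSum, alternatingSum_recurrence, cycleSum, add_right_inj]
  symm
  refine Finset.sum_bij (fun s _ => (⟨(s.1 : Cycle V), s.2⟩ : {c : Cycle V // c.Nodup})) ?_ ?_ ?_ ?_
  · rintro ⟨s, hs⟩ h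
    simp only [Finset.mem_filter, Finset.mem_univ, true_and] at h ⊢
    obtain ⟨h1, h2⟩ := h
    obtain ⟨l, rfl⟩ := List.head?_eq_some_iff.1 h1
    exact ⟨by simp, by simpa using h2⟩
  · rintro ⟨s, hs⟩ h ⟨s', hs'⟩ h' heq
    simp only [Finset.mem_filter, Finset.mem_univ, true_and] at h h'
    obtain ⟨l, rfl⟩ := List.head?_eq_some_iff.1 h.1
    obtain ⟨l', rfl⟩ := List.head?_eq_some_iff.1 h'.1
    replace heq : (v :: l) ~r (v :: l') := Cycle.coe_eq_coe.1 (congrArg Subtype.val heq)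
    obtain ⟨n, hn, hrot⟩ := List.isRotated_iff_mod.1 heq
    refine Subtype.ext ?_
    -- two rotations of a list without repetition that have the same first entry are equal
    rcases hn.lt_or_eq with hn | rfl
    · have h0 : ((v :: l).rotate n)[0]? = (v :: l)[n]? := by
        rw [List.getElem?_rotate (by simp)]
        rw [zero_add, Nat.mod_eq_of_lt hn]
      rw [hrot, List.getElem?_eq_getElem hn] at h0
      have : (v :: l)[0] = (v :: l)[n] := by simpa using h0
      have := (List.Nodup.getElem_inj_iff hs).1 this
      subst this
      simpa using hrot
    · simpa using hrot
  · rintro ⟨c, hc⟩ h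
    simp only [Finset.mem_filter, Finset.mem_univ, true_and] at h
    induction c using Quot.inductionOn with
    | h l =>
      obtain ⟨h1, h2⟩ := h
      rw [Cycle.mk_eq_coe] at h1 h2 hc
      rw [Cycle.coe_toFinset] at h1 h2
      obtain ⟨a, b, rfl⟩ := List.append_of_mem (List.mem_toFinset.1 h1)
      have hrot : (a ++ v :: b) ~r (v :: b ++ a) := List.isRotated_append
      refine ⟨⟨v :: b ++ a, hrot.nodup_iff.1 hc⟩, ?_, ?_⟩
      · simp only [Finset.mem_filter, Finset.mem_univ, true_and]
        refine ⟨by simp, ?_⟩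
        rwa [List.toFinset_eq_of_perm _ _ hrot.perm.symm]
      · exact Subtype.ext (Cycle.coe_eq_coe.2 hrot.symm)
  · rintro ⟨s, hs⟩ h
    simp only [Finset.mem_filter, Finset.mem_univ, true_and] at h
    obtain ⟨l, rfl⟩ := List.head?_eq_some_iff.1 h.1
    simp only [Cycle.coe_toFinset, cycleWeight_coe, List.toFinset_card_of_nodup hs, cycleSum]
    rfl

/-- The candidate `h_t(q) = t ^ (|q| - 1) w(q) D_t(U \ q)`, on the paths `q` in `U` that start at `x`,
for `D_t(U)` times the Green function of the loop-erased walk from `x`. -/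
def greenNumerator (U : Finset V) (x : V) (t : ℝ) (q : SAPath V) : ℝ :=
  if q.1.head? = some x ∧ q.1.toFinset ⊆ U then
    t ^ (q.1.length - 1) * pathWeight p q.1 * cycleSum p r (U \ q.1.toFinset) t else 0

variable {p r}

lemma greenNumerator_eq_zero {U : Finset V} {x : V} {t : ℝ} {q : SAPath V}
    (h : ¬ (q.1.head? = some x ∧ q.1.toFinset ⊆ U)) : greenNumerator p r U x t q = 0 :=
  if_neg h

/-- The Green equation: the function `greenNumerator` is a fixed point of the kernel with a source of
mass `D_t(U)` at the path `[x]`. A predecessor of a path `a y` is either `a` or a path `a y l` whose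
end closes the cycle `y l`, and the sum over the latter is the recurrence of the alternating sum. -/
lemma greenNumerator_eq {U : Finset V} {x : V} (hx : x ∈ U) (t : ℝ) (q : SAPath V) :
    greenNumerator p r U x t q = (if q.1 = [x] then cycleSum p r U t else 0) +
      t * ∑ s, greenNumerator p r U x t s * pathKernel p r U s q := by
  obtain ⟨q, hq⟩ := q
  rcases List.eq_nil_or_concat q with rfl | ⟨a, y, rfl⟩
  · have h0 : ∀ s, pathKernel p r U s ⟨[], hq⟩ = 0 := by
      intro s
      refine Finset.sum_eq_zero fun y _ => if_neg fun h => ?_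
      obtain ⟨a, ha⟩ := eraseStep_eq_concat s.1 y
      have := congrArg Subtype.val h
      simp [nextPath, ha] at this
    simp [h0, greenNumerator]
  simp only [List.concat_eq_append] at hq ⊢
  have hya : y ∉ a := by
    intro h
    simpa using (List.nodup_append.1 hq).2.2 y h y (by simp)
  by_cases hin : (a ++ [y]).head? = some x ∧ (a ++ [y]).toFinset ⊆ U
  swap
  · rw [greenNumerator_eq_zero hin, if_neg, zero_add, eq_comm, mul_eq_zero]
    · right
      refine Finset.sum_eq_zero fun s _ => ?_
      by_cases hs : s.1.head? = some x ∧ s.1.toFinset ⊆ U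
      · rw [pathKernel, Finset.sum_eq_zero, mul_zero]
        intro z hz
        refine if_neg fun h => hin ?_
        have h' : eraseStep s.1 z = a ++ [y] := congrArg Subtype.val h
        rw [← h']
        refine ⟨?_, ?_⟩
        · rw [eraseStep_head?, hs.1]
          rintro h0
          simp [h0] at hs
        · exact (eraseStep_toFinset_subset _ _).trans (Finset.insert_subset hz hs.2)
      · rw [greenNumerator_eq_zero hs, zero_mul]
    · intro h
      rw [h] at hin
      simp [hx] at hin
  obtain ⟨hhead, hsub⟩ := hin
  have hyU : y ∈ U := hsub (by simp)
  have haU : a.toFinset ⊆ U := fun v hv => hsub (by simp at hv ⊢; tauto)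
  have hna : a.Nodup := (List.nodup_append.1 hq).1
  have hker : ∀ s : SAPath V, pathKernel p r U s ⟨a ++ [y], hq⟩ =
      if eraseStep s.1 y = a ++ [y] then moveWeight p r s.1 y else 0 := by
    intro s
    rw [pathKernel, Finset.sum_eq_single_of_mem y hyU]
    · simp [nextPath, Subtype.ext_iff]
    · intro z _ hz
      refine if_neg fun h => hz ?_
      have h' : eraseStep s.1 z = a ++ [y] := congrArg Subtype.val h
      obtain ⟨b, hb⟩ := eraseStep_eq_concat s.1 z
      rw [hb] at h'
      simpa using (List.append_inj' h' rfl).2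
  simp only [hker]
  rw [← Finset.sum_filter_add_sum_filter_not _ (fun s : SAPath V => y ∈ s.1)]
  have hsumnot : t * ∑ s : SAPath V with y ∉ s.1, greenNumerator p r U x t s *
      (if eraseStep s.1 y = a ++ [y] then moveWeight p r s.1 y else 0) =
      if a = [] then 0 else t ^ a.length * pathWeight p (a ++ [y]) *
        cycleSum p r (U \ a.toFinset) t := by
    rw [Finset.sum_eq_single_of_mem (⟨a, hna⟩ : SAPath V) (by simpa using hya)]
    · rw [if_pos (eraseStep_of_notMem hya)]
      split_ifs with h0
      · subst h0
        simp [greenNumerator]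
      · obtain ⟨b, v, rfl⟩ : ∃ b v, a = b ++ [v] :=
          ⟨_, _, (List.dropLast_append_getLast h0).symm⟩
        rw [greenNumerator, if_pos ⟨by simpa using hhead, haU⟩, pathWeight_concat,
          moveWeight_concat _ _ _ hya]
        simp only [List.length_append, List.length_singleton, Nat.add_sub_cancel, pow_succ]
        ring
    · rintro ⟨s, hs⟩ hys hne
      rw [if_neg, mul_zero]
      intro h
      rw [eraseStep_of_notMem (by simpa using hys)] at h
      exact hne (Subtype.ext (List.append_cancel_right h))
  have hsum : t * ∑ s : SAPath V with y ∈ s.1, greenNumerator p r U x t s *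
      (if eraseStep s.1 y = a ++ [y] then moveWeight p r s.1 y else 0) =
      t ^ a.length * pathWeight p (a ++ [y]) *
        ∑ s : SAPath V with s.1.head? = some y ∧ s.1.toFinset ⊆ U \ a.toFinset,
          t ^ s.1.length * (pathWeight p (s.1 ++ [y]) * r s.1) *
            cycleSum p r ((U \ a.toFinset) \ s.1.toFinset) t := by
    rw [Finset.mul_sum, Finset.mul_sum]
    symm
    refine Finset.sum_bij_ne_zero (fun s hs _ => (⟨a ++ s.1, ?_⟩ : SAPath V)) ?_ ?_ ?_ ?_
    · simp only [Finset.mem_filter, Finset.mem_univ, true_and, Finset.subset_sdiff] at hs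
      refine List.nodup_append.2 ⟨hna, s.2, ?_⟩
      rintro u hu w hw rfl
      exact Finset.disjoint_left.1 hs.2.2 (List.mem_toFinset.2 hw) (List.mem_toFinset.2 hu)
    · rintro ⟨s, hs⟩ h _
      simp only [Finset.mem_filter, Finset.mem_univ, true_and] at h ⊢
      obtain ⟨l, rfl⟩ := List.head?_eq_some_iff.1 h.1
      simp
    · rintro ⟨s, hs⟩ h _ ⟨s', hs'⟩ h' _ heq
      simpa using heq
    · rintro ⟨s, hs⟩ h hne
      simp only [Finset.mem_filter, Finset.mem_univ, true_and] at h
      obtain ⟨b, l, rfl, hb⟩ := List.eq_append_cons_of_mem h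
      rw [eraseStep_append_cons hb] at hne
      have hab : b = a := by
        by_contra hcon
        exact hne (by rw [if_neg (fun e => hcon (List.append_cancel_right e))]; simp)
      subst hab
      have hg : (b ++ y :: l).head? = some x ∧ (b ++ y :: l).toFinset ⊆ U := by
        by_contra hcon
        exact hne (by rw [greenNumerator_eq_zero hcon]; simp)
      have hmem : (⟨y :: l, (List.nodup_append.1 hs).2.1⟩ : SAPath V) ∈
          (Finset.univ.filter fun s : SAPath V =>
            s.1.head? = some y ∧ s.1.toFinset ⊆ U \ b.toFinset) := by
        simp only [Finset.mem_filter, Finset.mem_univ, true_and, Finset.subset_sdiff]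
        refine ⟨by simp, fun v hv => hg.2 (by simp at hv ⊢; tauto), ?_⟩
        rw [Finset.disjoint_left]
        intro v hv hv'
        exact (List.nodup_append.1 hs).2.2 v (List.mem_toFinset.1 hv') v (List.mem_toFinset.1 hv) rfl
      refine ⟨_, hmem, ?_, rfl⟩
      rw [if_pos rfl, greenNumerator, if_pos hg] at hne
      intro hzero
      apply hne
      have hpm := pathWeight_mul_moveWeight (p := p) (r := r) b l y hb
      have : (U \ (b ++ y :: l).toFinset) = (U \ b.toFinset) \ (y :: l).toFinset := by
        rw [List.toFinset_append, sdiff_sdiff_left]; rfl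
      rw [this]
      simp only [List.length_append, List.length_cons] at hzero ⊢
      calc t * (t ^ (b.length + (l.length + 1) - 1) * pathWeight p (b ++ y :: l) *
            cycleSum p r ((U \ b.toFinset) \ (y :: l).toFinset) t *
              moveWeight p r (b ++ y :: l) y)
          = t ^ (b.length + (l.length + 1) - 1 + 1) *
            (pathWeight p (b ++ y :: l) * moveWeight p r (b ++ y :: l) y) *
            cycleSum p r ((U \ b.toFinset) \ (y :: l).toFinset) t := by ring
        _ = _ := by
            rw [hpm, Nat.sub_add_cancel (by omega), pow_add]; ring
        _ = 0 := hzero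
    · rintro ⟨s, hs⟩ h _
      simp only [Finset.mem_filter, Finset.mem_univ, true_and, Finset.subset_sdiff] at h
      obtain ⟨l, rfl⟩ := List.head?_eq_some_iff.1 h.1
      have hg : (a ++ y :: l).head? = some x ∧ (a ++ y :: l).toFinset ⊆ U := by
        refine ⟨?_, ?_⟩
        · rw [← hhead]; cases a <;> simp
        · rw [List.toFinset_append]
          exact Finset.union_subset haU h.2.1
      have hpm := pathWeight_mul_moveWeight (p := p) (r := r) a l y hya
      have : (U \ (a ++ y :: l).toFinset) = (U \ a.toFinset) \ (y :: l).toFinset := by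
        rw [List.toFinset_append, sdiff_sdiff_left]; rfl
      simp only
      rw [eraseStep_append_cons hya, if_pos rfl, greenNumerator, if_pos hg, this]
      simp only [List.length_append, List.length_cons]
      symm
      calc t * (t ^ (a.length + (l.length + 1) - 1) * pathWeight p (a ++ y :: l) *
            cycleSum p r ((U \ a.toFinset) \ (y :: l).toFinset) t *
              moveWeight p r (a ++ y :: l) y)
          = t ^ (a.length + (l.length + 1) - 1 + 1) *
            (pathWeight p (a ++ y :: l) * moveWeight p r (a ++ y :: l) y) *
            cycleSum p r ((U \ a.toFinset) \ (y :: l).toFinset) t := by ring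
        _ = _ := by
            rw [hpm, Nat.sub_add_cancel (by omega), pow_add]; ring
  rw [mul_add, hsum, hsumnot]
  have hrec := cycleSum_recurrence p r (U := U \ a.toFinset) y t
  have herase : (U \ a.toFinset).erase y = U \ (a ++ [y]).toFinset := by
    ext v; simp; tauto
  rw [herase] at hrec
  rw [greenNumerator, if_pos ⟨hhead, hsub⟩, hrec]
  simp only [List.length_append, List.length_singleton, Nat.add_sub_cancel]
  rcases List.eq_nil_or_concat a with rfl | ⟨b, v, rfl⟩
  · have hxy : y = x := by simpa using hhead
    subst hxy
    simp [pathWeight]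
  · have : ¬ ((b ++ [v]) ++ [y] = [x]) := by
      intro h
      have := congrArg List.length h
      simp at this
    simp only [List.concat_eq_append]
    rw [if_neg this, if_neg (by simp)]
    ring

end Green

/-! ### Summation of the Green function -/

section GreenSum

open Filter Topology

variable {V : Type*} [DecidableEq V] [Fintype V] {p : V → V → ℝ} {r : Cycle V → ℝ}

/-- The path reduced to the vertex `x`. -/
def singlePath (x : V) : SAPath V := ⟨[x], by simp⟩

/-- The steps have the probabilities `p`, and the cycles are erased with probabilities `r`. -/
structure IsStepLaw (p : V → V → ℝ) (r : Cycle V → ℝ) : Prop where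
  nonneg : ∀ x y, 0 ≤ p x y
  sum_eq_one : ∀ x, ∑ y, p x y = 1
  erase_nonneg : ∀ c, 0 ≤ r c
  erase_le_one : ∀ c, r c ≤ 1

/-- The probability that the loop-erased walk, in the state `q`, is killed in the next step: it leaves
`U`, or it closes a cycle that is not erased. -/
def killProb (p : V → V → ℝ) (r : Cycle V → ℝ) (U : Finset V) (q : SAPath V) : ℝ :=
  1 - ∑ y ∈ U, moveWeight p r q.1 y

lemma sum_pathKernel (U : Finset V) (q : SAPath V) :
    ∑ q', pathKernel p r U q q' = 1 - killProb p r U q := by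
  simp only [pathKernel, killProb]
  rw [Finset.sum_comm]
  simp

variable (h : IsStepLaw p r)
include h

lemma moveWeight_nonneg (q : List V) (y : V) : 0 ≤ moveWeight p r q y := by
  unfold moveWeight
  refine mul_nonneg ?_ ?_
  · cases q.getLast? with
    | none => simp
    | some v => exact h.nonneg v y
  · split_ifs
    · exact h.erase_nonneg _
    · exact zero_le_one

lemma moveWeight_le (q : List V) (v y : V) (hv : q.getLast? = some v) :
    moveWeight p r q y ≤ p v y := by
  unfold moveWeight
  rw [hv]
  refine mul_le_of_le_one_right (h.nonneg v y) ?_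
  split_ifs
  · exact h.erase_le_one _
  · exact le_rfl

lemma killProb_nonneg (U : Finset V) (q : SAPath V) : 0 ≤ killProb p r U q := by
  unfold killProb
  rw [sub_nonneg]
  cases hq : q.1.getLast? with
  | none => simp [moveWeight, hq]
  | some v =>
    calc ∑ y ∈ U, moveWeight p r q.1 y ≤ ∑ y ∈ U, p v y :=
          Finset.sum_le_sum fun y _ => moveWeight_le h q.1 v y hq
      _ ≤ ∑ y, p v y := Finset.sum_le_sum_of_subset_of_nonneg (Finset.subset_univ _)
          fun y _ _ => h.nonneg v y
      _ = 1 := h.sum_eq_one v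

lemma pathKernel_nonneg (U : Finset V) (q q' : SAPath V) : 0 ≤ pathKernel p r U q q' := by
  refine Finset.sum_nonneg fun y _ => ?_
  split_ifs
  · exact moveWeight_nonneg h _ _
  · exact le_rfl

lemma pathKernel_pow_nonneg (U : Finset V) (k : ℕ) (q q' : SAPath V) :
    0 ≤ (pathKernel p r U ^ k) q q' := by
  induction k generalizing q' with
  | zero => rw [pow_zero, Matrix.one_apply]; split_ifs <;> simp
  | succ k ih =>
    rw [pow_succ, Matrix.mul_apply]
    exact Finset.sum_nonneg fun s _ => mul_nonneg (ih s) (pathKernel_nonneg h U _ _)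

lemma sum_pathKernel_pow_le (U : Finset V) (k : ℕ) (q : SAPath V) :
    ∑ q', (pathKernel p r U ^ k) q q' ≤ 1 := by
  induction k with
  | zero => simp [Matrix.one_apply]
  | succ k ih =>
    simp only [pow_succ, Matrix.mul_apply]
    rw [Finset.sum_comm]
    refine le_trans (Finset.sum_le_sum fun s _ => ?_) ih
    rw [← Finset.mul_sum, sum_pathKernel]
    exact mul_le_of_le_one_right (pathKernel_pow_nonneg h U k _ _)
      (by linarith [killProb_nonneg h U s])

lemma pathKernel_pow_le_one (U : Finset V) (k : ℕ) (q q' : SAPath V) :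
    (pathKernel p r U ^ k) q q' ≤ 1 :=
  (Finset.single_le_sum (f := fun q' => (pathKernel p r U ^ k) q q')
    (fun s _ => pathKernel_pow_nonneg h U k q s) (Finset.mem_univ q')).trans
    (sum_pathKernel_pow_le h U k q)

omit h in
/-- Conservation of mass: summing the Green equation over the states. -/
lemma sum_greenNumerator_mul {U : Finset V} {x : V} (hx : x ∈ U) (t : ℝ) :
    ∑ q, greenNumerator p r U x t q * (1 - t * (1 - killProb p r U q)) = cycleSum p r U t := by
  have h1 : ∑ q, greenNumerator p r U x t q = cycleSum p r U t +
      t * ∑ q, greenNumerator p r U x t q * (1 - killProb p r U q) := by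
    calc ∑ q, greenNumerator p r U x t q
        = ∑ q : SAPath V, ((if q.1 = [x] then cycleSum p r U t else 0) +
          t * ∑ s, greenNumerator p r U x t s * pathKernel p r U s q) :=
          Finset.sum_congr rfl fun q _ => greenNumerator_eq hx t q
      _ = _ := by
          rw [Finset.sum_add_distrib]
          congr 1
          · rw [Finset.sum_eq_single_of_mem (singlePath x) (Finset.mem_univ _)]
            · simp [singlePath]
            · intro q _ hq
              exact if_neg fun e => hq (Subtype.ext e)
          · rw [← Finset.mul_sum, Finset.sum_comm]
            simp_rw [← Finset.mul_sum, sum_pathKernel]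
  have h2 : ∑ q, greenNumerator p r U x t q * (1 - t * (1 - killProb p r U q)) =
      ∑ q, greenNumerator p r U x t q -
        t * ∑ q, greenNumerator p r U x t q * (1 - killProb p r U q) := by
    rw [Finset.mul_sum, ← Finset.sum_sub_distrib]
    exact Finset.sum_congr rfl fun q _ => by ring
  linarith

/-- If every non-empty `U` contains a path of positive weight from which the walk is killed with
positive probability, then the alternating sums are positive. -/
lemma cycleSum_pos {t : ℝ} (ht : t ∈ Set.Icc (0 : ℝ) 1)
    (hkill : ∀ U : Finset V, U.Nonempty → ∃ q : SAPath V, q.1 ≠ [] ∧ q.1.toFinset ⊆ U ∧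
      0 < t ^ (q.1.length - 1) * pathWeight p q.1 ∧ 0 < 1 - t * (1 - killProb p r U q))
    (U : Finset V) : 0 < cycleSum p r U t := by
  induction U using Finset.strongInduction with
  | H U ih =>
    rcases U.eq_empty_or_nonempty with rfl | hU
    · simp [cycleSum, alternatingSum_empty]
    · obtain ⟨q, hq0, hqU, hqw, hqk⟩ := hkill U hU
      obtain ⟨x, hx⟩ : ∃ x, q.1.head? = some x := ⟨_, List.head?_eq_some_head hq0⟩
      have hmem : ∀ s : SAPath V, s.1.head? = some x → x ∈ s.1 := fun s hs => by
        obtain ⟨l, hl⟩ := List.head?_eq_some_iff.1 hs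
        simp [hl]
      have hxU : x ∈ U := hqU (List.mem_toFinset.2 (hmem q hx))
      have hlt : ∀ s : SAPath V, s.1.head? = some x → 0 < cycleSum p r (U \ s.1.toFinset) t :=
        fun s hs => ih _ (Finset.ssubset_iff_of_subset Finset.sdiff_subset |>.2
          ⟨x, hxU, fun hcon => (Finset.mem_sdiff.1 hcon).2 (List.mem_toFinset.2 (hmem s hs))⟩)
      rw [← sum_greenNumerator_mul hxU t]
      refine Finset.sum_pos' (fun s _ => ?_) ⟨q, Finset.mem_univ _, ?_⟩
      · refine mul_nonneg ?_ ?_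
        · unfold greenNumerator
          split_ifs with hs
          · exact mul_nonneg (mul_nonneg (pow_nonneg ht.1 _) (pathWeight_nonneg h.nonneg _))
              (hlt s hs.1).le
          · exact le_rfl
        · have := killProb_nonneg h U s
          nlinarith [ht.1, ht.2]
      · refine mul_pos ?_ hqk
        rw [greenNumerator, if_pos ⟨hx, hqU⟩]
        exact mul_pos hqw (hlt q hx)

lemma cycleSum_pos_of_lt_one {t : ℝ} (ht : t ∈ Set.Ico (0 : ℝ) 1) (U : Finset V) :
    0 < cycleSum p r U t := by
  refine cycleSum_pos h ⟨ht.1, ht.2.le⟩ (fun U hU => ?_) U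
  obtain ⟨x, hx⟩ := hU
  refine ⟨singlePath x, by simp [singlePath], by simpa [singlePath] using hx,
    by simp [singlePath, pathWeight], ?_⟩
  have := killProb_nonneg h U (singlePath x)
  nlinarith [ht.1, ht.2]

lemma greenNumerator_nonneg {t : ℝ} (ht : 0 ≤ t) (hD : ∀ U, 0 < cycleSum p r U t)
    (U : Finset V) (x : V) (q : SAPath V) : 0 ≤ greenNumerator p r U x t q := by
  unfold greenNumerator
  split_ifs
  · exact mul_nonneg (mul_nonneg (pow_nonneg ht _) (pathWeight_nonneg h.nonneg _)) (hD _).le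
  · exact le_rfl

omit h in
lemma greenNumerator_iterate {U : Finset V} {x : V} (hx : x ∈ U) (t : ℝ) (M : ℕ) (q : SAPath V) :
    greenNumerator p r U x t q =
      cycleSum p r U t * ∑ k ∈ Finset.range M, t ^ k * (pathKernel p r U ^ k) (singlePath x) q +
      t ^ M * ∑ s, greenNumerator p r U x t s * (pathKernel p r U ^ M) s q := by
  induction M with
  | zero => simp [Matrix.one_apply]
  | succ M ih =>
    rw [ih, Finset.sum_range_succ, mul_add, add_assoc, add_right_inj]
    have h1 : ∀ s, greenNumerator p r U x t s =
        (if s = singlePath x then cycleSum p r U t else 0) +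
        t * ∑ s', greenNumerator p r U x t s' * pathKernel p r U s' s := by
      intro s
      rw [greenNumerator_eq hx t s]
      congr 1
      simp [singlePath, Subtype.ext_iff]
    calc t ^ M * ∑ s, greenNumerator p r U x t s * (pathKernel p r U ^ M) s q
        = t ^ M * ∑ s, ((if s = singlePath x then cycleSum p r U t else 0) +
        t * ∑ s', greenNumerator p r U x t s' * pathKernel p r U s' s) *
          (pathKernel p r U ^ M) s q := by
          congr 1
          exact Finset.sum_congr rfl fun s _ => by rw [← h1 s]
      _ = _ := by
          simp only [add_mul, Finset.sum_add_distrib, ite_mul, zero_mul, Finset.sum_ite_eq',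
            Finset.mem_univ, if_true, mul_add]
          congr 1
          · ring
          · rw [pow_succ, mul_assoc]
            congr 1
            simp only [pow_succ', Matrix.mul_apply, mul_assoc, Finset.mul_sum, Finset.sum_mul]
            rw [Finset.sum_comm]

lemma sum_range_pathKernel_le {U : Finset V} {x : V} (hx : x ∈ U) {t : ℝ} (ht : 0 ≤ t)
    (hD : ∀ U, 0 < cycleSum p r U t) (M : ℕ) (q : SAPath V) :
    ∑ k ∈ Finset.range M, t ^ k * (pathKernel p r U ^ k) (singlePath x) q ≤
      greenNumerator p r U x t q / cycleSum p r U t := by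
  rw [le_div_iff₀ (hD U), greenNumerator_iterate hx t M q, mul_comm]
  refine le_add_of_nonneg_right (mul_nonneg (pow_nonneg ht _) (Finset.sum_nonneg fun s _ => ?_))
  exact mul_nonneg (greenNumerator_nonneg h ht hD U x s) (pathKernel_pow_nonneg h U M s q)

lemma summable_pathKernel {U : Finset V} {x : V} (hx : x ∈ U) {t : ℝ} (ht : 0 ≤ t)
    (hD : ∀ U, 0 < cycleSum p r U t) (q : SAPath V) :
    Summable fun k => t ^ k * (pathKernel p r U ^ k) (singlePath x) q :=
  summable_of_sum_range_le (fun k => mul_nonneg (pow_nonneg ht _) (pathKernel_pow_nonneg h U k _ _))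
    fun M => sum_range_pathKernel_le h hx ht hD M q

lemma hasSum_pathKernel_of_lt_one {U : Finset V} {x : V} (hx : x ∈ U) {t : ℝ}
    (ht : t ∈ Set.Ico (0 : ℝ) 1) (q : SAPath V) :
    HasSum (fun k => t ^ k * (pathKernel p r U ^ k) (singlePath x) q)
      (greenNumerator p r U x t q / cycleSum p r U t) := by
  have hD := cycleSum_pos_of_lt_one h ht
  have hs := summable_pathKernel h hx ht.1 hD q
  refine (hs.hasSum_iff_tendsto_nat).2 ?_
  have h1 : ∀ M, ∑ k ∈ Finset.range M, t ^ k * (pathKernel p r U ^ k) (singlePath x) q =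
      (greenNumerator p r U x t q -
        t ^ M * ∑ s, greenNumerator p r U x t s * (pathKernel p r U ^ M) s q) /
        cycleSum p r U t := by
    intro M
    rw [eq_div_iff (hD U).ne']
    nth_rewrite 1 [greenNumerator_iterate hx t M q]
    ring
  simp only [h1]
  have h2 : Tendsto (fun M => t ^ M * ∑ s, greenNumerator p r U x t s * (pathKernel p r U ^ M) s q)
      atTop (𝓝 0) := by
    refine squeeze_zero (g := fun M => t ^ M * ∑ s, greenNumerator p r U x t s) (fun M => ?_)
      (fun M => ?_) ?_
    · exact mul_nonneg (pow_nonneg ht.1 _) (Finset.sum_nonneg fun s _ =>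
        mul_nonneg (greenNumerator_nonneg h ht.1 hD U x s) (pathKernel_pow_nonneg h U M s q))
    · exact mul_le_mul_of_nonneg_left (Finset.sum_le_sum fun s _ =>
        mul_le_of_le_one_right (greenNumerator_nonneg h ht.1 hD U x s)
          (pathKernel_pow_le_one h U M s q)) (pow_nonneg ht.1 _)
    · simpa using (tendsto_pow_atTop_nhds_zero_of_lt_one ht.1 ht.2).mul_const
        (∑ s, greenNumerator p r U x t s)
  simpa using (tendsto_const_nhds.sub h2).div_const (cycleSum p r U t)

omit h in
lemma continuous_cycleSum (U : Finset V) : Continuous (cycleSum p r U) :=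
  continuous_alternatingSum

omit h in
lemma continuous_greenNumerator (U : Finset V) (x : V) (q : SAPath V) :
    Continuous fun t => greenNumerator p r U x t q := by
  unfold greenNumerator
  split_ifs
  · exact ((continuous_pow _).mul continuous_const).mul (continuous_cycleSum _)
  · exact continuous_const

/-- The Green function of the loop-erased walk in `U`, started at `x`. At `t = 1` the formula follows
from the case `t < 1` by Abel's theorem. -/
lemma hasSum_pathKernel (hD1 : ∀ U, 0 < cycleSum p r U 1) {U : Finset V} {x : V} (hx : x ∈ U)
    {t : ℝ} (ht : t ∈ Set.Icc (0 : ℝ) 1) (q : SAPath V) :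
    HasSum (fun k => t ^ k * (pathKernel p r U ^ k) (singlePath x) q)
      (greenNumerator p r U x t q / cycleSum p r U t) := by
  rcases ht.2.lt_or_eq with h1 | rfl
  · exact hasSum_pathKernel_of_lt_one h hx ⟨ht.1, h1⟩ q
  have hs := summable_pathKernel h hx zero_le_one hD1 q
  have habel := Real.tendsto_tsum_powerSeries_nhdsWithin_lt hs.hasSum.tendsto_sum_nat
  simp only [one_pow, one_mul] at habel
  have hlim : Tendsto (fun t => greenNumerator p r U x t q / cycleSum p r U t) (𝓝[<] 1)
      (𝓝 (greenNumerator p r U x 1 q / cycleSum p r U 1)) :=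
    (((continuous_greenNumerator U x q).continuousAt).div
      ((continuous_cycleSum U).continuousAt) (hD1 U).ne').tendsto.mono_left nhdsWithin_le_nhds
  have heq : (fun t => greenNumerator p r U x t q / cycleSum p r U t) =ᶠ[𝓝[<] 1]
      fun t => ∑' k, (pathKernel p r U ^ k) (singlePath x) q * t ^ k := by
    filter_upwards [Ioo_mem_nhdsLT (zero_lt_one (α := ℝ))] with t ht
    rw [← (hasSum_pathKernel_of_lt_one h hx ⟨ht.1.le, ht.2⟩ q).tsum_eq]
    exact tsum_congr fun k => mul_comm _ _
  have := tendsto_nhds_unique (hlim.congr' heq) habel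
  rw [this]
  simpa using hs.hasSum

end GreenSum

/-! ### The logarithm of the alternating sum -/

section LogDerivative

open Filter Topology

variable {V : Type*} [DecidableEq V] [Fintype V] {p : V → V → ℝ} {r : Cycle V → ℝ}

/-- The total weight of the based loops of length `k` in `U`: a walk from `x` is back at `x` exactly
when its loop-erased path is reduced to `x`. -/
def closedWeight (p : V → V → ℝ) (r : Cycle V → ℝ) (U : Finset V) (k : ℕ) : ℝ :=
  ∑ x ∈ U, (pathKernel p r U ^ k) (singlePath x) (singlePath x)

lemma closedWeight_nonneg (h : IsStepLaw p r) (U : Finset V) (k : ℕ) :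
    0 ≤ closedWeight p r U k :=
  Finset.sum_nonneg fun _ _ => pathKernel_pow_nonneg h U k _ _

lemma closedWeight_zero (U : Finset V) : closedWeight p r U 0 = U.card := by
  simp [closedWeight]

lemma greenNumerator_singlePath {U : Finset V} {x : V} (hx : x ∈ U) (t : ℝ) :
    greenNumerator p r U x t (singlePath x) = cycleSum p r (U.erase x) t := by
  rw [greenNumerator, if_pos (by simpa [singlePath] using hx), Finset.erase_eq]
  simp [singlePath, pathWeight]

variable (h : IsStepLaw p r) (hD1 : ∀ U, 0 < cycleSum p r U 1)
include h hD1

lemma hasSum_closedWeight (U : Finset V) {t : ℝ} (ht : t ∈ Set.Icc (0 : ℝ) 1) :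
    HasSum (fun k => t ^ k * closedWeight p r U k)
      (∑ x ∈ U, cycleSum p r (U.erase x) t / cycleSum p r U t) := by
  simp only [closedWeight, Finset.mul_sum]
  refine hasSum_sum fun x hx => ?_
  rw [← greenNumerator_singlePath hx]
  exact hasSum_pathKernel h hD1 hx ht _

lemma summable_closedWeight (U : Finset V) : Summable (closedWeight p r U) := by
  simpa using (hasSum_closedWeight h hD1 U (t := 1) (by simp)).summable

lemma summable_closedWeight_div {U : Finset V} {t : ℝ} (ht : t ∈ Set.Icc (0 : ℝ) 1) :
    Summable fun k : ℕ => t ^ k * (closedWeight p r U k / k) := by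
  refine (summable_closedWeight h hD1 U).of_nonneg_of_le (fun k => ?_) fun k => ?_
  · exact mul_nonneg (pow_nonneg ht.1 _)
      (div_nonneg (closedWeight_nonneg h U k) (Nat.cast_nonneg k))
  · refine (mul_le_of_le_one_left (div_nonneg (closedWeight_nonneg h U k) (Nat.cast_nonneg k))
      (pow_le_one₀ ht.1 ht.2)).trans ?_
    rcases Nat.eq_zero_or_pos k with rfl | hk
    · simpa using closedWeight_nonneg h U 0
    · exact div_le_self (closedWeight_nonneg h U k) (by exact_mod_cast hk)

/-- The logarithm of the alternating sum is minus the generating function of the loops, each loop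
being divided by its length: both sides have the same logarithmic derivative, and they agree at
`t = 0`. -/
lemma cycleSum_eq_exp (U : Finset V) {t : ℝ} (ht : t ∈ Set.Icc (0 : ℝ) 1) :
    cycleSum p r U t = Real.exp (-∑' k : ℕ, t ^ k * (closedWeight p r U k / k)) := by
  set A := closedWeight p r U with hA
  have hA0 : ∀ k, 0 ≤ A k := closedWeight_nonneg h U
  have hAs : Summable A := summable_closedWeight h hD1 U
  have hpos : ∀ s ∈ Set.Icc (0 : ℝ) 1, 0 < cycleSum p r U s := by
    intro s hs
    rcases hs.2.lt_or_eq with h1 | rfl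
    · exact cycleSum_pos_of_lt_one h ⟨hs.1, h1⟩ U
    · exact hD1 U
  set F : ℝ → ℝ := fun s => ∑' k : ℕ, s ^ k * (A k / k) with hF
  have hFcont : ContinuousOn F (Set.Icc 0 1) := by
    refine continuousOn_tsum (u := A) (fun k => by fun_prop) hAs fun k s hs => ?_
    rw [Real.norm_eq_abs, abs_mul, abs_of_nonneg (pow_nonneg hs.1 _),
      abs_of_nonneg (div_nonneg (hA0 k) (Nat.cast_nonneg k))]
    refine (mul_le_of_le_one_left (div_nonneg (hA0 k) (Nat.cast_nonneg k))
      (pow_le_one₀ hs.1 hs.2)).trans ?_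
    rcases Nat.eq_zero_or_pos k with rfl | hk
    · simpa using hA0 0
    · exact div_le_self (hA0 k) (by exact_mod_cast hk)
  have hFder : ∀ s ∈ Set.Ioo (0 : ℝ) 1, HasDerivAt F
      (∑' k : ℕ, (k : ℝ) * s ^ (k - 1) * (A k / k)) s := by
    intro s hs
    refine hasDerivAt_tsum_of_isPreconnected (u := A) (t := Set.Ioo (0 : ℝ) 1) (y₀ := s) hAs
      isOpen_Ioo isPreconnected_Ioo (fun k y hy => (hasDerivAt_pow k y).mul_const _)
      (fun k y hy => ?_) hs (summable_closedWeight_div h hD1 ⟨hs.1.le, hs.2.le⟩) hs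
    rcases Nat.eq_zero_or_pos k with rfl | hk
    · simpa using hA0 0
    · have hk' : (0 : ℝ) < k := by exact_mod_cast hk
      have : (k : ℝ) * y ^ (k - 1) * (A k / k) = y ^ (k - 1) * A k := by field_simp
      rw [this, Real.norm_eq_abs, abs_of_nonneg (mul_nonneg (pow_nonneg hy.1.le _) (hA0 k))]
      exact mul_le_of_le_one_left (hA0 k) (pow_le_one₀ hy.1.le hy.2.le)
  have hval : ∀ s ∈ Set.Ioo (0 : ℝ) 1, ∑' k : ℕ, (k : ℝ) * s ^ (k - 1) * (A k / k) =
      s⁻¹ * ∑ x ∈ U, (cycleSum p r (U.erase x) s / cycleSum p r U s - 1) := by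
    intro s hs
    have h1 := hasSum_closedWeight h hD1 U (t := s) ⟨hs.1.le, hs.2.le⟩
    have h2 : HasSum (fun k : ℕ => if k = 0 then (U.card : ℝ) else 0) U.card :=
      hasSum_ite_eq 0 _
    have h3 := (h1.sub h2).mul_left s⁻¹
    rw [Finset.sum_sub_distrib, Finset.sum_const, nsmul_eq_mul, mul_one, ← h3.tsum_eq]
    refine tsum_congr fun k => ?_
    rcases Nat.eq_zero_or_pos k with rfl | hk
    · simp [closedWeight_zero]
    · obtain ⟨m, rfl⟩ := Nat.exists_eq_succ_of_ne_zero hk.ne'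
      rw [if_neg (Nat.succ_ne_zero m), ← hA, Nat.succ_sub_one, pow_succ]
      have : s ≠ 0 := hs.1.ne'
      have : ((m.succ : ℕ) : ℝ) ≠ 0 := by positivity
      field_simp
      ring
  have hconst : Real.log (cycleSum p r U t) + F t = Real.log (cycleSum p r U 0) + F 0 := by
    have hder : ∀ s ∈ Set.Ioo (0 : ℝ) 1,
        HasDerivAt (fun s => Real.log (cycleSum p r U s) + F s) 0 s := by
      intro s hs
      have hD := hpos s ⟨hs.1.le, hs.2.le⟩
      have h1 : HasDerivAt (cycleSum p r U)
          (s⁻¹ * ∑ x ∈ U, (cycleSum p r U s - cycleSum p r (U.erase x) s)) s :=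
        hasDerivAt_alternatingSum hs.1.ne'
      have h2 := (h1.log hD.ne').add (hFder s hs)
      rw [hval s hs] at h2
      refine h2.congr_deriv ?_
      rw [mul_div_assoc, ← mul_add, Finset.sum_div, ← Finset.sum_add_distrib,
        Finset.sum_eq_zero, mul_zero]
      intro x _
      rw [sub_div, div_self hD.ne']
      ring
    have hcont : ContinuousOn (fun s => Real.log (cycleSum p r U s) + F s) (Set.Icc 0 1) :=
      ((continuous_cycleSum U).continuousOn.log fun s hs => (hpos s hs).ne').add hFcont
    rcases ht.1.eq_or_lt with h0 | h0
    · rw [← h0]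
    · obtain ⟨c, hc, hc'⟩ := exists_hasDerivAt_eq_slope _ _ h0
        (hcont.mono (Set.Icc_subset_Icc_right ht.2))
        (fun s hs => hder s ⟨hs.1, hs.2.trans_le ht.2⟩)
      rw [eq_comm, div_eq_zero_iff] at hc'
      rcases hc' with hc' | hc'
      · exact sub_eq_zero.1 hc'
      · linarith
  have hF0 : F 0 = 0 := by
    simp only [hF]
    rw [tsum_eq_single 0]
    · simp
    · intro k hk
      simp [hk]
  have hD0 : cycleSum p r U 0 = 1 := alternatingSum_zero
  rw [hF0, hD0, Real.log_one, add_zero] at hconst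
  rw [← Real.exp_log (hpos t ht)]
  congr 1
  linarith

end LogDerivative

/-! ### The step law of the algorithm -/

section StepLaw

variable {V : Type*}

open Classical in
/-- The probability that a cycle is erased; cycles that are not oriented cycles of `G` are never formed,
and they count as erased. -/
def eraseProb (G : SimpleGraph V) (α : Cycle V → ℝ) (c : Cycle V) : ℝ :=
  if IsOrientedCycle G c then 1 - α c else 1

lemma isStepLaw [Fintype V] {G : SimpleGraph V} (hG : G.Connected) (hn : 1 < Fintype.card V)
    {W : Matrix V V ℝ} (hW : IsEdgeWeight G W) {α : Cycle V → ℝ}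
    (hα : ∀ c, IsOrientedCycle G c → α c ∈ Set.Icc (0 : ℝ) 1) :
    IsStepLaw (transition W) (eraseProb G α) := by
  have hW0 : ∀ x y, 0 ≤ W x y := by
    intro x y
    by_cases h : G.Adj x y
    · exact (hW.pos x y h).le
    · exact (hW.zero x y h).ge
  have hdeg : ∀ x, 0 < ∑ z, W x z := by
    intro x
    have : Nontrivial V := Fintype.one_lt_card_iff_nontrivial.1 hn
    obtain ⟨y, hy⟩ := hG.preconnected.exists_adj_of_nontrivial x
    exact Finset.sum_pos' (fun z _ => hW0 x z) ⟨y, Finset.mem_univ _, hW.pos x y hy⟩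
  refine ⟨fun x y => div_nonneg (hW0 x y) (hdeg x).le, fun x => ?_, fun c => ?_, fun c => ?_⟩
  · simp only [transition]
    rw [← Finset.sum_div, div_self (hdeg x).ne']
  · unfold eraseProb
    split_ifs with h
    · linarith [(hα c h).2]
    · exact zero_le_one
  · unfold eraseProb
    split_ifs with h
    · linarith [(hα c h).1]
    · exact le_rfl

lemma transition_pos [Fintype V] {G : SimpleGraph V} {W : Matrix V V ℝ} (hW : IsEdgeWeight G W)
    {x y : V} (h : G.Adj x y) : 0 < transition W x y := by
  refine div_pos (hW.pos x y h) (Finset.sum_pos' (fun z _ => ?_)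
    ⟨y, Finset.mem_univ _, hW.pos x y h⟩)
  by_cases hz : G.Adj x z
  · exact (hW.pos x z hz).le
  · exact (hW.zero x z hz).ge

end StepLaw

/-! ### The loop measure as a trace of powers of the kernel -/

section LoopSums

variable {V : Type*} [DecidableEq V]

/-- The weight of the walk that visits the vertices of a list in order, from the state `q`. -/
def listWeight (p : V → V → ℝ) (r : Cycle V → ℝ) : List V → List V → ℝ
  | _, [] => 1
  | q, y :: l => moveWeight p r q y * listWeight p r (eraseStep q y) l

lemma eraseStep_getLast? (q : List V) (y : V) : (eraseStep q y).getLast? = some y := by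
  obtain ⟨a, ha⟩ : ∃ a, eraseStep q y = a ++ [y] := eraseStep_eq_concat q y
  simp [ha]

lemma listWeight_nonneg [Fintype V] {p : V → V → ℝ} {r : Cycle V → ℝ} (h : IsStepLaw p r)
    (q l : List V) : 0 ≤ listWeight p r q l := by
  induction l generalizing q with
  | nil => exact zero_le_one
  | cons y l ih => exact mul_nonneg (moveWeight_nonneg h q y) (ih _)

/-- The step weights of a walk factor into the transition probabilities and the weights of the cycles
that are erased. -/
lemma listWeight_support {G : SimpleGraph V} (p : V → V → ℝ) (r : Cycle V → ℝ) {x y : V}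
    (w : G.Walk x y) (q : List V) (hq : q.getLast? = some x) :
    listWeight p r q w.support.tail = (w.darts.map fun d => p d.fst d.snd).prod *
      ((erasedCycles q w.support.tail).map r).prod := by
  induction w generalizing q with
  | nil => simp [listWeight, erasedCycles]
  | @cons x v y hadj w ih =>
    have hs : w.support = v :: w.support.tail := w.cons_tail_support.symm
    rw [SimpleGraph.Walk.support_cons, List.tail_cons, hs, listWeight,
      ih _ (eraseStep_getLast? q v), SimpleGraph.Walk.darts_cons, erasedCycles, moveWeight, hq]
    simp only [List.map_cons, List.prod_cons]
    split_ifs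
    · rw [Multiset.map_cons, Multiset.prod_cons]; ring
    · ring

lemma isOrientedCycle_closedCycle {G : SimpleGraph V} {q : List V} {x v : V} (hq : q.Nodup)
    (hc : q.IsChain G.Adj) (hx : q.getLast? = some x) (hadj : G.Adj x v) (hv : v ∈ q) :
    IsOrientedCycle G (closedCycle q v) := by
  obtain ⟨a, l, rfl, ha⟩ := List.eq_append_cons_of_mem hv
  rw [closedCycle_append_cons ha]
  refine ⟨?_, ?_, ?_⟩
  · rw [Cycle.length_coe]
    cases l with
    | nil =>
      have : v = x := by simpa using hx
      exact absurd (this ▸ hadj) (G.loopless.irrefl _)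
    | cons z l => simp
  · rw [Cycle.nodup_coe_iff]
    exact (List.nodup_append.1 hq).2.1
  · rw [Cycle.chain_coe_cons]
    have h1 : (v :: l).IsChain G.Adj := (List.isChain_append.1 hc).2.1
    have h2 : (v :: l).getLast? = some x := by
      rw [List.getLast?_append] at hx
      simpa using hx
    rw [← List.cons_append, List.isChain_append]
    refine ⟨h1, by simp, ?_⟩
    intro u hu z hz
    rw [h2] at hu
    simp at hu hz
    subst hu hz
    exact hadj

lemma eraseStep_isChain {G : SimpleGraph V} {q : List V} {x v : V}
    (hc : q.IsChain G.Adj) (hx : q.getLast? = some x) (hadj : G.Adj x v) :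
    (eraseStep q v).IsChain G.Adj := by
  by_cases hv : v ∈ q
  · obtain ⟨a, l, rfl, ha⟩ := List.eq_append_cons_of_mem hv
    rw [eraseStep_append_cons ha]
    have : a ++ v :: l = (a ++ [v]) ++ l := by simp
    rw [this] at hc
    exact (List.isChain_append.1 hc).1
  · rw [eraseStep_of_notMem hv, List.isChain_append]
    refine ⟨hc, by simp, ?_⟩
    intro u hu z hz
    rw [hx] at hu
    simp at hu hz
    subst hu hz
    exact hadj

lemma isOrientedCycle_of_mem_erasedCycles {G : SimpleGraph V} {x y : V} (w : G.Walk x y)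
    (q : List V) (hq : q.Nodup) (hc : q.IsChain G.Adj) (hx : q.getLast? = some x)
    (c : Cycle V) (hcm : c ∈ erasedCycles q w.support.tail) : IsOrientedCycle G c := by
  induction w generalizing q with
  | nil => simp [erasedCycles] at hcm
  | @cons x v y hadj w ih =>
    have hs : w.support = v :: w.support.tail := w.cons_tail_support.symm
    rw [SimpleGraph.Walk.support_cons, List.tail_cons, hs, erasedCycles] at hcm
    have hrec := ih _ (eraseStep_nodup hq v) (eraseStep_isChain hc hx hadj) (eraseStep_getLast? q v)
    split_ifs at hcm with hv
    · rcases Multiset.mem_cons.1 hcm with rfl | h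
      · exact isOrientedCycle_closedCycle hq hc hx hadj hv
      · exact hrec h
    · exact hrec hcm

/-- A walk is trivial, or it is a step followed by a walk. -/
def walkEquiv (G : SimpleGraph V) (x : V) :
    (Σ y, G.Walk x y) ≃ Option (Σ v : {v // G.Adj x v}, Σ y, G.Walk v.1 y) where
  toFun
    | ⟨_, .nil⟩ => none
    | ⟨y, .cons h w⟩ => some ⟨⟨_, h⟩, ⟨y, w⟩⟩
  invFun
    | none => ⟨x, .nil⟩
    | some ⟨v, ⟨y, w⟩⟩ => ⟨y, .cons v.2 w⟩
  left_inv := by rintro ⟨_, _ | _⟩ <;> rfl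
  right_inv := by rintro (_ | ⟨_, ⟨_, _⟩⟩) <;> rfl

lemma foldl_eraseStep_head? (q l : List V) (hq : q ≠ []) :
    (l.foldl eraseStep q).head? = q.head? := by
  induction l generalizing q with
  | nil => rfl
  | cons y l ih =>
    have : eraseStep q y ≠ [] := by
      obtain ⟨a, ha⟩ := eraseStep_eq_concat q y
      simp [ha]
    rw [List.foldl_cons, ih _ this, eraseStep_head? hq]

lemma foldl_eraseStep_nodup (q l : List V) (hq : q.Nodup) : (l.foldl eraseStep q).Nodup := by
  induction l generalizing q with
  | nil => exact hq
  | cons y l ih => exact ih _ (eraseStep_nodup hq y)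

lemma foldl_eraseStep_getLast? {G : SimpleGraph V} {x y : V} (w : G.Walk x y) (q : List V)
    (hq : q.getLast? = some x) : (w.support.tail.foldl eraseStep q).getLast? = some y := by
  induction w generalizing q with
  | nil => simpa using hq
  | @cons x v y hadj w ih =>
    rw [SimpleGraph.Walk.support_cons, List.tail_cons, ← w.cons_tail_support, List.foldl_cons]
    exact ih _ (eraseStep_getLast? q v)

/-- The loop-erased path of a walk is reduced to its starting point exactly when the walk is closed. -/
lemma foldl_eraseStep_eq_singleton_iff {G : SimpleGraph V} {x y : V} (w : G.Walk x y) :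
    w.support.tail.foldl eraseStep [x] = [x] ↔ y = x := by
  have hlast := foldl_eraseStep_getLast? w [x] rfl
  constructor
  · intro h
    rw [h] at hlast
    simpa using hlast.symm
  · rintro rfl
    have hhead := foldl_eraseStep_head? [y] w.support.tail (by simp)
    have hnd := foldl_eraseStep_nodup [y] w.support.tail (by simp)
    obtain ⟨l, hl⟩ := List.head?_eq_some_iff.1 (hhead.trans rfl)
    rw [hl] at hlast hnd ⊢
    cases l with
    | nil => rfl
    | cons z l =>
      rw [List.getLast?_cons_cons] at hlast
      exact absurd (List.mem_of_getLast? hlast) (List.nodup_cons.1 hnd).1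

variable [Fintype V]

/-- The powers of the kernel sum the weights of the walks of a given length, by their final loop-erased
path. -/
lemma tsum_walk_eq_pow {G : SimpleGraph V} {p : V → V → ℝ} {r : Cycle V → ℝ} (h : IsStepLaw p r)
    (hp : ∀ x y, ¬ G.Adj x y → p x y = 0) (q' : SAPath V) (k : ℕ) (x : V) (q : SAPath V)
    (hq : q.1.getLast? = some x) :
    ∑' w : Σ y, G.Walk x y, (if w.2.length = k ∧ w.2.support.tail.foldl eraseStep q.1 = q'.1 then
      ENNReal.ofReal (listWeight p r q.1 w.2.support.tail) else 0) =
    ENNReal.ofReal ((pathKernel p r Finset.univ ^ k) q q') := by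
  induction k generalizing x q with
  | zero =>
    rw [tsum_eq_single (⟨x, .nil⟩ : Σ y, G.Walk x y)]
    · by_cases hqq : q = q'
      · subst hqq
        simp [listWeight]
      · rw [pow_zero, Matrix.one_apply_ne hqq, if_neg, ENNReal.ofReal_zero]
        rintro ⟨-, h⟩
        exact hqq (Subtype.ext (by simpa using h))
    · rintro ⟨y, w⟩ hw
      refine if_neg fun hh => hw ?_
      cases w with
      | nil => rfl
      | cons => simp at hh
  | succ k ih =>
    have hker : ENNReal.ofReal ((pathKernel p r Finset.univ ^ (k + 1)) q q') =
        ∑ v, ENNReal.ofReal (moveWeight p r q.1 v) *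
          ENNReal.ofReal ((pathKernel p r Finset.univ ^ k) (nextPath q v) q') := by
      have : (pathKernel p r Finset.univ ^ (k + 1)) q q' =
          ∑ v, moveWeight p r q.1 v * (pathKernel p r Finset.univ ^ k) (nextPath q v) q' := by
        rw [pow_succ', Matrix.mul_apply]
        simp only [pathKernel, Finset.sum_mul]
        rw [Finset.sum_comm]
        simp [ite_mul]
      rw [this, ENNReal.ofReal_sum_of_nonneg]
      · exact Finset.sum_congr rfl fun v _ => ENNReal.ofReal_mul (moveWeight_nonneg h _ _)
      · exact fun v _ => mul_nonneg (moveWeight_nonneg h _ _) (pathKernel_pow_nonneg h _ _ _ _)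
    rw [hker, ← (walkEquiv G x).symm.tsum_eq, ← (Option.some_injective _).tsum_eq]
    · rw [ENNReal.tsum_sigma']
      have hstep : ∀ v : {v // G.Adj x v},
          (∑' b : Σ y, G.Walk v.1 y,
            if ((walkEquiv G x).symm (some ⟨v, b⟩)).2.length = k + 1 ∧
              ((walkEquiv G x).symm (some ⟨v, b⟩)).2.support.tail.foldl eraseStep q.1 = q'.1 then
              ENNReal.ofReal (listWeight p r q.1
                ((walkEquiv G x).symm (some ⟨v, b⟩)).2.support.tail) else 0) =
          ENNReal.ofReal (moveWeight p r q.1 v.1) *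
            ENNReal.ofReal ((pathKernel p r Finset.univ ^ k) (nextPath q v.1) q') := by
        intro v
        rw [← ih v.1 (nextPath q v.1) (eraseStep_getLast? q.1 v.1), ← ENNReal.tsum_mul_left]
        refine tsum_congr fun b => ?_
        obtain ⟨y, w⟩ := b
        have hs : w.support = v.1 :: w.support.tail := w.cons_tail_support.symm
        change (if (SimpleGraph.Walk.cons v.2 w).length = k + 1 ∧
          (SimpleGraph.Walk.cons v.2 w).support.tail.foldl eraseStep q.1 = q'.1 then
            ENNReal.ofReal (listWeight p r q.1 (SimpleGraph.Walk.cons v.2 w).support.tail) else 0) = _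
        rw [SimpleGraph.Walk.length_cons, SimpleGraph.Walk.support_cons, List.tail_cons, hs,
          List.foldl_cons, listWeight, ENNReal.ofReal_mul (moveWeight_nonneg h _ _), mul_ite,
          mul_zero]
        simp [nextPath]
      rw [tsum_congr hstep]
      refine (tsum_subtype {v | G.Adj x v} fun v => ENNReal.ofReal (moveWeight p r q.1 v) *
        ENNReal.ofReal ((pathKernel p r Finset.univ ^ k) (nextPath q v) q')).trans ?_
      rw [tsum_fintype]
      refine Finset.sum_congr rfl fun v _ => Set.indicator_apply_eq_self.2 fun hv => ?_
      have : moveWeight p r q.1 v = 0 := by simp [moveWeight, hq, hp x v hv]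
      simp [this]
    · intro o ho
      cases o with
      | none =>
        refine absurd (if_neg ?_) ho
        rintro ⟨h0, -⟩
        change 0 = k + 1 at h0
        omega
      | some b => exact ⟨b, rfl⟩

variable {G : SimpleGraph V} {W : Matrix V V ℝ} {α : Cycle V → ℝ}

lemma basedMeasure_eq_listWeight (γ : BasedLoop G) : basedMeasure W α γ =
    listWeight (transition W) (eraseProb G α) [γ.1] γ.2.support.tail := by
  obtain ⟨x, w⟩ := γ
  have hcyc : cycles (⟨x, w⟩ : BasedLoop G) = erasedCycles [x] w.support.tail := by
    change erasedCycles [] w.support = _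
    rw [← w.cons_tail_support, erasedCycles, if_neg (by simp)]
    simp [eraseStep]
  rw [listWeight_support _ _ _ _ rfl, basedMeasure, stepWeight, hcyc]
  congr 2
  refine Multiset.map_congr rfl fun c hc => ?_
  rw [eraseProb, if_pos (isOrientedCycle_of_mem_erasedCycles w [x] (by simp) (by simp) rfl c hc)]

variable (hstep : IsStepLaw (transition W) (eraseProb G α)) (hW : IsEdgeWeight G W)
include hstep

lemma basedMeasure_nonneg (γ : BasedLoop G) : 0 ≤ basedMeasure W α γ := by
  rw [basedMeasure_eq_listWeight]
  exact listWeight_nonneg hstep _ _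

lemma loopMass_nonneg (ℓ : UnbasedLoop G) : 0 ≤ loopMass W α ℓ := by
  unfold loopMass
  split_ifs
  · exact le_rfl
  · exact div_nonneg (tsum_nonneg fun γ => basedMeasure_nonneg hstep γ.1) (Nat.cast_nonneg _)

include hW

lemma tsum_basedMeasure (k : ℕ) :
    ∑' γ : BasedLoop G, (if γ.2.length = k then ENNReal.ofReal (basedMeasure W α γ) else 0) =
      ENNReal.ofReal (closedWeight (transition W) (eraseProb G α) Finset.univ k) := by
  have hp : ∀ x y, ¬ G.Adj x y → transition W x y = 0 := fun x y hxy => by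
    simp [transition, hW.zero x y hxy]
  rw [closedWeight, ENNReal.ofReal_sum_of_nonneg fun x _ => pathKernel_pow_nonneg hstep _ _ _ _,
    ENNReal.tsum_sigma', tsum_fintype]
  refine Finset.sum_congr rfl fun x _ => ?_
  rw [← tsum_walk_eq_pow hstep hp (singlePath x) k x (singlePath x) rfl, ENNReal.tsum_sigma',
    tsum_eq_single x]
  · refine tsum_congr fun w => ?_
    rw [basedMeasure_eq_listWeight]
    simp [singlePath, foldl_eraseStep_eq_singleton_iff]
  · intro y hy
    refine ENNReal.tsum_eq_zero.2 fun w => if_neg ?_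
    rintro ⟨-, h⟩
    exact hy ((foldl_eraseStep_eq_singleton_iff w).1 h)

lemma tsum_basedMeasure_mul (f : ℕ → ℝ) (hf : ∀ k, 0 ≤ f k) :
    ∑' γ : BasedLoop G, ENNReal.ofReal (f γ.2.length * basedMeasure W α γ) =
      ∑' k, ENNReal.ofReal (f k * closedWeight (transition W) (eraseProb G α) Finset.univ k) := by
  have h1 : ∀ γ : BasedLoop G, ENNReal.ofReal (f γ.2.length * basedMeasure W α γ) =
      ∑' k, ENNReal.ofReal (f k) *
        (if γ.2.length = k then ENNReal.ofReal (basedMeasure W α γ) else 0) := by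
    intro γ
    rw [tsum_eq_single γ.2.length]
    · rw [if_pos rfl, ENNReal.ofReal_mul (hf _)]
    · intro k hk
      rw [if_neg (Ne.symm hk), mul_zero]
  rw [tsum_congr h1, ENNReal.tsum_comm]
  refine tsum_congr fun k => ?_
  rw [ENNReal.tsum_mul_left, tsum_basedMeasure hstep hW, ENNReal.ofReal_mul (hf _)]

lemma summable_basedMeasure_fiber (ℓ : UnbasedLoop G) :
    Summable fun γ : {γ : BasedLoop G // UnbasedLoop.mk γ = ℓ} => basedMeasure W α γ.1 := by
  have h1 : ∑' γ : {γ : BasedLoop G // UnbasedLoop.mk γ = ℓ},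
      ENNReal.ofReal (basedMeasure W α γ.1) ≠ ∞ := by
    refine ne_top_of_le_ne_top (ENNReal.ofReal_ne_top (r :=
      closedWeight (transition W) (eraseProb G α) Finset.univ ℓ.length)) ?_
    rw [← tsum_basedMeasure hstep hW]
    refine le_trans (le_of_eq ?_) (ENNReal.tsum_comp_le_tsum_of_injective
      (Subtype.val_injective (p := fun γ : BasedLoop G => UnbasedLoop.mk γ = ℓ)) _)
    refine tsum_congr fun γ => ?_
    exact (if_pos (congrArg UnbasedLoop.length γ.2)).symm
  have h2 := ENNReal.summable_toReal h1
  refine h2.congr fun γ => ?_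
  rw [ENNReal.toReal_ofReal (basedMeasure_nonneg hstep _)]

/-- Sums over the unbased loops, as sums over the lengths of the loops. -/
lemma hasSum_loopMass (f : ℕ → ℝ) (hf : ∀ k, 0 ≤ f k) (hs : Summable fun k : ℕ =>
    f k * (closedWeight (transition W) (eraseProb G α) Finset.univ k / k)) :
    HasSum (fun ℓ : UnbasedLoop G => f ℓ.length * loopMass W α ℓ)
      (∑' k : ℕ, f k * (closedWeight (transition W) (eraseProb G α) Finset.univ k / k)) := by
  have hfib : ∀ ℓ : UnbasedLoop G, ENNReal.ofReal (f ℓ.length * loopMass W α ℓ) =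
      ∑' γ : {γ : BasedLoop G // UnbasedLoop.mk γ = ℓ},
        ENNReal.ofReal (f γ.1.2.length / γ.1.2.length * basedMeasure W α γ.1) := by
    intro ℓ
    have hlen : ∀ γ : {γ : BasedLoop G // UnbasedLoop.mk γ = ℓ}, γ.1.2.length = ℓ.length :=
      fun γ => congrArg UnbasedLoop.length γ.2
    -- for trivial loops both sides vanish, a division by zero giving zero
    have h1 : f ℓ.length * loopMass W α ℓ =
        f ℓ.length / ℓ.length * unbasedMeasure W α ℓ := by
      unfold loopMass
      split_ifs with h0
      · simp [h0]
      · ring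
    rw [h1, unbasedMeasure, ← tsum_mul_left, ENNReal.ofReal_tsum_of_nonneg]
    · exact tsum_congr fun γ => by rw [hlen]
    · exact fun γ => mul_nonneg (div_nonneg (hf _) (Nat.cast_nonneg _))
        (basedMeasure_nonneg hstep _)
    · exact (summable_basedMeasure_fiber hstep hW ℓ).mul_left _
  have hnn : ∀ k : ℕ, 0 ≤ f k * (closedWeight (transition W) (eraseProb G α) Finset.univ k / k) :=
    fun k => mul_nonneg (hf k) (div_nonneg (closedWeight_nonneg hstep _ k) (Nat.cast_nonneg k))
  have htot : ∑' ℓ : UnbasedLoop G, ENNReal.ofReal (f ℓ.length * loopMass W α ℓ) =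
      ENNReal.ofReal
        (∑' k : ℕ, f k * (closedWeight (transition W) (eraseProb G α) Finset.univ k / k)) := by
    rw [tsum_congr hfib, ← ENNReal.tsum_sigma' (fun s : Σ ℓ : UnbasedLoop G, {γ : BasedLoop G //
      UnbasedLoop.mk γ = ℓ} => ENNReal.ofReal (f s.2.1.2.length / s.2.1.2.length *
        basedMeasure W α s.2.1))]
    have := (Equiv.sigmaFiberEquiv (UnbasedLoop.mk (G := G))).tsum_eq fun γ =>
      ENNReal.ofReal (f γ.2.length / γ.2.length * basedMeasure W α γ)
    rw [ENNReal.ofReal_tsum_of_nonneg hnn hs]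
    refine Eq.trans this ?_
    rw [tsum_basedMeasure_mul hstep hW (fun k => f k / k)
      fun k => div_nonneg (hf k) (Nat.cast_nonneg k)]
    exact tsum_congr fun k => by rw [div_mul_eq_mul_div, mul_div_assoc]
  have hnn' : ∀ ℓ : UnbasedLoop G, 0 ≤ f ℓ.length * loopMass W α ℓ := fun ℓ =>
    mul_nonneg (hf _) (loopMass_nonneg hstep ℓ)
  have hsum : Summable fun ℓ : UnbasedLoop G => f ℓ.length * loopMass W α ℓ := by
    have h2 := ENNReal.summable_toReal (htot ▸ ENNReal.ofReal_ne_top)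
    exact h2.congr fun ℓ => ENNReal.toReal_ofReal (hnn' ℓ)
  rw [hsum.hasSum_iff]
  rw [← ENNReal.ofReal_tsum_of_nonneg hnn' hsum] at htot
  exact (ENNReal.ofReal_eq_ofReal_iff (tsum_nonneg hnn') (tsum_nonneg hnn)).1 htot

end LoopSums

/-! ### The trajectories of one walk -/

section Trajectories

variable {V : Type*} [DecidableEq V]

lemma loopErased_congr {X Y : ℕ → V} {k : ℕ} (h : ∀ i ≤ k, X i = Y i) :
    loopErased X k = loopErased Y k := by
  induction k with
  | zero => simp [loopErased, h 0 le_rfl]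
  | succ k ih =>
    rw [loopErased, loopErased, ih fun i hi => h i (by omega), h (k + 1) le_rfl]

lemma loopErased_nodup (X : ℕ → V) (k : ℕ) : (loopErased X k).Nodup := by
  induction k with
  | zero => simp [loopErased]
  | succ k ih => exact eraseStep_nodup ih _

lemma loopErased_getLast? (X : ℕ → V) (k : ℕ) : (loopErased X k).getLast? = some (X k) := by
  cases k with
  | zero => simp [loopErased]
  | succ k => exact eraseStep_getLast? _ _

/-- The loop-erased path, as a state of the loop-erased walk. -/
def erasedPath (X : ℕ → V) (k : ℕ) : SAPath V := ⟨loopErased X k, loopErased_nodup X k⟩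

lemma erasedPath_succ (X : ℕ → V) (k : ℕ) :
    erasedPath X (k + 1) = nextPath (erasedPath X k) (X (k + 1)) := rfl

lemma not_formedAt_zero (X : ℕ → V) (c : Cycle V) : ¬ FormedAt X 0 c := by
  rintro ⟨j, hj, -⟩
  omega

lemma formedAt_succ {X : ℕ → V} {k : ℕ} {c : Cycle V} : FormedAt X (k + 1) c ↔
    X (k + 1) ∈ loopErased X k ∧ c = closedCycle (loopErased X k) (X (k + 1)) := by
  constructor
  · rintro ⟨j, hj, h⟩
    obtain rfl : k = j := by omega
    exact h
  · rintro h
    exact ⟨k, rfl, h⟩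

lemma formedAt_congr {X Y : ℕ → V} {k : ℕ} (h : ∀ i ≤ k, X i = Y i) (c : Cycle V) :
    FormedAt X k c ↔ FormedAt Y k c := by
  cases k with
  | zero => simp [not_formedAt_zero]
  | succ k =>
    rw [formedAt_succ, formedAt_succ, loopErased_congr fun i hi => h i (by omega),
      h (k + 1) le_rfl]

/-- The product of the weights of the steps of the loop-erased walk along a trajectory. -/
def trajectoryWeight (p : V → V → ℝ) (r : Cycle V → ℝ) (y : ℕ → V) (k : ℕ) : ℝ :=
  ∏ i ∈ Finset.range k, moveWeight p r (loopErased y i) (y (i + 1))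

lemma trajectoryWeight_eq (p : V → V → ℝ) (r : Cycle V → ℝ) (y : ℕ → V) (k : ℕ) :
    trajectoryWeight p r y k = (∏ i ∈ Finset.range k, p (y i) (y (i + 1))) *
      ∏ i ∈ Finset.range k, if y (i + 1) ∈ loopErased y i then
        r (closedCycle (loopErased y i) (y (i + 1))) else 1 := by
  rw [trajectoryWeight, ← Finset.prod_mul_distrib]
  refine Finset.prod_congr rfl fun i _ => ?_
  rw [moveWeight, loopErased_getLast?]

variable {G : SimpleGraph V}

/-- The walk does not stop up to time `k`. -/
def SurvivesTo (X : ℕ → V) (b : OrientedCycle G → ℕ → Bool) (A : Finset V) (k : ℕ) : Prop :=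
  ∀ j ≤ k, ¬ StopsAt X b A j

lemma survivesTo_iff {X : ℕ → V} {b : OrientedCycle G → ℕ → Bool} {A : Finset V} {k : ℕ} :
    SurvivesTo X b A k ↔ (∀ j ≤ k, X j ∉ A) ∧
      ∀ j ≤ k, ∀ c : OrientedCycle G, FormedAt X j c.1 → b c j = false := by
  simp only [SurvivesTo, StopsAt, not_or, not_exists, not_and, Bool.not_eq_true]
  exact ⟨fun h => ⟨fun j hj => (h j hj).1, fun j hj => (h j hj).2⟩,
    fun h j hj => ⟨h.1 j hj, h.2 j hj⟩⟩

lemma survivesTo_succ {X : ℕ → V} {b : OrientedCycle G → ℕ → Bool} {A : Finset V} {k : ℕ} :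
    SurvivesTo X b A (k + 1) ↔ SurvivesTo X b A k ∧ ¬ StopsAt X b A (k + 1) := by
  constructor
  · exact fun h => ⟨fun j hj => h j (by omega), h _ le_rfl⟩
  · rintro ⟨h, h'⟩ j hj
    rcases Nat.lt_or_ge j (k + 1) with h1 | h1
    · exact h j (by omega)
    · obtain rfl : j = k + 1 := by omega
      exact h'

instance [Fintype V] (G : SimpleGraph V) : Finite (OrientedCycle G) :=
  Finite.of_injective (β := {c : Cycle V // c.Nodup}) (fun c => ⟨c.1, c.2.2.1⟩) fun _ _ h =>
    Subtype.ext (Subtype.mk.inj h)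

end Trajectories

section Measurability

variable {V : Type*} [Fintype V] [DecidableEq V] [MeasurableSpace V] [MeasurableSingletonClass V]

lemma measurableSet_erasedPath (k : ℕ) (q : SAPath V) :
    MeasurableSet {Y : ℕ → V | erasedPath Y k = q} := by
  induction k generalizing q with
  | zero =>
    have : {Y : ℕ → V | erasedPath Y 0 = q} = (fun Y : ℕ → V => Y 0) ⁻¹' {v | singlePath v = q} := rfl
    rw [this]
    exact measurable_pi_apply 0 (Set.toFinite _).measurableSet
  | succ k ih =>
    have : {Y : ℕ → V | erasedPath Y (k + 1) = q} = ⋃ q' : SAPath V,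
        {Y : ℕ → V | erasedPath Y k = q'} ∩
          (fun Y : ℕ → V => Y (k + 1)) ⁻¹' {v | nextPath q' v = q} := by
      ext Y
      simp [erasedPath_succ]
    rw [this]
    exact MeasurableSet.iUnion fun q' => (ih q').inter
      (measurable_pi_apply (k + 1) (Set.toFinite _).measurableSet)

lemma measurableSet_formedAt (k : ℕ) (c : Cycle V) : MeasurableSet {Y : ℕ → V | FormedAt Y k c} := by
  cases k with
  | zero => simp [not_formedAt_zero]
  | succ k =>
    have : {Y : ℕ → V | FormedAt Y (k + 1) c} = ⋃ q : SAPath V,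
        {Y : ℕ → V | erasedPath Y k = q} ∩
          (fun Y : ℕ → V => Y (k + 1)) ⁻¹' {v | v ∈ q.1 ∧ c = closedCycle q.1 v} := by
      ext Y
      simp [formedAt_succ, erasedPath]
    rw [this]
    exact MeasurableSet.iUnion fun q => (measurableSet_erasedPath k q).inter
      (measurable_pi_apply (k + 1) (Set.toFinite _).measurableSet)

variable {G : SimpleGraph V}

lemma measurableSet_stopsAt (A : Finset V) (k : ℕ) :
    MeasurableSet {d : (ℕ → V) × (OrientedCycle G → ℕ → Bool) | StopsAt d.1 d.2 A k} := by
  have : {d : (ℕ → V) × (OrientedCycle G → ℕ → Bool) | StopsAt d.1 d.2 A k} =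
      {d : (ℕ → V) × (OrientedCycle G → ℕ → Bool) | d.1 k ∈ (A : Set V)} ∪ ⋃ c : OrientedCycle G,
        (Prod.fst ⁻¹' {Y : ℕ → V | FormedAt Y k c.1}) ∩
          {d : (ℕ → V) × (OrientedCycle G → ℕ → Bool) | d.2 c k = true} := by
    ext d
    simp [StopsAt]
  rw [this]
  refine MeasurableSet.union ?_ (MeasurableSet.iUnion fun c => MeasurableSet.inter ?_ ?_)
  · exact ((measurable_pi_apply k).comp measurable_fst) A.measurableSet
  · exact measurable_fst (measurableSet_formedAt k c.1)
  · exact measurableSet_eq_fun ((measurable_pi_apply k).comp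
      ((measurable_pi_apply c).comp measurable_snd)) measurable_const

lemma measurableSet_survivesTo (A : Finset V) (k : ℕ) :
    MeasurableSet {d : (ℕ → V) × (OrientedCycle G → ℕ → Bool) | SurvivesTo d.1 d.2 A k} := by
  have : {d : (ℕ → V) × (OrientedCycle G → ℕ → Bool) | SurvivesTo d.1 d.2 A k} =
      ⋂ j, ⋂ (_ : j ≤ k), {d | StopsAt d.1 d.2 A j}ᶜ := by
    ext d
    simp [SurvivesTo]
  rw [this]
  exact MeasurableSet.iInter fun j => MeasurableSet.iInter fun _ => (measurableSet_stopsAt A j).compl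

end Measurability

section TrajectoryLaw

variable {V : Type*} [Fintype V] [DecidableEq V] [MeasurableSpace V]

variable {Ω : Type*} [MeasurableSpace Ω] {G : SimpleGraph V} {W : Matrix V V ℝ} {α : Cycle V → ℝ}
  {P : Measure Ω} {X : V → ℕ → Ω → V} {B : V → OrientedCycle G → ℕ → Ω → Bool}

variable [IsProbabilityMeasure P]
  (hstep : IsStepLaw (transition W) (eraseProb G α))
  (hα : ∀ c, IsOrientedCycle G c → α c ∈ Set.Icc (0 : ℝ) 1)
  (hXB : IsRandomInput W α P X B)
include hα hXB

lemma prob_bit_false (x : V) (c : OrientedCycle G) (k : ℕ) :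
    P {ω | B x c k ω = false} = ENNReal.ofReal (1 - α c.1) := by
  have h1 : {ω | B x c k ω = false} = {ω | B x c k ω = true}ᶜ := by
    ext ω
    simp
  have hm : MeasurableSet {ω | B x c k ω = true} :=
    hXB.measurable_bit x c k (measurableSet_singleton true)
  rw [h1, prob_compl_eq_one_sub hm, hXB.bit_law, ENNReal.ofReal_sub _ (hα c.1 c.2).1,
    ENNReal.ofReal_one]

/-- The probability that no cycle that is formed along the trajectory `y` is accepted: at most one
cycle is formed at each time. -/
lemma prob_bits_false (x : V) (y : ℕ → V) (k : ℕ) :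
    P {ω | ∀ j ≤ k, ∀ c : OrientedCycle G, FormedAt y j c.1 → B x c j ω = false} =
      ENNReal.ofReal (∏ i ∈ Finset.range k, if y (i + 1) ∈ loopErased y i then
        eraseProb G α (closedCycle (loopErased y i) (y (i + 1))) else 1) := by
  classical
  let _ : Fintype (OrientedCycle G) := Fintype.ofFinite _
  set S : Finset (V × OrientedCycle G × ℕ) :=
    ({x} : Finset V) ×ˢ (Finset.univ : Finset (OrientedCycle G)) ×ˢ Finset.range (k + 1) with hS
  have hset : {ω | ∀ j ≤ k, ∀ c : OrientedCycle G, FormedAt y j c.1 → B x c j ω = false} =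
      ⋂ s ∈ S, (fun ω => B s.1 s.2.1 s.2.2 ω) ⁻¹'
        (if FormedAt y s.2.2 s.2.1.1 then {false} else Set.univ) := by
    ext ω
    simp only [Set.mem_ofPred_eq, Set.mem_iInter, Set.mem_preimage, hS, Finset.mem_product,
      Finset.mem_singleton, Finset.mem_univ, true_and, Finset.mem_range, Nat.lt_succ_iff]
    constructor
    · rintro h ⟨x', c, j⟩ ⟨rfl, hj⟩
      simp only
      split_ifs with hf
      · exact h j hj c hf
      · trivial
    · intro h j hj c hf
      have := h (x, c, j) ⟨rfl, hj⟩
      simpa [hf] using this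
  rw [hset, hXB.bit_indep.measure_inter_preimage_eq_mul S fun s _ => MeasurableSet.of_discrete]
  have hterm : ∀ s ∈ S, P ((fun ω => B s.1 s.2.1 s.2.2 ω) ⁻¹'
        (if FormedAt y s.2.2 s.2.1.1 then {false} else Set.univ)) =
      ENNReal.ofReal (if FormedAt y s.2.2 s.2.1.1 then 1 - α s.2.1.1 else 1) := by
    intro s _
    split_ifs
    · exact prob_bit_false hα hXB s.1 s.2.1 s.2.2
    · rw [Set.preimage_univ, measure_univ, ENNReal.ofReal_one]
  have hnn : ∀ s ∈ S, 0 ≤ (if FormedAt y s.2.2 s.2.1.1 then 1 - α s.2.1.1 else 1) := by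
    intro s _
    split_ifs
    · linarith [(hα s.2.1.1 s.2.1.2).2]
    · exact zero_le_one
  rw [Finset.prod_congr rfl hterm, ← ENNReal.ofReal_prod_of_nonneg hnn]
  congr 1
  rw [hS, Finset.prod_product, Finset.prod_singleton, Finset.prod_product_right,
    Finset.prod_range_succ']
  simp only [not_formedAt_zero, if_false, Finset.prod_const_one, mul_one]
  refine Finset.prod_congr rfl fun i _ => ?_
  by_cases hy : y (i + 1) ∈ loopErased y i
  · rw [if_pos hy, eraseProb]
    split_ifs with ho
    · rw [Finset.prod_eq_single (⟨_, ho⟩ : OrientedCycle G)]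
      · rw [if_pos (formedAt_succ.2 ⟨hy, rfl⟩)]
      · intro c _ hc
        refine if_neg fun hf => hc (Subtype.ext (formedAt_succ.1 hf).2)
      · simp
    · refine Finset.prod_eq_one fun c _ => if_neg fun hf => ho ?_
      rw [← (formedAt_succ.1 hf).2]
      exact c.2
  · rw [if_neg hy]
    exact Finset.prod_eq_one fun c _ => if_neg fun hf => hy (formedAt_succ.1 hf).1

variable [MeasurableSingletonClass V]
include hstep

/-- The probability that the walk follows the trajectory `y` and that all the cycles formed are popped. -/
lemma prob_trajectory (x : V) (y : ℕ → V) (k : ℕ) :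
    P {ω | (∀ i ≤ k, X x i ω = y i) ∧
      ∀ j ≤ k, ∀ c : OrientedCycle G, FormedAt y j c.1 → B x c j ω = false} =
      ENNReal.ofReal ((if y 0 = x then 1 else 0) *
        trajectoryWeight (transition W) (eraseProb G α) y k) := by
  have h1 : MeasurableSet {f : V × ℕ → V | ∀ i ≤ k, f (x, i) = y i} := by
    simp only [Set.ofPred_forall]
    exact MeasurableSet.iInter fun i => MeasurableSet.iInter fun _ =>
      measurableSet_eq_fun (measurable_pi_apply _) measurable_const
  have h2 : MeasurableSet {f : V × OrientedCycle G × ℕ → Bool |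
      ∀ j ≤ k, ∀ c : OrientedCycle G, FormedAt y j c.1 → f (x, c, j) = false} := by
    simp only [Set.ofPred_forall]
    exact MeasurableSet.iInter fun j => MeasurableSet.iInter fun _ => MeasurableSet.iInter fun c =>
      MeasurableSet.iInter fun _ => measurableSet_eq_fun (measurable_pi_apply _) measurable_const
  have h3 := hXB.indep.measure_inter_preimage_eq_mul _ _ h1 h2
  refine Eq.trans h3 ?_
  have h4 := hXB.walk_law x k y
  have h5 := prob_bits_false hα hXB x y k
  simp only [Set.preimage_ofPred_eq] at h4 h5 ⊢
  rw [h4, h5, trajectoryWeight_eq, ← mul_assoc, ← ENNReal.ofReal_mul]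
  refine mul_nonneg ?_ (Finset.prod_nonneg fun i _ => hstep.nonneg _ _)
  split_ifs <;> simp

omit [IsProbabilityMeasure P] hα hstep in
lemma measure_eq_sum_trajectory (x : V) (k : ℕ) (E : Set Ω) :
    P E = ∑ s : Fin (k + 1) → V, P ((fun ω (i : Fin (k + 1)) => X x i ω) ⁻¹' {s} ∩ E) := by
  have hR : Measurable fun ω (i : Fin (k + 1)) => X x i ω :=
    measurable_pi_lambda _ fun i => hXB.measurable_walk x i
  have h := sum_measure_preimage_singleton (μ := P.restrict E) Finset.univ
    (f := fun ω (i : Fin (k + 1)) => X x i ω) fun s _ => hR (measurableSet_singleton s)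
  rw [Finset.coe_univ, Set.preimage_univ, Measure.restrict_apply_univ] at h
  rw [← h]
  exact Finset.sum_congr rfl fun s _ => Measure.restrict_apply (hR (measurableSet_singleton s))

/-- The Markov property of the loop-erased walk. -/
lemma prob_survives_step (A : Finset V) (x : V) (k : ℕ) (q : SAPath V) (z : V) :
    P {ω | (SurvivesTo (fun i => X x i ω) (fun c i => B x c i ω) A k ∧
        erasedPath (fun i => X x i ω) k = q) ∧
        X x (k + 1) ω = z ∧ ¬ StopsAt (fun i => X x i ω) (fun c i => B x c i ω) A (k + 1)} =
      P {ω | SurvivesTo (fun i => X x i ω) (fun c i => B x c i ω) A k ∧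
        erasedPath (fun i => X x i ω) k = q} *
      ENNReal.ofReal (if z ∈ Aᶜ then moveWeight (transition W) (eraseProb G α) q.1 z else 0) := by
  rw [measure_eq_sum_trajectory hXB x k, measure_eq_sum_trajectory hXB x k {ω | _ ∧ _},
    Finset.sum_mul]
  refine Finset.sum_congr rfl fun s _ => ?_
  set y : ℕ → V := fun i => if h : i < k + 1 then s ⟨i, h⟩ else z with hy
  have hyz : y (k + 1) = z := by simp [hy]
  have hmem : ∀ ω, ω ∈ (fun ω (i : Fin (k + 1)) => X x i ω) ⁻¹' {s} ↔ ∀ i ≤ k, X x i ω = y i := by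
    intro ω
    rw [Set.mem_preimage, Set.mem_singleton_iff, funext_iff]
    constructor
    · intro h i hi
      simpa [hy, hi] using h ⟨i, Nat.lt_succ_of_le hi⟩
    · intro h i
      have := h i (Nat.lt_succ_iff.1 i.2)
      simpa [hy, Nat.lt_succ_iff.1 i.2] using this
  have hpath : ∀ ω, (∀ i ≤ k, X x i ω = y i) →
      erasedPath (fun i => X x i ω) k = erasedPath y k := fun ω hω =>
    Subtype.ext (loopErased_congr hω)
  by_cases hcase : (∀ i ≤ k, y i ∉ A) ∧ erasedPath y k = q
  swap
  · have hempty : (fun ω (i : Fin (k + 1)) => X x i ω) ⁻¹' {s} ∩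
        {ω | SurvivesTo (fun i => X x i ω) (fun c i => B x c i ω) A k ∧
          erasedPath (fun i => X x i ω) k = q} = ∅ := by
      refine Set.eq_empty_iff_forall_notMem.2 ?_
      rintro ω ⟨h1, h2, h3⟩
      rw [hmem] at h1
      refine hcase ⟨fun i hi => ?_, (hpath ω h1).symm.trans h3⟩
      rw [← h1 i hi]
      exact (survivesTo_iff.1 h2).1 i hi
    have hempty' : (fun ω (i : Fin (k + 1)) => X x i ω) ⁻¹' {s} ∩
        {ω | (SurvivesTo (fun i => X x i ω) (fun c i => B x c i ω) A k ∧
          erasedPath (fun i => X x i ω) k = q) ∧ X x (k + 1) ω = z ∧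
          ¬ StopsAt (fun i => X x i ω) (fun c i => B x c i ω) A (k + 1)} = ∅ :=
      Set.subset_empty_iff.1 (hempty ▸ fun ω h => ⟨h.1, h.2.1⟩)
    rw [hempty, hempty', measure_empty, zero_mul]
  obtain ⟨hyA, hyq⟩ := hcase
  have hE : (fun ω (i : Fin (k + 1)) => X x i ω) ⁻¹' {s} ∩
        {ω | SurvivesTo (fun i => X x i ω) (fun c i => B x c i ω) A k ∧
          erasedPath (fun i => X x i ω) k = q} =
      {ω | (∀ i ≤ k, X x i ω = y i) ∧
        ∀ j ≤ k, ∀ c : OrientedCycle G, FormedAt y j c.1 → B x c j ω = false} := by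
    ext ω
    rw [Set.mem_inter_iff, hmem]
    refine and_congr_right fun h1 => ?_
    rw [Set.mem_ofPred_eq, survivesTo_iff]
    constructor
    · rintro ⟨⟨-, h2⟩, -⟩ j hj c hf
      exact h2 j hj c ((formedAt_congr (fun i hi => h1 i (hi.trans hj)) c.1).2 hf)
    · intro h2
      refine ⟨⟨fun j hj => ?_, fun j hj c hf => ?_⟩, (hpath ω h1).trans hyq⟩
      · rw [h1 j hj]
        exact hyA j hj
      · exact h2 j hj c ((formedAt_congr (fun i hi => h1 i (hi.trans hj)) c.1).1 hf)
  by_cases hz : z ∈ A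
  · have hempty : (fun ω (i : Fin (k + 1)) => X x i ω) ⁻¹' {s} ∩
        {ω | (SurvivesTo (fun i => X x i ω) (fun c i => B x c i ω) A k ∧
          erasedPath (fun i => X x i ω) k = q) ∧ X x (k + 1) ω = z ∧
          ¬ StopsAt (fun i => X x i ω) (fun c i => B x c i ω) A (k + 1)} = ∅ := by
      refine Set.eq_empty_iff_forall_notMem.2 ?_
      rintro ω ⟨-, -, h1, h2⟩
      refine h2 (Or.inl ?_)
      simpa [h1] using hz
    rw [hempty, measure_empty, if_neg (by simpa using hz), ENNReal.ofReal_zero, mul_zero]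
  have hEF : (fun ω (i : Fin (k + 1)) => X x i ω) ⁻¹' {s} ∩
        {ω | (SurvivesTo (fun i => X x i ω) (fun c i => B x c i ω) A k ∧
          erasedPath (fun i => X x i ω) k = q) ∧ X x (k + 1) ω = z ∧
          ¬ StopsAt (fun i => X x i ω) (fun c i => B x c i ω) A (k + 1)} =
      {ω | (∀ i ≤ k + 1, X x i ω = y i) ∧
        ∀ j ≤ k + 1, ∀ c : OrientedCycle G, FormedAt y j c.1 → B x c j ω = false} := by
    ext ω
    rw [Set.mem_inter_iff, hmem, Set.mem_ofPred_eq, Set.mem_ofPred_eq]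
    constructor
    · rintro ⟨h1, ⟨h2, h3⟩, h4, h5⟩
      have h6 : ∀ i ≤ k + 1, X x i ω = y i := by
        intro i hi
        rcases Nat.lt_or_ge i (k + 1) with h | h
        · exact h1 i (by omega)
        · obtain rfl : i = k + 1 := by omega
          rw [h4, hyz]
      refine ⟨h6, fun j hj c hf => ?_⟩
      exact (survivesTo_iff.1 (survivesTo_succ.2 ⟨h2, h5⟩)).2 j hj c
        ((formedAt_congr (fun i hi => h6 i (hi.trans hj)) c.1).2 hf)
    · rintro ⟨h6, h7⟩
      have h8 : SurvivesTo (fun i => X x i ω) (fun c i => B x c i ω) A (k + 1) := by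
        refine survivesTo_iff.2 ⟨fun j hj => ?_, fun j hj c hf => ?_⟩
        · rw [h6 j hj]
          rcases Nat.lt_or_ge j (k + 1) with h | h
          · exact hyA j (by omega)
          · obtain rfl : j = k + 1 := by omega
            rwa [hyz]
        · exact h7 j hj c ((formedAt_congr (fun i hi => h6 i (hi.trans hj)) c.1).1 hf)
      have h1 : ∀ i ≤ k, X x i ω = y i := fun i hi => h6 i (by omega)
      exact ⟨h1, ⟨(survivesTo_succ.1 h8).1, (hpath ω h1).trans hyq⟩,
        (h6 _ le_rfl).trans hyz, (survivesTo_succ.1 h8).2⟩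
  rw [hE, hEF, prob_trajectory hstep hα hXB, prob_trajectory hstep hα hXB,
    if_pos (show z ∈ Aᶜ by simpa using hz), ← ENNReal.ofReal_mul, mul_assoc]
  · rw [trajectoryWeight, Finset.prod_range_succ, ← trajectoryWeight, hyz]
    have : loopErased y k = q.1 := congrArg Subtype.val hyq
    rw [this]
  · refine mul_nonneg (by split_ifs <;> simp) (Finset.prod_nonneg fun i _ => ?_)
    exact moveWeight_nonneg hstep _ _

lemma prob_survives_step' (A : Finset V) (x : V) (k : ℕ) (q : SAPath V) (E : Set V) :
    P {ω | (SurvivesTo (fun i => X x i ω) (fun c i => B x c i ω) A k ∧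
        erasedPath (fun i => X x i ω) k = q) ∧
        X x (k + 1) ω ∈ E ∧ ¬ StopsAt (fun i => X x i ω) (fun c i => B x c i ω) A (k + 1)} =
      P {ω | SurvivesTo (fun i => X x i ω) (fun c i => B x c i ω) A k ∧
        erasedPath (fun i => X x i ω) k = q} *
      ENNReal.ofReal (∑ z ∈ Aᶜ, E.indicator (moveWeight (transition W) (eraseProb G α) q.1) z) := by
  classical
  have h := sum_measure_preimage_singleton (μ := P.restrict
    {ω | (SurvivesTo (fun i => X x i ω) (fun c i => B x c i ω) A k ∧
        erasedPath (fun i => X x i ω) k = q) ∧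
        ¬ StopsAt (fun i => X x i ω) (fun c i => B x c i ω) A (k + 1)})
    (Finset.univ.filter (· ∈ E)) (f := X x (k + 1))
    fun z _ => hXB.measurable_walk x _ (measurableSet_singleton z)
  rw [Measure.restrict_apply (hXB.measurable_walk x _ (Set.toFinite _).measurableSet)] at h
  have hset : X x (k + 1) ⁻¹' ((Finset.univ.filter (· ∈ E) : Finset V) : Set V) ∩
      {ω | (SurvivesTo (fun i => X x i ω) (fun c i => B x c i ω) A k ∧
        erasedPath (fun i => X x i ω) k = q) ∧
        ¬ StopsAt (fun i => X x i ω) (fun c i => B x c i ω) A (k + 1)} =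
      {ω | (SurvivesTo (fun i => X x i ω) (fun c i => B x c i ω) A k ∧
        erasedPath (fun i => X x i ω) k = q) ∧
        X x (k + 1) ω ∈ E ∧ ¬ StopsAt (fun i => X x i ω) (fun c i => B x c i ω) A (k + 1)} := by
    ext ω
    simp only [Set.mem_inter_iff, Set.mem_preimage, Set.mem_ofPred_eq, Finset.coe_filter,
      Finset.mem_univ, true_and]
    tauto
  rw [hset] at h
  rw [← h]
  have hz : ∀ z, P.restrict {ω | (SurvivesTo (fun i => X x i ω) (fun c i => B x c i ω) A k ∧
        erasedPath (fun i => X x i ω) k = q) ∧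
        ¬ StopsAt (fun i => X x i ω) (fun c i => B x c i ω) A (k + 1)} (X x (k + 1) ⁻¹' {z}) =
      P {ω | SurvivesTo (fun i => X x i ω) (fun c i => B x c i ω) A k ∧
        erasedPath (fun i => X x i ω) k = q} *
      ENNReal.ofReal (if z ∈ Aᶜ then moveWeight (transition W) (eraseProb G α) q.1 z else 0) := by
    intro z
    rw [← prob_survives_step hstep hα hXB, Measure.restrict_apply
      (hXB.measurable_walk x _ (measurableSet_singleton z))]
    congr 1
    ext ω
    simp only [Set.mem_inter_iff, Set.mem_preimage, Set.mem_ofPred_eq, Set.mem_singleton_iff]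
    tauto
  rw [Finset.sum_congr rfl fun z _ => hz z, ← Finset.mul_sum, ← ENNReal.ofReal_sum_of_nonneg]
  · congr 2
    rw [← Finset.sum_filter, Finset.filter_filter]
    simp only [Set.indicator_apply]
    rw [← Finset.sum_filter]
    refine Finset.sum_congr ?_ fun _ _ => rfl
    ext z
    simp only [Finset.mem_filter, Finset.mem_univ, true_and]
    tauto
  · intro z _
    split_ifs
    · exact moveWeight_nonneg hstep _ _
    · exact le_rfl

/-- The law of the loop-erased walk that is not stopped. -/
lemma prob_survives (A : Finset V) {x : V} (hx : x ∉ A) (k : ℕ) (q : SAPath V) :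
    P {ω | SurvivesTo (fun i => X x i ω) (fun c i => B x c i ω) A k ∧
        erasedPath (fun i => X x i ω) k = q} =
      ENNReal.ofReal
        ((pathKernel (transition W) (eraseProb G α) Aᶜ ^ k) (singlePath x) q) := by
  have hstart : P {ω | X x 0 ω = x} = 1 := by
    have := hXB.walk_law x 0 fun _ => x
    simpa using this
  induction k generalizing q with
  | zero =>
    rw [pow_zero, Matrix.one_apply]
    have hae : ∀ᵐ ω ∂P, X x 0 ω = x :=
      (prob_compl_eq_zero_iff (hXB.measurable_walk x 0 (measurableSet_singleton x))).2 hstart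
    have hsurv : ∀ ω, X x 0 ω = x →
        SurvivesTo (fun i => X x i ω) (fun c i => B x c i ω) A 0 ∧
        erasedPath (fun i => X x i ω) 0 = singlePath x := by
      intro ω hω
      refine ⟨survivesTo_iff.2 ⟨fun j hj => ?_, fun j hj c hf => ?_⟩, ?_⟩
      · obtain rfl : j = 0 := by omega
        rwa [hω]
      · obtain rfl : j = 0 := by omega
        exact absurd hf (not_formedAt_zero _ _)
      · exact Subtype.ext (by simp [erasedPath, loopErased, singlePath, hω])
    split_ifs with hq
    · subst hq
      rw [ENNReal.ofReal_one, ← measure_univ (μ := P)]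
      refine measure_congr ?_
      filter_upwards [hae] with ω hω
      exact propext ⟨fun _ => trivial, fun _ => hsurv ω hω⟩
    · rw [ENNReal.ofReal_zero, ← measure_empty (μ := P)]
      refine measure_congr ?_
      filter_upwards [hae] with ω hω
      refine propext ⟨fun h => hq ?_, fun h => h.elim⟩
      exact (hsurv ω hω).2.symm.trans h.2
  | succ k ih =>
    have h := sum_measure_preimage_singleton (μ := P.restrict
      {ω | SurvivesTo (fun i => X x i ω) (fun c i => B x c i ω) A (k + 1) ∧
        erasedPath (fun i => X x i ω) (k + 1) = q}) Finset.univ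
      (f := fun ω => erasedPath (fun i => X x i ω) k) fun s _ =>
        measurable_pi_lambda _ (hXB.measurable_walk x) (measurableSet_erasedPath k s)
    rw [Finset.coe_univ, Set.preimage_univ, Measure.restrict_apply_univ] at h
    rw [← h, pow_succ, Matrix.mul_apply, ENNReal.ofReal_sum_of_nonneg]
    swap
    · exact fun s _ => mul_nonneg (pathKernel_pow_nonneg hstep _ _ _ _)
        (pathKernel_nonneg hstep _ _ _)
    refine Finset.sum_congr rfl fun s _ => ?_
    have hms : MeasurableSet ((fun ω => erasedPath (fun i => X x i ω) k) ⁻¹' {s}) :=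
      measurable_pi_lambda _ (hXB.measurable_walk x) (measurableSet_erasedPath k s)
    rw [Measure.restrict_apply hms, ENNReal.ofReal_mul (pathKernel_pow_nonneg hstep _ _ _ _), ← ih s]
    have hstep' := prob_survives_step' hstep hα hXB A x k s {z | nextPath s z = q}
    simp only [Set.indicator_apply, Set.mem_ofPred_eq] at hstep'
    rw [pathKernel, ← hstep']
    congr 1
    ext ω
    simp only [Set.mem_inter_iff, Set.mem_preimage, Set.mem_ofPred_eq, Set.mem_singleton_iff,
      survivesTo_succ, erasedPath_succ]
    constructor
    · rintro ⟨rfl, ⟨h1, h2⟩, h3⟩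
      exact ⟨⟨h1, rfl⟩, h3, h2⟩
    · rintro ⟨⟨h1, rfl⟩, h3, h2⟩
      exact ⟨rfl, ⟨h1, h2⟩, h3⟩

/-- The law of the time at which the walk is stopped and of its loop-erased path just before. -/
lemma prob_stops (A : Finset V) {x : V} (hx : x ∉ A) (k : ℕ) (q : SAPath V) :
    P {ω | (SurvivesTo (fun i => X x i ω) (fun c i => B x c i ω) A k ∧
        erasedPath (fun i => X x i ω) k = q) ∧
        StopsAt (fun i => X x i ω) (fun c i => B x c i ω) A (k + 1)} =
      ENNReal.ofReal ((pathKernel (transition W) (eraseProb G α) Aᶜ ^ k) (singlePath x) q *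
        killProb (transition W) (eraseProb G α) Aᶜ q) := by
  have hd : Measurable fun ω => ((fun i => X x i ω), fun c i => B x c i ω) :=
    (measurable_pi_lambda _ (hXB.measurable_walk x)).prodMk
      (measurable_pi_lambda _ fun c => measurable_pi_lambda _ (hXB.measurable_bit x c))
  have hm := hd (measurableSet_stopsAt (G := G) A (k + 1))
  have h1 := measure_inter_add_sdiff (μ := P)
    {ω | SurvivesTo (fun i => X x i ω) (fun c i => B x c i ω) A k ∧
        erasedPath (fun i => X x i ω) k = q} hm
  have h2 := prob_survives_step' hstep hα hXB A x k q Set.univ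
  have h3 : {ω | (SurvivesTo (fun i => X x i ω) (fun c i => B x c i ω) A k ∧
        erasedPath (fun i => X x i ω) k = q) ∧ X x (k + 1) ω ∈ Set.univ ∧
        ¬ StopsAt (fun i => X x i ω) (fun c i => B x c i ω) A (k + 1)} =
      {ω | SurvivesTo (fun i => X x i ω) (fun c i => B x c i ω) A k ∧
        erasedPath (fun i => X x i ω) k = q} \
      (fun ω => ((fun i => X x i ω), fun c i => B x c i ω)) ⁻¹'
        {d | StopsAt d.1 d.2 A (k + 1)} := by
    ext ω
    simp only [Set.mem_ofPred_eq, Set.mem_univ, true_and]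
    rfl
  rw [← h3, h2, prob_survives hstep hα hXB A hx] at h1
  simp only [Set.indicator_univ] at h1
  have h4 : ∑ z ∈ Aᶜ, moveWeight (transition W) (eraseProb G α) q.1 z =
      1 - killProb (transition W) (eraseProb G α) Aᶜ q := by
    rw [killProb]
    ring
  have h5 := pathKernel_pow_nonneg hstep Aᶜ k (singlePath x) q
  have h6 : 0 ≤ 1 - killProb (transition W) (eraseProb G α) Aᶜ q := by
    rw [← h4]
    exact Finset.sum_nonneg fun z _ => moveWeight_nonneg hstep _ _
  rw [h4, ← ENNReal.ofReal_mul h5] at h1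
  have h7 := ENNReal.eq_sub_of_add_eq ENNReal.ofReal_ne_top h1
  rw [← ENNReal.ofReal_sub _ (mul_nonneg h5 h6)] at h7
  refine Eq.trans h7 ?_
  congr 1
  ring

end TrajectoryLaw

/-! ### The number of steps from a visited set -/

section Steps

variable {V : Type*} [DecidableEq V] {G : SimpleGraph V}

lemma stopTime_eq_top {X : ℕ → V} {b : OrientedCycle G → ℕ → Bool} {A : Finset V}
    (h : ∀ k, ¬ StopsAt X b A k) : stopTime X b A = ⊤ := by
  have : {k : ℕ∞ | ∃ j : ℕ, k = j ∧ StopsAt X b A j} = ∅ := by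
    refine Set.eq_empty_iff_forall_notMem.2 ?_
    rintro k ⟨j, -, hj⟩
    exact h j hj
  rw [stopTime, this, sInf_empty]

lemma stopTime_eq_coe {X : ℕ → V} {b : OrientedCycle G → ℕ → Bool} {A : Finset V} {k : ℕ}
    (h : StopsAt X b A k) (h' : ∀ j < k, ¬ StopsAt X b A j) : stopTime X b A = k := by
  refine IsLeast.csInf_eq ⟨⟨k, rfl, h⟩, ?_⟩
  rintro _ ⟨j, rfl, hj⟩
  by_contra hlt
  exact h' j (by exact_mod_cast not_le.1 hlt) hj

lemma stopTime_eq_coe_iff {X : ℕ → V} {b : OrientedCycle G → ℕ → Bool} {A : Finset V} {k : ℕ} :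
    stopTime X b A = k ↔ StopsAt X b A k ∧ ∀ j < k, ¬ StopsAt X b A j := by
  classical
  refine ⟨fun h => ?_, fun h => stopTime_eq_coe h.1 h.2⟩
  by_cases hex : ∃ j, StopsAt X b A j
  · have h2 : ∀ j < Nat.find hex, ¬ StopsAt X b A j := fun j hj => Nat.find_min hex hj
    have h1 := stopTime_eq_coe (Nat.find_spec hex) h2
    obtain rfl : k = Nat.find hex := by
      rw [h] at h1
      exact_mod_cast h1
    exact ⟨Nat.find_spec hex, h2⟩
  · rw [stopTime_eq_top (not_exists.1 hex)] at h
    exact absurd h (by simp)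

lemma stopTime_eq_top_iff {X : ℕ → V} {b : OrientedCycle G → ℕ → Bool} {A : Finset V} :
    stopTime X b A = ⊤ ↔ ∀ k, ¬ StopsAt X b A k := by
  classical
  refine ⟨fun h k hk => ?_, stopTime_eq_top⟩
  have hex : ∃ j, StopsAt X b A j := ⟨k, hk⟩
  rw [stopTime_eq_coe (Nat.find_spec hex) fun j hj => Nat.find_min hex hj] at h
  exact absurd h (by simp)

/-- The vertices added by an iteration that stops at time `k + 1` are those of the loop-erased path at
time `k`, up to vertices that are already visited. -/
lemma union_newVertices {X : ℕ → V} {b : OrientedCycle G → ℕ → Bool} {S : Finset V} {k : ℕ}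
    (h : StopsAt X b S (k + 1)) :
    S ∪ newVertices X (k + 1) = S ∪ (loopErased X k).toFinset := by
  have : X (k + 1) ∈ S ∪ (loopErased X k).toFinset := by
    rcases h with h | ⟨c, hf, -⟩
    · exact Finset.mem_union_left _ h
    · exact Finset.mem_union_right _ (List.mem_toFinset.2 (formedAt_succ.1 hf).1)
  rw [newVertices, Nat.add_sub_cancel, Finset.union_insert, Finset.insert_eq_of_mem this]

variable [Fintype V] (ι : Fin (Fintype.card V) ≃ V)

lemma nextStart_univ : nextStart ι Finset.univ = none := by
  simp [nextStart]

lemma exists_nextStart {S : Finset V} (h : S ≠ Finset.univ) : ∃ x ∉ S, nextStart ι S = some x := by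
  cases hs : nextStart ι S with
  | none =>
    refine absurd (Finset.eq_univ_iff_forall.2 fun v => ?_) h
    rw [nextStart, List.find?_eq_none] at hs
    simpa using hs v (List.mem_map.2 ⟨ι.symm v, List.mem_finRange _, ι.apply_symm_apply v⟩)
  | some x =>
    refine ⟨x, ?_, rfl⟩
    have := List.find?_some hs
    simpa using this

/-- The trajectories and the acceptance bits of all the walks. -/
abbrev InputData (G : SimpleGraph V) : Type _ := V → (ℕ → V) × (OrientedCycle G → ℕ → Bool)

/-- The number of steps in `m` iterations of the algorithm, started from the visited set `S`. -/
def stepsFrom (d : InputData G) : ℕ → Finset V → ℕ∞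
  | 0, _ => 0
  | m + 1, S => iterSteps ι (fun x => (d x).1) (fun x => (d x).2) S +
      stepsFrom d m (iterVertices ι (fun x => (d x).1) (fun x => (d x).2) S)

lemma sum_iterSteps_eq (d : InputData G) (m : ℕ) (S : Finset V) :
    ∑ l ∈ Finset.range m, iterSteps ι (fun x => (d x).1) (fun x => (d x).2)
      ((iterVertices ι (fun x => (d x).1) (fun x => (d x).2))^[l] S) = stepsFrom ι d m S := by
  induction m generalizing S with
  | zero => simp [stepsFrom]
  | succ m ih =>
    rw [Finset.sum_range_succ', stepsFrom, ← ih, add_comm]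
    rfl

lemma totalSteps_eq (d : InputData G) :
    totalSteps ι (fun x => (d x).1) (fun x => (d x).2) = stepsFrom ι d (Fintype.card V) ∅ := by
  rw [← sum_iterSteps_eq, totalSteps]
  have h : ∀ l, vertexSet ι (fun x => (d x).1) (fun x => (d x).2) l =
      (iterVertices ι (fun x => (d x).1) (fun x => (d x).2))^[l] ∅ := by
    intro l
    induction l with
    | zero => rfl
    | succ l ih => rw [Function.iterate_succ_apply', vertexSet, ih]
  exact Finset.sum_congr rfl fun l _ => by rw [h]

lemma stepsFrom_univ (d : InputData G) (m : ℕ) : stepsFrom ι d m Finset.univ = 0 := by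
  induction m with
  | zero => rfl
  | succ m ih => simp [stepsFrom, iterSteps, iterVertices, nextStart_univ, ih]

lemma stepsFrom_succ {S : Finset V} {x : V} (hx : nextStart ι S = some x) (d : InputData G) (m : ℕ) :
    stepsFrom ι d (m + 1) S = stopTime (d x).1 (d x).2 S +
      stepsFrom ι d m (if stopTime (d x).1 (d x).2 S = ⊤ then S
        else S ∪ newVertices (d x).1 (stopTime (d x).1 (d x).2 S).toNat) := by
  simp [stepsFrom, iterSteps, iterVertices, hx]

/-- The iterations from the visited set `S` use the walks that start outside `S` only. -/
lemma stepsFrom_congr {d d' : InputData G} (m : ℕ) {S : Finset V} (h : ∀ y ∉ S, d y = d' y) :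
    stepsFrom ι d m S = stepsFrom ι d' m S := by
  induction m generalizing S with
  | zero => rfl
  | succ m ih =>
    by_cases hS : S = Finset.univ
    · rw [hS, stepsFrom_univ, stepsFrom_univ]
    · obtain ⟨x, hxS, hx⟩ := exists_nextStart ι hS
      rw [stepsFrom_succ ι hx, stepsFrom_succ ι hx, h x hxS]
      congr 1
      refine ih fun y hy => h y fun hyS => hy ?_
      split_ifs
      · exact hyS
      · exact Finset.mem_union_left _ hyS

end Steps

section StepsMeasurable

variable {V : Type*} [Fintype V] [DecidableEq V] [MeasurableSpace V] [MeasurableSingletonClass V]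
  {G : SimpleGraph V}

lemma measurable_stopTime (A : Finset V) :
    Measurable fun d : (ℕ → V) × (OrientedCycle G → ℕ → Bool) => stopTime d.1 d.2 A := by
  refine measurable_to_countable' fun a => ?_
  cases a with
  | top =>
    have : (fun d : (ℕ → V) × (OrientedCycle G → ℕ → Bool) => stopTime d.1 d.2 A) ⁻¹' {⊤} =
        ⋂ k, {d | StopsAt d.1 d.2 A k}ᶜ := by
      ext d
      simp [stopTime_eq_top_iff]
    rw [this]
    exact MeasurableSet.iInter fun k => (measurableSet_stopsAt A k).compl
  | coe k =>
    have : (fun d : (ℕ → V) × (OrientedCycle G → ℕ → Bool) => stopTime d.1 d.2 A) ⁻¹' {(k : ℕ∞)} =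
        {d | StopsAt d.1 d.2 A k} ∩ ⋂ j, ⋂ (_ : j < k), {d | StopsAt d.1 d.2 A j}ᶜ := by
      ext d
      simp [stopTime_eq_coe_iff]
    rw [this]
    exact (measurableSet_stopsAt A k).inter (MeasurableSet.iInter fun j =>
      MeasurableSet.iInter fun _ => (measurableSet_stopsAt A j).compl)

lemma measurableSet_newVertices (A S : Finset V) (k : ℕ) :
    MeasurableSet {X : ℕ → V | A ∪ newVertices X k = S} := by
  have : {X : ℕ → V | A ∪ newVertices X k = S} = ⋃ q : SAPath V,
      {X : ℕ → V | erasedPath X (k - 1) = q} ∩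
        (fun X : ℕ → V => X k) ⁻¹' {v | A ∪ insert v q.1.toFinset = S} := by
    ext X
    simp [newVertices, erasedPath]
  rw [this]
  exact MeasurableSet.iUnion fun q => (measurableSet_erasedPath _ q).inter
    (measurable_pi_apply k (Set.toFinite _).measurableSet)

lemma measurable_stepsFrom (ι : Fin (Fintype.card V) ≃ V) (m : ℕ) (S : Finset V) :
    Measurable fun d : InputData G => stepsFrom ι d m S := by
  induction m generalizing S with
  | zero => exact measurable_const
  | succ m ih =>
    by_cases hS : S = Finset.univ
    · simp only [hS, stepsFrom_univ]
      exact measurable_const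
    obtain ⟨x, -, hx⟩ := exists_nextStart ι hS
    have h_end : Measurable fun d : InputData G => stopTime (d x).1 (d x).2 S :=
      (measurable_stopTime S).comp (measurable_pi_apply x)
    refine measurable_to_countable' fun a => ?_
    have : (fun d : InputData G => stepsFrom ι d (m + 1) S) ⁻¹' {a} =
        ({d | stopTime (d x).1 (d x).2 S = ⊤} ∩ {d | ⊤ + stepsFrom ι d m S = a}) ∪
        ⋃ k : ℕ, ⋃ S' : Finset V, {d | stopTime (d x).1 (d x).2 S = (k : ℕ∞)} ∩
          ((fun d : InputData G => (d x).1) ⁻¹' {Y | S ∪ newVertices Y k = S'} ∩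
            {d | (k : ℕ∞) + stepsFrom ι d m S' = a}) := by
      ext d
      rw [Set.mem_preimage, Set.mem_singleton_iff, stepsFrom_succ ι hx]
      cases hk : stopTime (d x).1 (d x).2 S with
      | top => simp [hk]
      | coe k => simp [hk]
    rw [this]
    refine MeasurableSet.union (MeasurableSet.inter ?_ ?_) (MeasurableSet.iUnion fun k =>
      MeasurableSet.iUnion fun S' => MeasurableSet.inter ?_ (MeasurableSet.inter ?_ ?_))
    · exact h_end (measurableSet_singleton _)
    · exact measurableSet_eq_fun (measurable_const.add (ih S)) measurable_const
    · exact h_end (measurableSet_singleton _)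
    · exact (measurable_fst.comp (measurable_pi_apply x)) (measurableSet_newVertices S S' k)
    · exact measurableSet_eq_fun (measurable_const.add (ih S')) measurable_const

end StepsMeasurable

/-! ### Independence of the walks of different vertices -/

section Independence

lemma comap_prod_eq_generateFrom {Ω β γ : Type*} [MeasurableSpace β] [MeasurableSpace γ]
    (f : Ω → β × γ) : MeasurableSpace.comap f inferInstance = MeasurableSpace.generateFrom
      (Set.preimage f '' (Set.image2 (· ×ˢ ·) {s : Set β | MeasurableSet s}
        {t : Set γ | MeasurableSet t})) := by
  rw [← generateFrom_prod, MeasurableSpace.comap_generateFrom]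

/-- If `X₁, X₂` are independent, `B₁, B₂` are independent, and the `X`'s are independent of the `B`'s,
then the pairs `(X₁, B₁)` and `(X₂, B₂)` are independent. -/
lemma indepFun_prodMk_prodMk {Ω β₁ β₂ γ₁ γ₂ : Type*} [MeasurableSpace Ω] [MeasurableSpace β₁]
    [MeasurableSpace β₂] [MeasurableSpace γ₁] [MeasurableSpace γ₂] {P : Measure Ω}
    [IsProbabilityMeasure P] {X₁ : Ω → β₁} {X₂ : Ω → β₂} {B₁ : Ω → γ₁} {B₂ : Ω → γ₂}
    (hX₁ : Measurable X₁) (hX₂ : Measurable X₂) (hB₁ : Measurable B₁) (hB₂ : Measurable B₂)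
    (hX : IndepFun X₁ X₂ P) (hB : IndepFun B₁ B₂ P)
    (h : IndepFun (fun ω => (X₁ ω, X₂ ω)) (fun ω => (B₁ ω, B₂ ω)) P) :
    IndepFun (fun ω => (X₁ ω, B₁ ω)) (fun ω => (X₂ ω, B₂ ω)) P := by
  have hXB : ∀ s₁ s₂ t₁ t₂, MeasurableSet s₁ → MeasurableSet s₂ → MeasurableSet t₁ →
      MeasurableSet t₂ → P ((X₁ ⁻¹' s₁ ∩ X₂ ⁻¹' s₂) ∩ (B₁ ⁻¹' t₁ ∩ B₂ ⁻¹' t₂)) =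
        (P (X₁ ⁻¹' s₁) * P (X₂ ⁻¹' s₂)) * (P (B₁ ⁻¹' t₁) * P (B₂ ⁻¹' t₂)) := by
    intro s₁ s₂ t₁ t₂ hs₁ hs₂ ht₁ ht₂
    rw [← hX.measure_inter_preimage_eq_mul _ _ hs₁ hs₂,
      ← hB.measure_inter_preimage_eq_mul _ _ ht₁ ht₂]
    exact h.measure_inter_preimage_eq_mul _ _ (hs₁.prod hs₂) (ht₁.prod ht₂)
  refine IndepSets.indep ?_ ?_ ?_ ?_ (comap_prod_eq_generateFrom _) (comap_prod_eq_generateFrom _) ?_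
  · exact measurable_iff_comap_le.1 (hX₁.prodMk hB₁)
  · exact measurable_iff_comap_le.1 (hX₂.prodMk hB₂)
  · exact isPiSystem_prod.comap _
  · exact isPiSystem_prod.comap _
  rw [IndepSets_iff]
  rintro _ _ ⟨_, ⟨s₁, hs₁, t₁, ht₁, rfl⟩, rfl⟩ ⟨_, ⟨s₂, hs₂, t₂, ht₂, rfl⟩, rfl⟩
  have h1 := hXB s₁ Set.univ t₁ Set.univ hs₁ .univ ht₁ .univ
  have h2 := hXB Set.univ s₂ Set.univ t₂ .univ hs₂ .univ ht₂
  have h3 := hXB s₁ s₂ t₁ t₂ hs₁ hs₂ ht₁ ht₂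
  simp only [Set.preimage_univ, Set.inter_univ, Set.univ_inter, measure_univ, one_mul,
    mul_one] at h1 h2
  have e3 : (fun ω => (X₁ ω, B₁ ω)) ⁻¹' (s₁ ×ˢ t₁) ∩ (fun ω => (X₂ ω, B₂ ω)) ⁻¹' (s₂ ×ˢ t₂) =
      (X₁ ⁻¹' s₁ ∩ X₂ ⁻¹' s₂) ∩ (B₁ ⁻¹' t₁ ∩ B₂ ⁻¹' t₂) := by
    ext ω
    simp only [Set.mem_inter_iff, Set.mem_preimage, Set.mem_prod]
    tauto
  rw [e3, h3, Set.mk_preimage_prod, Set.mk_preimage_prod, h1, h2]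
  ring

variable {V : Type*} [Fintype V] [DecidableEq V] [MeasurableSpace V]
  {Ω : Type*} [MeasurableSpace Ω] {G : SimpleGraph V} {W : Matrix V V ℝ} {α : Cycle V → ℝ}
  {P : Measure Ω} [IsProbabilityMeasure P] {X : V → ℕ → Ω → V}
  {B : V → OrientedCycle G → ℕ → Ω → Bool}

/-- The walk and the acceptance bits of a vertex are independent of those of the other vertices. -/
lemma IsRandomInput.indepFun_compl (hXB : IsRandomInput W α P X B) (x : V) :
    IndepFun (fun ω => ((fun k => X x k ω), fun c k => B x c k ω))
      (fun ω (y : {y // y ≠ x}) => ((fun k => X y k ω), fun c k => B y c k ω)) P := by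
  have hX : IndepFun (fun ω k => X x k ω) (fun ω (y : {y // y ≠ x}) k => X y.1 k ω) P := by
    have h := hXB.walk_indep.indepFun_finset {x} {x}ᶜ disjoint_compl_right
      fun y => measurable_pi_lambda _ (hXB.measurable_walk y)
    refine h.comp (φ := fun f => f ⟨x, Finset.mem_singleton_self x⟩)
      (ψ := fun f (y : {y // y ≠ x}) => f ⟨y.1, by simpa using y.2⟩) ?_ ?_
    · exact measurable_pi_apply _
    · exact measurable_pi_lambda _ fun y => measurable_pi_apply _
  have hB : IndepFun (fun ω (s : OrientedCycle G × ℕ) => B x s.1 s.2 ω)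
      (fun ω (s : {y // y ≠ x} × OrientedCycle G × ℕ) => B s.1 s.2.1 s.2.2 ω) P := by
    refine IndepFun.process_indepFun_process
      (X := fun (s : OrientedCycle G × ℕ) ω => B x s.1 s.2 ω)
      (Y := fun (s : {y // y ≠ x} × OrientedCycle G × ℕ) ω => B s.1 s.2.1 s.2.2 ω)
      (fun s => hXB.measurable_bit _ _ _) (fun s => hXB.measurable_bit _ _ _) fun I J => ?_
    classical
    set I' : Finset (V × OrientedCycle G × ℕ) := I.image fun s => (x, s) with hI'
    set J' : Finset (V × OrientedCycle G × ℕ) := J.image fun s => (s.1.1, s.2) with hJ'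
    have hdisj : Disjoint I' J' := by
      rw [Finset.disjoint_left]
      intro s hs hs'
      obtain ⟨a, -, rfl⟩ := Finset.mem_image.1 hs
      obtain ⟨b, -, hb⟩ := Finset.mem_image.1 hs'
      exact b.1.2 (congrArg Prod.fst hb)
    have h := hXB.bit_indep.indepFun_finset I' J' hdisj fun s => hXB.measurable_bit _ _ _
    exact h.comp (φ := fun f (s : I) => f ⟨(x, s.1), Finset.mem_image_of_mem _ s.2⟩)
      (ψ := fun f (s : J) => f ⟨(s.1.1.1, s.1.2), Finset.mem_image_of_mem
        (fun s : {y // y ≠ x} × OrientedCycle G × ℕ => (s.1.1, s.2)) s.2⟩)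
      (measurable_pi_lambda _ fun s => measurable_pi_apply _)
      (measurable_pi_lambda _ fun s => measurable_pi_apply _)
  have hXB' : IndepFun (fun ω => ((fun k => X x k ω), fun (y : {y // y ≠ x}) k => X y.1 k ω))
      (fun ω => ((fun s : OrientedCycle G × ℕ => B x s.1 s.2 ω),
        fun s : {y // y ≠ x} × OrientedCycle G × ℕ => B s.1 s.2.1 s.2.2 ω)) P := by
    refine hXB.indep.comp
      (φ := fun f => ((fun k => f (x, k)), fun (y : {y // y ≠ x}) k => f (y.1, k)))
      (ψ := fun f => ((fun s : OrientedCycle G × ℕ => f (x, s)),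
        fun s : {y // y ≠ x} × OrientedCycle G × ℕ => f (s.1.1, s.2))) ?_ ?_ <;> fun_prop
  have h := indepFun_prodMk_prodMk
    (measurable_pi_lambda _ fun k => hXB.measurable_walk x k)
    (measurable_pi_lambda _ fun y : {y // y ≠ x} =>
      measurable_pi_lambda _ fun k => hXB.measurable_walk y.1 k)
    (measurable_pi_lambda _ fun s : OrientedCycle G × ℕ => hXB.measurable_bit x s.1 s.2)
    (measurable_pi_lambda _ fun s : {y // y ≠ x} × OrientedCycle G × ℕ =>
      hXB.measurable_bit s.1.1 s.2.1 s.2.2) hX hB hXB'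
  refine h.comp (φ := fun f => (f.1, fun c k => f.2 (c, k)))
    (ψ := fun f (y : {y // y ≠ x}) => (f.1 y, fun c k => f.2 (y, c, k))) ?_ ?_ <;> fun_prop

end Independence

/-! ### The generating function of the number of steps -/

section GeneratingFunction

/-- The random variable `t ^ T`, which is `0` where `T` is infinite. -/
def stepGen (t : ℝ) (T : ℕ∞) : ℝ≥0∞ := if T = ⊤ then 0 else ENNReal.ofReal (t ^ T.toNat)

lemma stepGen_coe_add {t : ℝ} (ht : 0 ≤ t) (k : ℕ) (T : ℕ∞) :
    stepGen t (k + T) = ENNReal.ofReal (t ^ k) * stepGen t T := by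
  cases T with
  | top => simp [stepGen]
  | coe m =>
    have : ((k : ℕ∞) + (m : ℕ∞)) = ((k + m : ℕ) : ℕ∞) := by push_cast; rfl
    rw [this]
    simp only [stepGen, ENat.natCast_ne_top, if_false, ENat.toNat_natCast]
    rw [pow_add, ENNReal.ofReal_mul (pow_nonneg ht _)]

lemma measurable_stepGen (t : ℝ) : Measurable (stepGen t) := measurable_of_countable _

variable {V : Type*} [Fintype V] [DecidableEq V] {G : SimpleGraph V}

/-- The decomposition of `t ^ T` by the first iteration: the time `k` just before the walk stops, and
its loop-erased path `q` at that time. -/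
lemma stepGen_stepsFrom_succ (ι : Fin (Fintype.card V) ≃ V) {t : ℝ} (ht : 0 ≤ t) {S : Finset V}
    {x : V} (hxS : x ∉ S) (hx : nextStart ι S = some x) (d : InputData G) (hd : (d x).1 0 = x)
    (m : ℕ) :
    stepGen t (stepsFrom ι d (m + 1) S) = ∑' k : ℕ, ∑ q : SAPath V, ENNReal.ofReal (t ^ (k + 1)) *
      ({d' : (ℕ → V) × (OrientedCycle G → ℕ → Bool) | (SurvivesTo d'.1 d'.2 S k ∧
        erasedPath d'.1 k = q) ∧ StopsAt d'.1 d'.2 S (k + 1)}.indicator 1 (d x) *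
        stepGen t (stepsFrom ι d m (S ∪ q.1.toFinset))) := by
  classical
  by_cases hex : ∃ k, StopsAt (d x).1 (d x).2 S k
  · obtain ⟨k, hk⟩ : ∃ k, Nat.find hex = k + 1 := by
      refine Nat.exists_eq_succ_of_ne_zero fun h0 => ?_
      have h := Nat.find_spec hex
      rw [h0] at h
      rcases h with h | ⟨c, hf, -⟩
      · rw [hd] at h
        exact hxS h
      · exact not_formedAt_zero _ _ hf
    have h_end : StopsAt (d x).1 (d x).2 S (k + 1) := hk ▸ Nat.find_spec hex
    have hsurv : ∀ j < k + 1, ¬ StopsAt (d x).1 (d x).2 S j := fun j hj =>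
      Nat.find_min hex (hk ▸ hj)
    rw [stepsFrom_succ ι hx, stopTime_eq_coe h_end hsurv, if_neg (ENat.natCast_ne_top _),
      ENat.toNat_natCast, union_newVertices h_end, stepGen_coe_add ht,
      tsum_eq_single k, Finset.sum_eq_single (erasedPath (d x).1 k)]
    · rw [Set.indicator_of_mem]
      · simp [erasedPath]
      · exact ⟨⟨fun j hj => hsurv j (by omega), rfl⟩, h_end⟩
    · intro q _ hq
      rw [Set.indicator_of_notMem, zero_mul, mul_zero]
      exact fun h => hq h.1.2.symm
    · simp
    · intro j hj
      refine Finset.sum_eq_zero fun q _ => ?_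
      rw [Set.indicator_of_notMem, zero_mul, mul_zero]
      rintro ⟨⟨h1, -⟩, h2⟩
      rcases lt_trichotomy j k with h | h | h
      · exact hsurv (j + 1) (by omega) h2
      · exact hj h
      · exact h1 (k + 1) (by omega) h_end
  · have htop : stopTime (d x).1 (d x).2 S = ⊤ := stopTime_eq_top (not_exists.1 hex)
    rw [stepsFrom_succ ι hx, htop, top_add, stepGen, if_pos rfl, eq_comm, ENNReal.tsum_eq_zero]
    intro k
    refine Finset.sum_eq_zero fun q _ => ?_
    rw [Set.indicator_of_notMem, zero_mul, mul_zero]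
    exact fun h => hex ⟨_, h.2⟩

end GeneratingFunction

/-! ### The recursion over the iterations -/

section GeneratingFunctionLaw

variable {V : Type*} [Fintype V] [DecidableEq V] [MeasurableSpace V] [MeasurableSingletonClass V]
  {Ω : Type*} [MeasurableSpace Ω] {G : SimpleGraph V} {W : Matrix V V ℝ} {α : Cycle V → ℝ}
  {P : Measure Ω} [IsProbabilityMeasure P] {X : V → ℕ → Ω → V}
  {B : V → OrientedCycle G → ℕ → Ω → Bool}

/-- The input of the algorithm, as a random element of the space of data. -/
def inputData (X : V → ℕ → Ω → V) (B : V → OrientedCycle G → ℕ → Ω → Bool) (ω : Ω) :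
    InputData G :=
  fun x => ((fun k => X x k ω), fun c k => B x c k ω)

omit [IsProbabilityMeasure P] [MeasurableSingletonClass V] in
lemma IsRandomInput.measurable_inputData (hXB : IsRandomInput W α P X B) :
    Measurable (inputData X B) :=
  measurable_pi_lambda _ fun x => (measurable_pi_lambda _ (hXB.measurable_walk x)).prodMk
    (measurable_pi_lambda _ fun c => measurable_pi_lambda _ (hXB.measurable_bit x c))

variable (hstep : IsStepLaw (transition W) (eraseProb G α))
  (hα : ∀ c, IsOrientedCycle G c → α c ∈ Set.Icc (0 : ℝ) 1)
  (hD1 : ∀ U, 0 < cycleSum (transition W) (eraseProb G α) U 1)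
  (hXB : IsRandomInput W α P X B) (ι : Fin (Fintype.card V) ≃ V)

include hXB in
lemma ae_start (x : V) : ∀ᵐ ω ∂P, X x 0 ω = x := by
  have hstart : P {ω | X x 0 ω = x} = 1 := by
    have := hXB.walk_law x 0 fun _ => x
    simpa using this
  exact (prob_compl_eq_zero_iff (hXB.measurable_walk x 0 (measurableSet_singleton x))).2 hstart

include hXB in
/-- After an iteration that starts at `x`, the remaining number of steps is independent of the walk of
`x`, because the vertex `x` has been visited. -/
lemma lintegral_indicator_mul_stepGen (t : ℝ) (m : ℕ) {x : V} {S : Finset V} (hx : x ∈ S)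
    {E : Set ((ℕ → V) × (OrientedCycle G → ℕ → Bool))} (hE : MeasurableSet E) :
    ∫⁻ ω, E.indicator 1 (inputData X B ω x) * stepGen t (stepsFrom ι (inputData X B ω) m S) ∂P =
      P {ω | inputData X B ω x ∈ E} * ∫⁻ ω, stepGen t (stepsFrom ι (inputData X B ω) m S) ∂P := by
  set ext : ({y // y ≠ x} → (ℕ → V) × (OrientedCycle G → ℕ → Bool)) → InputData G :=
    fun f y => if h : y ≠ x then f ⟨y, h⟩ else (fun _ => x, fun _ _ => false) with hext
  have hextm : Measurable ext := by
    refine measurable_pi_lambda _ fun y => ?_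
    by_cases h : y ≠ x
    · simp only [hext, h, ne_eq, not_false_eq_true, dite_true]
      exact measurable_pi_apply _
    · simp only [hext, h, dite_false]
      exact measurable_const
  have hsteps : ∀ ω, stepsFrom ι (inputData X B ω) m S =
      stepsFrom ι (ext fun y => inputData X B ω y.1) m S := by
    intro ω
    refine stepsFrom_congr ι m fun y hy => ?_
    have : y ≠ x := fun h => hy (h ▸ hx)
    simp [hext, this]
  simp only [hsteps]
  have h1 : Measurable fun d : (ℕ → V) × (OrientedCycle G → ℕ → Bool) =>
      E.indicator (fun _ => (1 : ℝ≥0∞)) d := measurable_one.indicator hE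
  have h2 : Measurable fun f : {y // y ≠ x} → (ℕ → V) × (OrientedCycle G → ℕ → Bool) =>
      stepGen t (stepsFrom ι (ext f) m S) :=
    (measurable_stepGen t).comp ((measurable_stepsFrom ι m S).comp hextm)
  have hd := hXB.measurable_inputData
  have hind := (hXB.indepFun_compl x).comp h1 h2
  have hdx : Measurable fun ω => inputData X B ω x := (measurable_pi_apply x).comp hd
  have h3 := lintegral_mul_eq_lintegral_mul_lintegral_of_indepFun (μ := P)
    (h1.comp hdx)
    (h2.comp (measurable_pi_lambda _ fun y => (measurable_pi_apply y.1).comp hd)) hind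
  refine Eq.trans h3 ?_
  congr 1
  have h4 : ∀ ω, E.indicator (fun _ => (1 : ℝ≥0∞)) (inputData X B ω x) =
      ((fun ω => inputData X B ω x) ⁻¹' E).indicator 1 ω := fun ω => rfl
  simp only [Function.comp_apply, h4]
  exact lintegral_indicator_one (hdx hE)

include hstep hα hD1 hXB

/-- The generating function of the number of steps from the visited set `S`. -/
theorem lintegral_stepGen {t : ℝ} (ht : t ∈ Set.Icc (0 : ℝ) 1) (m : ℕ) (S : Finset V)
    (hm : Sᶜ.card ≤ m) :
    ∫⁻ ω, stepGen t (stepsFrom ι (inputData X B ω) m S) ∂P =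
      ENNReal.ofReal (t ^ Sᶜ.card * cycleSum (transition W) (eraseProb G α) Sᶜ 1 /
        cycleSum (transition W) (eraseProb G α) Sᶜ t) := by
  set D := cycleSum (transition W) (eraseProb G α) with hD
  have hDt : ∀ U, 0 < D U t := by
    intro U
    rcases ht.2.lt_or_eq with h1 | rfl
    · exact cycleSum_pos_of_lt_one hstep ⟨ht.1, h1⟩ U
    · exact hD1 U
  induction m generalizing S with
  | zero =>
    have hS : Sᶜ = ∅ := Finset.card_eq_zero.1 (Nat.le_zero.1 hm)
    simp [stepsFrom, stepGen, hS, hD, cycleSum, alternatingSum_empty]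
  | succ m ih =>
    by_cases hS : S = Finset.univ
    · subst hS
      simp [stepsFrom_univ, stepGen, hD, cycleSum, alternatingSum_empty]
    obtain ⟨x, hxS, hx⟩ := exists_nextStart ι hS
    have hxU : x ∈ Sᶜ := by simpa using hxS
    have hd := hXB.measurable_inputData
    set E : ℕ → SAPath V → Set ((ℕ → V) × (OrientedCycle G → ℕ → Bool)) := fun k q =>
      {d | (SurvivesTo d.1 d.2 S k ∧ erasedPath d.1 k = q) ∧ StopsAt d.1 d.2 S (k + 1)} with hE
    have hEm : ∀ k q, MeasurableSet (E k q) := fun k q =>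
      ((measurableSet_survivesTo S k).inter (measurable_fst (measurableSet_erasedPath k q))).inter
        (measurableSet_stopsAt S (k + 1))
    have hEP : ∀ k q, P {ω | inputData X B ω x ∈ E k q} =
        ENNReal.ofReal ((pathKernel (transition W) (eraseProb G α) Sᶜ ^ k) (singlePath x) q *
          killProb (transition W) (eraseProb G α) Sᶜ q) :=
      fun k q => prob_stops hstep hα hXB S hxS k q
    have hmeas : ∀ m S, Measurable fun ω => stepGen t (stepsFrom ι (inputData X B ω) m S) :=
      fun m S => (measurable_stepGen t).comp ((measurable_stepsFrom ι m S).comp hd)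
    have hind : ∀ k q, Measurable fun ω => (E k q).indicator (fun _ => (1 : ℝ≥0∞)) (inputData X B ω x) :=
      fun k q => (measurable_one.indicator (hEm k q)).comp ((measurable_pi_apply x).comp hd)
    have hterm : ∀ k q, Measurable fun ω => ENNReal.ofReal (t ^ (k + 1)) *
        ((E k q).indicator 1 (inputData X B ω x) *
          stepGen t (stepsFrom ι (inputData X B ω) m (S ∪ q.1.toFinset))) :=
      fun k q => ((hind k q).mul (hmeas _ _)).const_mul _
    have hexpand : ∫⁻ ω, stepGen t (stepsFrom ι (inputData X B ω) (m + 1) S) ∂P =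
        ∑ q : SAPath V, ∑' k : ℕ, ENNReal.ofReal (t ^ (k + 1)) *
          ∫⁻ ω, (E k q).indicator 1 (inputData X B ω x) *
            stepGen t (stepsFrom ι (inputData X B ω) m (S ∪ q.1.toFinset)) ∂P := by
      have hae : ∀ᵐ ω ∂P, stepGen t (stepsFrom ι (inputData X B ω) (m + 1) S) =
          ∑' k : ℕ, ∑ q : SAPath V, ENNReal.ofReal (t ^ (k + 1)) *
            ((E k q).indicator 1 (inputData X B ω x) *
              stepGen t (stepsFrom ι (inputData X B ω) m (S ∪ q.1.toFinset))) := by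
        filter_upwards [ae_start hXB x] with ω hω
        exact stepGen_stepsFrom_succ ι ht.1 hxS hx _ hω m
      rw [lintegral_congr_ae hae, lintegral_tsum fun k =>
        (Finset.measurable_fun_sum _ fun q _ => hterm k q).aemeasurable]
      simp_rw [lintegral_finsetSum _ fun q _ => hterm _ q]
      rw [Summable.tsum_finsetSum fun _ _ => ENNReal.summable]
      refine Finset.sum_congr rfl fun q _ => tsum_congr fun k => ?_
      exact lintegral_const_mul _ ((hind k q).mul (hmeas _ _))
    have hg := fun q => hasSum_pathKernel hstep hD1 hxU ht q
    have hq : ∀ q : SAPath V, ∑' k : ℕ, ENNReal.ofReal (t ^ (k + 1)) *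
          ∫⁻ ω, (E k q).indicator 1 (inputData X B ω x) *
            stepGen t (stepsFrom ι (inputData X B ω) m (S ∪ q.1.toFinset)) ∂P =
        ENNReal.ofReal (t ^ Sᶜ.card / D Sᶜ t *
          (greenNumerator (transition W) (eraseProb G α) Sᶜ x 1 q *
            (1 - 1 * (1 - killProb (transition W) (eraseProb G α) Sᶜ q)))) := by
      intro q
      -- Paths that do not start at `x` or leave `U` have probability `0`. For the others, the factors
      -- `D_t(U \ q)` of the Green function and of the induction hypothesis cancel.
      by_cases hqx : q.1.head? = some x ∧ q.1.toFinset ⊆ Sᶜ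
      · have hxq : x ∈ q.1 := List.mem_of_mem_head? hqx.1
        have hcompl : (S ∪ q.1.toFinset)ᶜ = Sᶜ \ q.1.toFinset := by
          rw [Finset.compl_union, Finset.sdiff_eq_inter_compl]
        have hlen : q.1.toFinset.card = q.1.length := List.toFinset_card_of_nodup q.2
        have hpos : 0 < q.1.length := List.length_pos_of_mem hxq
        have hle : q.1.length ≤ Sᶜ.card := hlen ▸ Finset.card_le_card hqx.2
        have hcard : (S ∪ q.1.toFinset)ᶜ.card = Sᶜ.card - q.1.length := by
          rw [hcompl, Finset.card_sdiff_of_subset hqx.2, hlen]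
        have hih := ih (S ∪ q.1.toFinset) (by omega)
        rw [hcard, hcompl] at hih
        set v := t ^ (Sᶜ.card - q.1.length) * D (Sᶜ \ q.1.toFinset) 1 / D (Sᶜ \ q.1.toFinset) t
          with hv
        have hv0 : 0 ≤ v := div_nonneg (mul_nonneg (pow_nonneg ht.1 _) (hD1 _).le) (hDt _).le
        set κ := killProb (transition W) (eraseProb G α) Sᶜ q with hκ
        have hκ0 : 0 ≤ κ := killProb_nonneg hstep Sᶜ q
        have hK0 := fun k => pathKernel_pow_nonneg hstep Sᶜ k (singlePath x) q
        have hsum := (hg q).mul_left (t * κ * v)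
        calc _ = ∑' k : ℕ, ENNReal.ofReal (t * κ * v * (t ^ k *
              (pathKernel (transition W) (eraseProb G α) Sᶜ ^ k) (singlePath x) q)) := by
              refine tsum_congr fun k => ?_
              rw [lintegral_indicator_mul_stepGen hXB ι t m (by simp [hxq]) (hEm k q), hEP, hih,
                ← ENNReal.ofReal_mul (mul_nonneg (hK0 k) hκ0),
                ← ENNReal.ofReal_mul (pow_nonneg ht.1 _)]
              congr 1
              ring
          _ = _ := by
              rw [← ENNReal.ofReal_tsum_of_nonneg (fun k => mul_nonneg
                (mul_nonneg (mul_nonneg ht.1 hκ0) hv0) (mul_nonneg (pow_nonneg ht.1 _) (hK0 k)))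
                hsum.summable, hsum.tsum_eq]
              congr 1
              rw [greenNumerator, if_pos hqx, greenNumerator, if_pos hqx, hv]
              have hpow : t ^ Sᶜ.card = t * t ^ (Sᶜ.card - q.1.length) * t ^ (q.1.length - 1) := by
                rw [← pow_succ', ← pow_add]
                congr 1
                omega
              have h1 := (hDt Sᶜ).ne'
              have h2 := (hDt (Sᶜ \ q.1.toFinset)).ne'
              rw [hpow, one_pow]
              simp only [← hD]
              field_simp
              ring
      · rw [greenNumerator_eq_zero hqx, zero_mul, mul_zero, ENNReal.ofReal_zero,
          ENNReal.tsum_eq_zero]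
        intro k
        have h0 := hg q
        rw [greenNumerator_eq_zero hqx, zero_div, hasSum_zero_iff_of_nonneg fun k =>
          mul_nonneg (pow_nonneg ht.1 _) (pathKernel_pow_nonneg hstep Sᶜ k (singlePath x) q)] at h0
        rcases mul_eq_zero.1 (congrFun h0 k) with hk | hk
        · rw [pow_succ, hk, zero_mul, ENNReal.ofReal_zero, zero_mul]
        · have hP := hEP k q
          rw [hk, zero_mul, ENNReal.ofReal_zero] at hP
          have hz : (fun ω => (E k q).indicator 1 (inputData X B ω x) *
              stepGen t (stepsFrom ι (inputData X B ω) m (S ∪ q.1.toFinset))) =ᵐ[P] 0 := by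
            filter_upwards [measure_eq_zero_iff_ae_notMem.1 hP] with ω hω
            rw [Set.indicator_of_notMem hω, zero_mul]
            rfl
          rw [lintegral_congr_ae hz]
          simp
    rw [hexpand, Finset.sum_congr rfl fun q _ => hq q, ← ENNReal.ofReal_sum_of_nonneg,
      ← Finset.mul_sum, sum_greenNumerator_mul hxU]
    · congr 1
      ring
    · intro q _
      refine mul_nonneg (div_nonneg (pow_nonneg ht.1 _) (hDt _).le) (mul_nonneg
        (greenNumerator_nonneg hstep zero_le_one hD1 _ _ _) ?_)
      linarith [killProb_nonneg hstep Sᶜ q]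

end GeneratingFunctionLaw

/-! ### Positivity of the alternating sums at `1` -/

section Positivity

variable {V : Type*} [Fintype V] [DecidableEq V]

/-- The walk is killed at least with the probability that it steps to a given vertex `y` and is killed
there. -/
lemma le_killProb {p : V → V → ℝ} {r : Cycle V → ℝ} (h : IsStepLaw p r) (U : Finset V) {q : SAPath V}
    {v : V} (hv : q.1.getLast? = some v) (y : V) :
    p v y * (1 - if y ∈ U then (if y ∈ q.1 then r (closedCycle q.1 y) else 1) else 0) ≤
      killProb p r U q := by
  have hkill : killProb p r U q = ∑ y, p v y *
      (1 - if y ∈ U then (if y ∈ q.1 then r (closedCycle q.1 y) else 1) else 0) := by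
    simp only [killProb, mul_sub, mul_one, Finset.sum_sub_distrib, h.sum_eq_one, mul_ite, mul_zero]
    rw [← Finset.sum_filter, Finset.filter_univ_mem]
    simp [moveWeight, hv]
  rw [hkill]
  refine Finset.single_le_sum (f := fun y => p v y *
    (1 - if y ∈ U then (if y ∈ q.1 then r (closedCycle q.1 y) else 1) else 0))
    (fun y _ => mul_nonneg (h.nonneg v y) ?_) (Finset.mem_univ y)
  split_ifs
  · linarith [h.erase_le_one (closedCycle q.1 y)]
  · simp
  · simp

omit [DecidableEq V] in
lemma pathWeight_transition_pos {G : SimpleGraph V} {W : Matrix V V ℝ} (hW : IsEdgeWeight G W)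
    {l : List V} (hl : l.IsChain G.Adj) : 0 < pathWeight (transition W) l := by
  induction l with
  | nil => exact zero_lt_one
  | cons x l ih =>
    cases l with
    | nil => exact zero_lt_one
    | cons y l =>
      rw [List.isChain_cons_cons] at hl
      exact mul_pos (transition_pos hW hl.1) (ih hl.2)

/-- The walk is killed with positive probability from every nonempty set: if the set is not the whole
graph, the walk can leave it, and otherwise it can close a cycle that may be accepted. -/
lemma cycleSum_one_pos {G : SimpleGraph V} (hG : G.Connected) {W : Matrix V V ℝ}
    (hW : IsEdgeWeight G W) {α : Cycle V → ℝ}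
    (hpos : ∃ c, IsOrientedCycle G c ∧ 0 < α c)
    (h : IsStepLaw (transition W) (eraseProb G α)) (U : Finset V) :
    0 < cycleSum (transition W) (eraseProb G α) U 1 := by
  refine cycleSum_pos h ⟨zero_le_one, le_rfl⟩ (fun U hU => ?_) U
  simp only [one_pow, one_mul, sub_sub_cancel]
  by_cases hU' : U = Finset.univ
  · obtain ⟨c, hc, hαc⟩ := hpos
    induction c using Quotient.inductionOn with
    | h l =>
    obtain ⟨h2, hnd, hch⟩ := id hc
    cases l with
    | nil => simp at h2
    | cons x l =>
      have hnd' : (x :: l).Nodup := Cycle.nodup_coe_iff.1 hnd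
      have hch' : (x :: (l ++ [x])).IsChain G.Adj := (Cycle.chain_coe_cons _ _ _).1 hch
      rw [← List.cons_append, List.isChain_append] at hch'
      obtain ⟨v, hv⟩ : ∃ v, (x :: l).getLast? = some v :=
        ⟨_, List.getLast?_eq_some_getLast (List.cons_ne_nil x l)⟩
      have hadj : G.Adj v x := hch'.2.2 v hv x (by simp)
      refine ⟨⟨x :: l, hnd'⟩, List.cons_ne_nil _ _, by simp [hU'],
        pathWeight_transition_pos hW hch'.1, ?_⟩
      refine lt_of_lt_of_le ?_ (le_killProb h U hv x)
      have hcl : closedCycle (x :: l) x = ((x :: l : List V) : Cycle V) := by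
        simp [closedCycle]
      have hr : eraseProb G α ((x :: l : List V) : Cycle V) = 1 - α ((x :: l : List V) : Cycle V) :=
        if_pos hc
      simp only [hU', Finset.mem_univ, if_true, List.mem_cons, true_or, hcl, hr, sub_sub_cancel]
      exact mul_pos (transition_pos hW hadj) hαc
  · obtain ⟨y, hy⟩ : ∃ y, y ∉ U := by
      by_contra! hcon
      exact hU' (Finset.eq_univ_of_forall hcon)
    obtain ⟨x, hx⟩ := hU
    obtain ⟨d, hd, h1, h2⟩ :=
      (hG.preconnected x y).some.exists_boundary_dart (U : Set V) hx hy
    refine ⟨singlePath d.fst, by simp [singlePath], by simpa [singlePath] using h1,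
      by simp [singlePath, pathWeight], ?_⟩
    refine lt_of_lt_of_le ?_ (le_killProb h U (q := singlePath d.fst) (v := d.fst) rfl d.snd)
    have h2' : d.snd ∉ U := h2
    simp only [h2', if_false, sub_zero, mul_one]
    exact transition_pos hW d.adj

end Positivity

/-! ### The generating function of the running time -/

section RunningTime

variable {V : Type*} [Fintype V] [DecidableEq V] {G : SimpleGraph V} {W : Matrix V V ℝ}
  {α : Cycle V → ℝ}

lemma summable_loopMass (hW : IsEdgeWeight G W) (hstep : IsStepLaw (transition W) (eraseProb G α))
    (hD1 : ∀ U, 0 < cycleSum (transition W) (eraseProb G α) U 1) :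
    Summable fun ℓ : UnbasedLoop G => loopMass W α ℓ := by
  have h1 := (hasSum_loopMass hstep hW (α := α) (fun k => (1 : ℝ) ^ k) (fun k => by simp)
    (summable_closedWeight_div hstep hD1 ⟨zero_le_one, le_rfl⟩)).summable
  simpa using h1

/-- The alternating sum over the whole graph is the exponential of minus the generating function of the
loop measure. -/
lemma cycleSum_univ_div (hW : IsEdgeWeight G W) (hstep : IsStepLaw (transition W) (eraseProb G α))
    (hD1 : ∀ U, 0 < cycleSum (transition W) (eraseProb G α) U 1) {t : ℝ}
    (ht : t ∈ Set.Icc (0 : ℝ) 1) :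
    cycleSum (transition W) (eraseProb G α) Finset.univ 1 /
      cycleSum (transition W) (eraseProb G α) Finset.univ t =
      Real.exp (∑' ℓ : UnbasedLoop G, (t ^ ℓ.length - 1) * loopMass W α ℓ) := by
  have h1 : (1 : ℝ) ∈ Set.Icc (0 : ℝ) 1 := ⟨zero_le_one, le_rfl⟩
  have hs1 := hasSum_loopMass hstep hW (α := α) (fun k => (1 : ℝ) ^ k) (fun k => by simp)
    (summable_closedWeight_div hstep hD1 h1)
  have hst := hasSum_loopMass hstep hW (α := α) (fun k => t ^ k) (fun k => pow_nonneg ht.1 k)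
    (summable_closedWeight_div hstep hD1 ht)
  have hdiff := hst.sub hs1
  rw [cycleSum_eq_exp hstep hD1 _ h1, cycleSum_eq_exp hstep hD1 _ ht, ← Real.exp_sub,
    neg_sub_neg, ← hdiff.tsum_eq]
  congr 1
  exact tsum_congr fun ℓ => by rw [one_pow]; ring

variable [MeasurableSpace V] [MeasurableSingletonClass V] {Ω : Type*} [MeasurableSpace Ω]
  {P : Measure Ω} {X : V → ℕ → Ω → V} {B : V → OrientedCycle G → ℕ → Ω → Bool}

lemma IsRandomInput.measurable_runningTime (hXB : IsRandomInput W α P X B)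
    (ι : Fin (Fintype.card V) ≃ V) : Measurable (runningTime ι X B) := by
  have : runningTime ι X B =
      fun ω => stepsFrom ι (inputData X B ω) (Fintype.card V) ∅ := by
    funext ω
    exact totalSteps_eq ι (inputData X B ω)
  rw [this]
  exact (measurable_stepsFrom ι _ _).comp hXB.measurable_inputData

variable [IsProbabilityMeasure P] (hW : IsEdgeWeight G W)
  (hstep : IsStepLaw (transition W) (eraseProb G α))
  (hα : ∀ c, IsOrientedCycle G c → α c ∈ Set.Icc (0 : ℝ) 1)
  (hD1 : ∀ U, 0 < cycleSum (transition W) (eraseProb G α) U 1)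
  (hXB : IsRandomInput W α P X B) (ι : Fin (Fintype.card V) ≃ V)
include hW hstep hα hD1 hXB

lemma lintegral_stepGen_runningTime {t : ℝ} (ht : t ∈ Set.Icc (0 : ℝ) 1) :
    ∫⁻ ω, stepGen t (runningTime ι X B ω) ∂P = ENNReal.ofReal (t ^ Fintype.card V *
      Real.exp (∑' ℓ : UnbasedLoop G, (t ^ ℓ.length - 1) * loopMass W α ℓ)) := by
  have h1 : ∀ ω, runningTime ι X B ω = stepsFrom ι (inputData X B ω) (Fintype.card V) ∅ :=
    fun ω => totalSteps_eq ι (inputData X B ω)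
  simp only [h1]
  rw [lintegral_stepGen hstep hα hD1 hXB ι ht _ _ (Finset.card_le_univ _), Finset.compl_empty,
    Finset.card_univ, mul_div_assoc, cycleSum_univ_div hW hstep hD1 ht]

lemma runningTime_lt_top : ∀ᵐ ω ∂P, runningTime ι X B ω < ⊤ := by
  have h1 := lintegral_stepGen_runningTime hW hstep hα hD1 hXB ι (t := 1) ⟨zero_le_one, le_rfl⟩
  have h2 : ∀ ω, stepGen 1 (runningTime ι X B ω) = {ω | runningTime ι X B ω < ⊤}.indicator 1 ω := by
    intro ω
    by_cases h : runningTime ι X B ω = ⊤ <;> simp [stepGen, h, lt_top_iff_ne_top]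
  have hm : MeasurableSet {ω | runningTime ι X B ω < ⊤} :=
    hXB.measurable_runningTime ι (Set.to_countable (Set.Iio ⊤)).measurableSet
  simp only [h2, lintegral_indicator_one hm, one_pow, sub_self, zero_mul, tsum_zero, Real.exp_zero,
    mul_one, ENNReal.ofReal_one] at h1
  exact (prob_compl_eq_zero_iff hm).2 h1

lemma integral_pow_runningTime {t : ℝ} (ht : t ∈ Set.Icc (0 : ℝ) 1) :
    ∫ ω, t ^ (runningTime ι X B ω).toNat ∂P = t ^ Fintype.card V *
      Real.exp (∑' ℓ : UnbasedLoop G, (t ^ ℓ.length - 1) * loopMass W α ℓ) := by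
  have hm : Measurable fun ω => t ^ (runningTime ι X B ω).toNat :=
    (measurable_of_countable fun k : ℕ∞ => t ^ k.toNat).comp (hXB.measurable_runningTime ι)
  rw [integral_eq_lintegral_of_nonneg_ae (Filter.Eventually.of_forall fun ω => pow_nonneg ht.1 _)
    hm.aestronglyMeasurable]
  have hae : (fun ω => ENNReal.ofReal (t ^ (runningTime ι X B ω).toNat)) =ᵐ[P]
      fun ω => stepGen t (runningTime ι X B ω) := by
    filter_upwards [runningTime_lt_top hW hstep hα hD1 hXB ι] with ω hω
    rw [stepGen, if_neg hω.ne]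
  rw [lintegral_congr_ae hae, lintegral_stepGen_runningTime hW hstep hα hD1 hXB ι ht,
    ENNReal.toReal_ofReal (mul_nonneg (pow_nonneg ht.1 _) (Real.exp_pos _).le)]

end RunningTime

/-! ### Laplace transforms of extended nonnegative random variables -/

section Laplace

/-- The function `x ↦ exp (-c x)` on `[0, ∞]`, with value `0` at `∞` if `c > 0`. -/
def expNeg (c : NNReal) (x : ℝ≥0∞) : ℝ≥0∞ := (EReal.exp ((c * x : ℝ≥0∞) : EReal))⁻¹

lemma continuous_expNeg (c : NNReal) : Continuous (expNeg c) :=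
  (ENNReal.continuous_exp.comp
    (continuous_coe_ennreal_ereal.comp (ENNReal.continuous_const_mul ENNReal.coe_ne_top))).inv

lemma expNeg_le_one (c : NNReal) (x : ℝ≥0∞) : expNeg c x ≤ 1 := by
  rw [expNeg, ENNReal.inv_le_one]
  exact EReal.one_le_exp_iff.2 (EReal.coe_ennreal_nonneg _)

lemma expNeg_add (c : NNReal) (x y : ℝ≥0∞) : expNeg c (x + y) = expNeg c x * expNeg c y := by
  have hne : ∀ z : ℝ≥0∞, EReal.exp (z : EReal) ≠ 0 := fun z => by simp
  rw [expNeg, mul_add, EReal.coe_ennreal_add, EReal.exp_add,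
    ENNReal.mul_inv (Or.inl (hne _)) (Or.inr (hne _))]
  rfl

lemma expNeg_zero (c : NNReal) : expNeg c 0 = 1 := by simp [expNeg]

lemma expNeg_top {c : NNReal} (hc : 0 < c) : expNeg c ⊤ = 0 := by
  simp [expNeg, ENNReal.mul_top, hc.ne']

lemma expNeg_natCast (c : NNReal) (k : ℕ) :
    expNeg c k = ENNReal.ofReal (Real.exp (-c) ^ k) := by
  induction k with
  | zero => simp [expNeg_zero]
  | succ k ih =>
    have h1 : expNeg c 1 = ENNReal.ofReal (Real.exp (-c)) := by
      rw [expNeg, mul_one, Real.exp_neg, ENNReal.ofReal_inv_of_pos (Real.exp_pos _)]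
      rfl
    rw [Nat.cast_succ, expNeg_add, ih, h1, pow_succ, ENNReal.ofReal_mul (by positivity)]

lemma expNeg_sum {ι : Type*} (c : NNReal) (F : Finset ι) (f : ι → ℝ≥0∞) :
    expNeg c (∑ i ∈ F, f i) = ∏ i ∈ F, expNeg c (f i) := by
  classical
  induction F using Finset.induction_on with
  | empty => simp [expNeg_zero]
  | insert i F hi ih => rw [Finset.sum_insert hi, Finset.prod_insert hi, expNeg_add, ih]

lemma expNeg_toENNReal {c : NNReal} (hc : 0 < c) (T : ℕ∞) :
    expNeg c (T : ℝ≥0∞) = stepGen (Real.exp (-c)) T := by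
  cases T with
  | top => simp [stepGen, expNeg_top hc]
  | coe k => simp [stepGen, expNeg_natCast]

/-- A bounded sequence is determined by its generating function on `(0, 1)`. -/
lemma eq_zero_of_tsum_pow_eq_zero {C : ℝ} (m : ℕ) (d : ℕ → ℝ) (hd : ∀ k, |d k| ≤ C)
    (h : ∀ t ∈ Set.Ioo (0 : ℝ) 1, ∑' k, d k * t ^ k = 0) : d m = 0 := by
  have hs : ∀ t ∈ Set.Ioo (0 : ℝ) 1, ∀ d : ℕ → ℝ, (∀ k, |d k| ≤ C) →
      Summable fun k => d k * t ^ k := by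
    intro t ht d hd
    refine Summable.of_norm_bounded ((summable_geometric_of_lt_one ht.1.le ht.2).mul_left C)
      fun k => ?_
    rw [norm_mul, Real.norm_eq_abs, Real.norm_of_nonneg (pow_nonneg ht.1.le k)]
    exact mul_le_mul_of_nonneg_right (hd k) (pow_nonneg ht.1.le k)
  have key : ∀ d : ℕ → ℝ, (∀ k, |d k| ≤ C) → (∀ t ∈ Set.Ioo (0 : ℝ) 1, ∑' k, d k * t ^ k = 0) →
      d 0 = 0 ∧ ∀ t ∈ Set.Ioo (0 : ℝ) 1, ∑' k, d (k + 1) * t ^ k = 0 := by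
    intro d hd h
    have hsplit : ∀ t ∈ Set.Ioo (0 : ℝ) 1, d 0 + t * ∑' k, d (k + 1) * t ^ k = 0 := by
      intro t ht
      rw [← h t ht, (hs t ht d hd).tsum_eq_zero_add, pow_zero, mul_one, ← tsum_mul_left]
      congr 1
      exact tsum_congr fun k => by ring
    have h0 : d 0 = 0 := by
      have hbound : ∀ t ∈ Set.Ioo (0 : ℝ) (1 / 2), |d 0| ≤ t * (C * 2) := by
        intro t ht
        have ht' : t ∈ Set.Ioo (0 : ℝ) 1 := ⟨ht.1, by linarith [ht.2]⟩
        have h1 : d 0 = -(t * ∑' k, d (k + 1) * t ^ k) := by linarith [hsplit t ht']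
        have hC : 0 ≤ C := (abs_nonneg _).trans (hd 0)
        rw [h1, abs_neg, abs_mul, abs_of_pos ht.1]
        refine mul_le_mul_of_nonneg_left ?_ ht.1.le
        refine (tsum_of_norm_bounded (E := ℝ)
          ((hasSum_geometric_of_lt_one ht'.1.le ht'.2).mul_left C) fun k => ?_).trans ?_
        · rw [norm_mul, Real.norm_eq_abs, Real.norm_of_nonneg (pow_nonneg ht.1.le k)]
          exact mul_le_mul_of_nonneg_right (hd _) (pow_nonneg ht.1.le k)
        · refine mul_le_mul_of_nonneg_left ?_ hC
          rw [inv_le_comm₀ (by linarith [ht.2]) two_pos]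
          linarith [ht.2]
      have hlim : Filter.Tendsto (fun t : ℝ => t * (C * 2)) (nhdsWithin 0 (Set.Ioi 0)) (nhds 0) := by
        have : Filter.Tendsto (fun t : ℝ => t * (C * 2)) (nhds 0) (nhds (0 * (C * 2))) :=
          (continuous_id.mul continuous_const).tendsto 0
        rw [zero_mul] at this
        exact this.mono_left nhdsWithin_le_nhds
      have hle := ge_of_tendsto hlim (b := |d 0|)
        (Filter.mem_of_superset (Ioo_mem_nhdsGT (by norm_num : (0 : ℝ) < 1 / 2)) hbound)
      exact abs_nonpos_iff.1 hle
    refine ⟨h0, fun t ht => ?_⟩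
    have := hsplit t ht
    rw [h0, zero_add, mul_eq_zero] at this
    exact this.resolve_left ht.1.ne'
  induction m generalizing d with
  | zero => exact (key d hd h).1
  | succ m ih => exact ih (fun k => d (k + 1)) (fun k => hd _) (key d hd h).2

variable {Ω : Type*} [MeasurableSpace Ω] {P : Measure Ω} [IsProbabilityMeasure P]

lemma lintegral_expNeg {c : NNReal} (hc : 0 < c) {Y : Ω → ℝ≥0∞} (hY : Measurable Y)
    (hY' : ∀ᵐ ω ∂P, ∃ k : ℕ∞, Y ω = k) :
    ∫⁻ ω, expNeg c (Y ω) ∂P =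
      ENNReal.ofReal (∑' k : ℕ, P.real (Y ⁻¹' {(k : ℝ≥0∞)}) * Real.exp (-c) ^ k) := by
  have hm : ∀ k : ℕ, MeasurableSet (Y ⁻¹' {(k : ℝ≥0∞)}) := fun k => hY (measurableSet_singleton _)
  have h1 : (fun ω => expNeg c (Y ω)) =ᵐ[P] fun ω => ∑' k : ℕ,
      (Y ⁻¹' {(k : ℝ≥0∞)}).indicator (fun _ => ENNReal.ofReal (Real.exp (-c) ^ k)) ω := by
    filter_upwards [hY'] with ω hω
    obtain ⟨k, hk⟩ := hω
    cases k with
    | top =>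
      rw [hk, ENat.toENNReal_top, expNeg_top hc, eq_comm, ENNReal.tsum_eq_zero]
      intro j
      refine Set.indicator_of_notMem (fun h => ?_) _
      have h' : Y ω = j := h
      rw [hk] at h'
      exact absurd h'.symm (by simp)
    | coe k =>
      rw [ENat.toENNReal_coe] at hk
      rw [hk, expNeg_natCast, tsum_eq_single k]
      · exact (Set.indicator_of_mem (s := Y ⁻¹' {(k : ℝ≥0∞)}) hk
          fun _ => ENNReal.ofReal (Real.exp (-c) ^ k)).symm
      · intro j hj
        refine Set.indicator_of_notMem (fun h => hj ?_) _
        have h' : Y ω = j := h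
        rw [hk] at h'
        exact_mod_cast h'.symm
  have hle : Real.exp (-c) < 1 := Real.exp_lt_one_iff.2 (by simpa using hc)
  have hs : Summable fun k : ℕ => P.real (Y ⁻¹' {(k : ℝ≥0∞)}) * Real.exp (-c) ^ k :=
    (summable_geometric_of_lt_one (Real.exp_pos _).le hle).of_nonneg_of_le
      (fun k => by positivity) fun k => mul_le_of_le_one_left (by positivity) measureReal_le_one
  rw [lintegral_congr_ae h1, lintegral_tsum fun k =>
    (measurable_const.indicator (hm k)).aemeasurable, ENNReal.ofReal_tsum_of_nonneg
    (fun k => by positivity) hs]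
  refine tsum_congr fun k => ?_
  rw [lintegral_indicator_const (hm k), mul_comm, ENNReal.ofReal_mul measureReal_nonneg,
    ofReal_measureReal]

/-- A random variable with values in the nonnegative integers, and another one that may also be
infinite, have the same law as soon as they have the same Laplace transform. -/
lemma identDistrib_of_lintegral_expNeg {Ω' : Type*} [MeasurableSpace Ω'] {Q : Measure Ω'}
    [IsProbabilityMeasure Q] {Y : Ω → ℝ≥0∞} {Z : Ω' → ℝ≥0∞} (hY : Measurable Y)
    (hZ : Measurable Z) (hY' : ∀ᵐ ω ∂P, ∃ k : ℕ, Y ω = k) (hZ' : ∀ᵐ ω ∂Q, ∃ k : ℕ∞, Z ω = k)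
    (h : ∀ c : NNReal, 0 < c → ∫⁻ ω, expNeg c (Y ω) ∂P = ∫⁻ ω, expNeg c (Z ω) ∂Q) :
    IdentDistrib Y Z P Q := by
  have hY'' : ∀ᵐ ω ∂P, ∃ k : ℕ∞, Y ω = k := by
    filter_upwards [hY'] with ω hω
    obtain ⟨k, hk⟩ := hω
    exact ⟨k, by simpa using hk⟩
  have hreal : ∀ k : ℕ, P.real (Y ⁻¹' {(k : ℝ≥0∞)}) = Q.real (Z ⁻¹' {(k : ℝ≥0∞)}) := by
    intro m
    have habs : ∀ k : ℕ, |P.real (Y ⁻¹' {(k : ℝ≥0∞)}) - Q.real (Z ⁻¹' {(k : ℝ≥0∞)})| ≤ 1 := by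
      intro k
      rw [abs_sub_le_iff]
      have h1 : P.real (Y ⁻¹' {(k : ℝ≥0∞)}) ≤ 1 := measureReal_le_one
      have h2 : Q.real (Z ⁻¹' {(k : ℝ≥0∞)}) ≤ 1 := measureReal_le_one
      have h3 : 0 ≤ P.real (Y ⁻¹' {(k : ℝ≥0∞)}) := measureReal_nonneg
      have h4 : 0 ≤ Q.real (Z ⁻¹' {(k : ℝ≥0∞)}) := measureReal_nonneg
      constructor <;> linarith
    refine sub_eq_zero.1 (eq_zero_of_tsum_pow_eq_zero m
      (fun k => P.real (Y ⁻¹' {(k : ℝ≥0∞)}) - Q.real (Z ⁻¹' {(k : ℝ≥0∞)})) habs fun t ht => ?_)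
    have hs : ∀ f : ℕ → ℝ, (∀ k, 0 ≤ f k) → (∀ k, f k ≤ 1) → Summable fun k => f k * t ^ k :=
      fun f h0 h1 => (summable_geometric_of_lt_one ht.1.le ht.2).of_nonneg_of_le
        (fun k => mul_nonneg (h0 k) (pow_nonneg ht.1.le k))
        fun k => mul_le_of_le_one_left (pow_nonneg ht.1.le k) (h1 k)
    set c : NNReal := ⟨-Real.log t, by linarith [Real.log_neg ht.1 ht.2]⟩ with hc
    have hc0 : 0 < c := by
      rw [← NNReal.coe_pos]
      exact neg_pos.2 (Real.log_neg ht.1 ht.2)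
    have hct : Real.exp (-c) = t := by
      have : (c : ℝ) = -Real.log t := rfl
      rw [this, neg_neg, Real.exp_log ht.1]
    have hgen := h c hc0
    rw [lintegral_expNeg hc0 hY hY'', lintegral_expNeg hc0 hZ hZ', hct,
      ENNReal.ofReal_eq_ofReal_iff
        (tsum_nonneg fun k => mul_nonneg measureReal_nonneg (pow_nonneg ht.1.le k))
        (tsum_nonneg fun k => mul_nonneg measureReal_nonneg (pow_nonneg ht.1.le k))] at hgen
    simp_rw [sub_mul]
    rw [(hs _ (fun k => measureReal_nonneg) fun k => measureReal_le_one).tsum_sub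
      (hs _ (fun k => measureReal_nonneg) fun k => measureReal_le_one), hgen, sub_self]
  have heq : ∀ k : ℕ, P (Y ⁻¹' {(k : ℝ≥0∞)}) = Q (Z ⁻¹' {(k : ℝ≥0∞)}) := by
    intro k
    rw [← ofReal_measureReal, hreal, ofReal_measureReal]
  have hcount : ∀ s ⊆ Set.range ((↑) : ℕ → ℝ≥0∞), P (Y ⁻¹' s) = Q (Z ⁻¹' s) := by
    intro s hs
    have hsc : s.Countable := (Set.countable_range _).mono hs
    rw [← tsum_measure_preimage_singleton hsc fun y _ => hY (measurableSet_singleton y),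
      ← tsum_measure_preimage_singleton hsc fun y _ => hZ (measurableSet_singleton y)]
    refine tsum_congr fun y => ?_
    obtain ⟨k, hk⟩ := hs y.2
    rw [← hk]
    exact heq k
  have hZ'' : ∀ᵐ ω ∂Q, Z ω ∈ Set.range ((↑) : ℕ → ℝ≥0∞) := by
    have hm : MeasurableSet (Set.range ((↑) : ℕ → ℝ≥0∞)) := (Set.countable_range _).measurableSet
    refine (mem_ae_iff_prob_eq_one (hZ hm)).2 ?_
    rw [← hcount _ subset_rfl, ← mem_ae_iff_prob_eq_one (hY hm)]
    filter_upwards [hY'] with ω hω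
    obtain ⟨k, hk⟩ := hω
    exact ⟨k, hk.symm⟩
  refine ⟨hY.aemeasurable, hZ.aemeasurable, Measure.ext fun s hs => ?_⟩
  rw [Measure.map_apply hY hs, Measure.map_apply hZ hs]
  have h1 : P (Y ⁻¹' s) = P (Y ⁻¹' (s ∩ Set.range ((↑) : ℕ → ℝ≥0∞))) := by
    refine measure_congr ?_
    filter_upwards [hY'] with ω hω
    refine propext ⟨fun h => ⟨h, ?_⟩, fun h => h.1⟩
    obtain ⟨k, hk⟩ := hω
    exact ⟨k, hk.symm⟩
  have h2 : Q (Z ⁻¹' s) = Q (Z ⁻¹' (s ∩ Set.range ((↑) : ℕ → ℝ≥0∞))) := by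
    refine measure_congr ?_
    filter_upwards [hZ''] with ω hω
    exact propext ⟨fun h => ⟨h, hω⟩, fun h => h.1⟩
  rw [h1, h2, hcount _ Set.inter_subset_right]

end Laplace

/-! ### Laplace functionals of Poisson point processes -/

section PoissonProcess

lemma lintegral_expNeg_poissonLaw (c : NNReal) (l : ℕ) {m : ℝ} (hm : 0 ≤ m) :
    ∫⁻ x, expNeg c (l * x) ∂(poissonLaw (ENNReal.ofReal m)) =
      ENNReal.ofReal (Real.exp ((Real.exp (-c) ^ l - 1) * m)) := by
  have hmeas : Measurable fun x : ℝ≥0∞ => expNeg c (l * x) :=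
    (continuous_expNeg c).measurable.comp (measurable_const_mul _)
  rw [poissonLaw, if_neg ENNReal.ofReal_ne_top, lintegral_map hmeas (measurable_of_countable _),
    lintegral_countable']
  have hr : ((ENNReal.ofReal m).toNNReal : ℝ) = m := ENNReal.toReal_ofReal hm
  have hterm : ∀ k : ℕ, expNeg c (l * (k : ℝ≥0∞)) * poissonMeasure (ENNReal.ofReal m).toNNReal {k} =
      ENNReal.ofReal (Real.exp (-m) * ((m * Real.exp (-c) ^ l) ^ k / k.factorial)) := by
    intro k
    rw [poissonMeasure_singleton, hr, ← Nat.cast_mul, expNeg_natCast,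
      ← ENNReal.ofReal_mul (by positivity)]
    congr 1
    rw [mul_pow, pow_mul]
    ring
  have hs := (NormedSpace.expSeries_div_hasSum_exp (m * Real.exp (-c) ^ l)).mul_left (Real.exp (-m))
  rw [← Real.exp_eq_exp_ℝ, ← Real.exp_add] at hs
  rw [tsum_congr hterm, ← ENNReal.ofReal_tsum_of_nonneg (fun k => by positivity) hs.summable,
    hs.tsum_eq]
  congr 2
  ring

variable {Ω E : Type*} [MeasurableSpace Ω] [MeasurableSpace E] [MeasurableSingletonClass E]
  {Λ : Measure E} {N : Ω → Measure E} {Q : Measure Ω}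

/-- The Laplace transform of a sum over finitely many points: the numbers of points of the process at
different places are independent Poisson variables. -/
lemma IsPoissonProcess.lintegral_prod_expNeg (hN : IsPoissonProcess Λ N Q) {m : E → ℝ}
    (hm : ∀ e, 0 ≤ m e) (hΛ : ∀ e, Λ {e} = ENNReal.ofReal (m e)) (f : E → ℕ) (c : NNReal)
    (F : Finset E) :
    ∫⁻ ω, ∏ e ∈ F, expNeg c (f e * N ω {e}) ∂Q =
      ENNReal.ofReal (Real.exp (∑ e ∈ F, (Real.exp (-c) ^ f e - 1) * m e)) := by
  have hmeas : ∀ e, Measurable fun x : ℝ≥0∞ => expNeg c (f e * x) := fun e =>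
    (continuous_expNeg c).measurable.comp (measurable_const_mul _)
  have hNe : ∀ e, Measurable fun ω => N ω {e} := fun e =>
    (Measure.measurable_coe (measurableSet_singleton e)).comp hN.measurable
  set g : Fin F.card → E := fun i => (F.equivFin.symm i : E) with hg
  have hind := (hN.indep F.card (fun i => {g i}) (fun i => measurableSet_singleton _) (by
    intro i j hij
    refine Set.disjoint_singleton.2 fun h => hij ?_
    exact F.equivFin.symm.injective (Subtype.ext h))).comp
      (fun i x => expNeg c (f (g i) * x)) fun i => hmeas _
  have hprod : ∀ φ : E → ℝ≥0∞, ∏ e ∈ F, φ e = ∏ i, φ (g i) := by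
    intro φ
    rw [← Finset.prod_coe_sort F φ]
    exact Fintype.prod_equiv F.equivFin _ _ fun e => by simp [hg]
  simp only [hprod]
  have h1 := lintegral_prod_eq_prod_lintegral_of_indepFun Finset.univ _ hind
    fun i => (hmeas _).comp (hNe _)
  refine h1.trans ?_
  rw [Real.exp_sum, ENNReal.ofReal_prod_of_nonneg fun e _ => (Real.exp_pos _).le, hprod]
  refine Finset.prod_congr rfl fun i _ => ?_
  rw [← lintegral_expNeg_poissonLaw c (f (g i)) (hm (g i)), ← hΛ,
    ← hN.law {g i} (measurableSet_singleton _), lintegral_map (hmeas _) (hNe _)]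
  rfl

variable [Countable E]

/-- Campbell's formula for the Laplace transform of the sum of `f` over a Poisson process. -/
lemma IsPoissonProcess.lintegral_expNeg [IsProbabilityMeasure Q] (hN : IsPoissonProcess Λ N Q)
    {m : E → ℝ} (hm : ∀ e, 0 ≤ m e) (hΛ : ∀ e, Λ {e} = ENNReal.ofReal (m e)) (hs : Summable m)
    (f : E → ℕ) (c : NNReal) :
    ∫⁻ ω, expNeg c (∫⁻ e, f e ∂(N ω)) ∂Q =
      ENNReal.ofReal (Real.exp (∑' e, (Real.exp (-c) ^ f e - 1) * m e)) := by
  have hNe : ∀ e, Measurable fun ω => N ω {e} := fun e =>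
    (Measure.measurable_coe (measurableSet_singleton e)).comp hN.measurable
  have hterm : ∀ e, Measurable fun ω => expNeg c (f e * N ω {e}) := fun e =>
    (continuous_expNeg c).measurable.comp ((hNe e).const_mul _)
  have hle : Real.exp (-c) ≤ 1 := Real.exp_le_one_iff.2 (by simp)
  have hs' : Summable fun e => (Real.exp (-c) ^ f e - 1) * m e := by
    refine Summable.of_norm_bounded hs fun e => ?_
    rw [norm_mul, Real.norm_of_nonneg (hm e)]
    refine mul_le_of_le_one_left (hm e) ?_
    rw [Real.norm_eq_abs, abs_le]
    have h1 : 0 ≤ Real.exp (-c) ^ f e := by positivity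
    have h2 : Real.exp (-c) ^ f e ≤ 1 := pow_le_one₀ (Real.exp_pos _).le hle
    constructor <;> linarith
  have hlim1 : Filter.Tendsto (fun F : Finset E => ∫⁻ ω, ∏ e ∈ F, expNeg c (f e * N ω {e}) ∂Q)
      Filter.atTop (nhds (∫⁻ ω, expNeg c (∫⁻ e, f e ∂(N ω)) ∂Q)) := by
    refine tendsto_lintegral_filter_of_dominated_convergence (fun _ => 1)
      (Filter.Eventually.of_forall fun F => Finset.measurable_fun_prod _ fun e _ => hterm e)
      (Filter.Eventually.of_forall fun F => Filter.Eventually.of_forall fun ω =>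
        Finset.prod_le_one' fun e _ => expNeg_le_one _ _) (by simp)
      (Filter.Eventually.of_forall fun ω => ?_)
    simp only [← expNeg_sum]
    rw [lintegral_countable']
    exact ((continuous_expNeg c).tendsto _).comp ENNReal.summable.hasSum
  have hlim2 : Filter.Tendsto (fun F : Finset E =>
      ENNReal.ofReal (Real.exp (∑ e ∈ F, (Real.exp (-c) ^ f e - 1) * m e))) Filter.atTop
      (nhds (ENNReal.ofReal (Real.exp (∑' e, (Real.exp (-c) ^ f e - 1) * m e)))) :=
    ((ENNReal.continuous_ofReal.comp Real.continuous_exp).tendsto _).comp hs'.hasSum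
  simp only [hN.lintegral_prod_expNeg hm hΛ f c] at hlim1
  exact tendsto_nhds_unique hlim1 hlim2

lemma IsPoissonProcess.exists_lintegral_eq (hN : IsPoissonProcess Λ N Q) (f : E → ℕ) :
    ∀ᵐ ω ∂Q, ∃ k : ℕ∞, ∫⁻ e, f e ∂(N ω) = k := by
  filter_upwards [hN.integer_valued] with ω hω
  choose k hk using fun e => hω {e} (measurableSet_singleton e)
  rw [lintegral_countable']
  have hmem := ENat.isClosedEmbedding_toENNReal.isClosed_range.mem_of_tendsto
    (ENNReal.summable (f := fun e => (f e : ℝ≥0∞) * N ω {e})).hasSum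
    (Filter.Eventually.of_forall fun F => ?_)
  · obtain ⟨j, hj⟩ := hmem
    exact ⟨j, hj.symm⟩
  · induction F using Finset.cons_induction with
    | empty => exact ⟨0, by simp⟩
    | cons e F he ih =>
      obtain ⟨j, hj⟩ := ih
      refine ⟨f e * k e + j, ?_⟩
      rw [ENat.toENNReal_add, ENat.toENNReal_mul, hj, Finset.sum_cons, hk]
      simp

end PoissonProcess

/-! ### The set of unbased loops -/

section Countability

variable {V : Type*} [Countable V] (G : SimpleGraph V)

instance : Countable (BasedLoop G) := by
  refine Function.Injective.countable (f := fun γ : BasedLoop G => γ.2.support) ?_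
  rintro ⟨x, w⟩ ⟨y, w'⟩ h
  have h' : w.support = w'.support := h
  have hxy : x = y := by
    rw [← w.cons_tail_support, ← w'.cons_tail_support] at h'
    exact (List.cons.inj h').1
  subst hxy
  rw [SimpleGraph.Walk.ext_support h']

instance : Countable (UnbasedLoop G) :=
  inferInstanceAs (Countable (Quot (IsShift G)))

instance : DiscreteMeasurableSpace (UnbasedLoop G) := ⟨fun _ => trivial⟩

end Countability

lemma loopIntensity_singleton {V : Type*} [Fintype V] [DecidableEq V] (G : SimpleGraph V)
    (W : Matrix V V ℝ) (α : Cycle V → ℝ) (ℓ : UnbasedLoop G) :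
    loopIntensity G W α {ℓ} = ENNReal.ofReal (loopMass W α ℓ) := by
  rw [loopIntensity, Measure.sum_apply _ (measurableSet_singleton ℓ), tsum_eq_single ℓ]
  · simp
  · intro ℓ' h
    simp [h]

end CyclePopping

end

open CyclePopping in
theorem corollary5p8 {V : Type*} [Fintype V] [DecidableEq V] [MeasurableSpace V]
    [MeasurableSingletonClass V] (G : SimpleGraph V) (hG : G.Connected)
    (hn : 1 < Fintype.card V)
    (W : Matrix V V ℝ) (hW : CyclePopping.IsEdgeWeight G W)
    (α : Cycle V → ℝ)
    (hα : ∀ c, CyclePopping.IsOrientedCycle G c → α c ∈ Set.Icc (0 : ℝ) 1)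
    (hpos : ∃ c, CyclePopping.IsOrientedCycle G c ∧ 0 < α c)
    (ι : Fin (Fintype.card V) ≃ V)
    {Ω : Type*} [MeasurableSpace Ω] (P : Measure Ω) [IsProbabilityMeasure P]
    (X : V → ℕ → Ω → V) (B : V → CyclePopping.OrientedCycle G → ℕ → Ω → Bool)
    (hXB : CyclePopping.IsRandomInput W α P X B)
    {Ω' : Type*} [MeasurableSpace Ω'] (Q : Measure Ω') [IsProbabilityMeasure Q]
    (N : Ω' → Measure (CyclePopping.UnbasedLoop G))
    (hN : CyclePopping.IsPoissonProcess (CyclePopping.loopIntensity G W α) N Q) :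
    -- the algorithm terminates almost surely
    (∀ᵐ ω ∂P, CyclePopping.runningTime ι X B ω < ⊤) ∧
    -- equality in law of `T` and of `n` plus the sum of the lengths of the loops of the process
    IdentDistrib
      (fun ω => ((CyclePopping.runningTime ι X B ω : ℕ∞) : ℝ≥0∞))
      (fun ω' => (Fintype.card V : ℝ≥0∞) + ∫⁻ ℓ, (ℓ.length : ℝ≥0∞) ∂(N ω')) P Q ∧
    -- the generating function of `T`, the total intensity being finite
    Summable (fun ℓ : CyclePopping.UnbasedLoop G => CyclePopping.loopMass W α ℓ) ∧
    ∀ t ∈ Set.Ioc (0 : ℝ) 1,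
      ∫ ω, t ^ (CyclePopping.runningTime ι X B ω).toNat ∂P =
        t ^ Fintype.card V * Real.exp (∑' ℓ : CyclePopping.UnbasedLoop G,
          (t ^ ℓ.length - 1) * CyclePopping.loopMass W α ℓ) := by
  have hstep : CyclePopping.IsStepLaw (transition W) (eraseProb G α) := isStepLaw hG hn hW hα
  have hD1 := cycleSum_one_pos hG hW hpos hstep
  have hfin := runningTime_lt_top hW hstep hα hD1 hXB ι
  have hsum := summable_loopMass hW hstep hD1
  refine ⟨hfin, ?_, hsum, fun t ht =>
    integral_pow_runningTime hW hstep hα hD1 hXB ι ⟨ht.1.le, ht.2⟩⟩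
  have hT : Measurable fun ω => ((runningTime ι X B ω : ℕ∞) : ℝ≥0∞) :=
    (measurable_of_countable ENat.toENNReal).comp (hXB.measurable_runningTime ι)
  have hS : Measurable fun ω' => (Fintype.card V : ℝ≥0∞) + ∫⁻ ℓ, (ℓ.length : ℝ≥0∞) ∂(N ω') :=
    ((Measure.measurable_lintegral (measurable_of_countable _)).comp hN.measurable).const_add _
  refine identDistrib_of_lintegral_expNeg hT hS ?_ ?_ fun c hc => ?_
  · filter_upwards [hfin] with ω hω
    obtain ⟨k, hk⟩ := ENat.ne_top_iff_exists.1 hω.ne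
    exact ⟨k, by rw [← hk, ENat.toENNReal_coe]⟩
  · filter_upwards [hN.exists_lintegral_eq fun ℓ => ℓ.length] with ω hω
    obtain ⟨k, hk⟩ := hω
    exact ⟨Fintype.card V + k, by rw [hk, ENat.toENNReal_add, ENat.toENNReal_coe]⟩
  · have hle : Real.exp (-c) ≤ 1 := Real.exp_le_one_iff.2 (by simp)
    simp only [expNeg_toENNReal hc, expNeg_add, expNeg_natCast]
    rw [lintegral_stepGen_runningTime hW hstep hα hD1 hXB ι ⟨(Real.exp_pos _).le, hle⟩,
      lintegral_const_mul' _ _ ENNReal.ofReal_ne_top,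
      hN.lintegral_expNeg (loopMass_nonneg hstep) (loopIntensity_singleton G W α) hsum,
      ENNReal.ofReal_mul (by positivity)]
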